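/- **Algebras.** Let $K$ be a division ring, $Q$ a finite quiver with head and tail maps $h,t$, and $\sigma_a$ ($a$ an arrow) automorphisms of $K$. The semilinear path algebra $K_{\boldsymbol\sigma}Q$ is the $K$-ring generated by orthogonal idempotents $e_i$ ($i$ a vertex) with sum $1$ and by the arrows $a$, subject to $e_{h(a)}a=a=ae_{t(a)}$, $e_i\lambda=\lambda e_i$ and $a\lambda=\sigma_a(\lambda)a$ ($\lambda\in K$). Fix a set of special loops in $Q$ (other arrows are ordinary), for each special loop $s$ a quadratic $q_s(x)=x^2-\beta_sx+\gamma_s\in K[x;\sigma_s]$, where $x\lambda=\sigma_s(\lambda)x$, and a set $Z$ of paths of length at least $2$, none of which starts or ends with a special loop or contains $s^2$ with $s$ special. Let $R=K_{\boldsymbol\sigma}Q/I$, where $I$ is generated by $Z$ and the elements $s^2-\beta_ss+\gamma_se_{h(s)}$ ($s$ special). Assume that $R$ is a semilinear clannish algebra: at most two arrows have any given tail, at most two have any given head, and for each ordinary arrow $a$ there is at most one arrow $c$ with $ca$ a path not in $Z$, and at most one arrow $c$ with $ac$ a path not in $Z$. Assume also that each $q_s$ is normal ($q_sK[x;\sigma_s]=K[x;\sigma_s]q_s$),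 that $\gamma_s\ne0$, and that $K[x;\sigma_s]/\langle q_s\rangle$ is semisimple artinian. Finite-dimensional $R$-modules are left $R$-modules that are finite-dimensional over $K$. **Words.** Letters are $a$ and $a^{-1}$ for $a$ an ordinary arrow and $s^*=(s^*)^{-1}$ for $s$ a special loop; $a$ and $s^*$ have the head and tail of the arrow, and inversion exchanges head and tail. For an arrow $a$ let $a^*$ be $a$ if $a$ is ordinary and the $*$-letter if $a$ is special; for a path $r=a_1\cdots a_m$ let $r^*=a_1^*\cdots a_m^*$. Fix signs $\pm1$ of the letters such that distinct letters with the same head and sign are of the form $a^{-1},b$ with $ab\in Z$. A word $w$ with index set $I=\{0,\dots,n\}$ (finite, of length $n$) or $I=\mathbb Z$ consists of letters $w_i$ ($i,i-1\in I$), vertices $v_i(w)$ ($i\in I$) and a sign $\epsilon$ such that $w_i$ has head $v_{i-1}(w)$ and tail $v_i(w)$, consecutive letters $w_i,w_{i+1}$ are such that $w_i^{-1}$ and $w_{i+1}$ have opposite signs, $w_1$ has sign $\epsilon$ if it exists, and $w_0^{-1}$ has sign $-\epsilon$ if it exists. The inverse $w^{-1}$ is obtained by inverting the letters and reversing their order,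 with $(w^{-1})_i=(w_{-i})^{-1}$ if $I=\mathbb Z$; inverting a word of length $0$ changes its sign. The shift $w[m]$ of a $\mathbb Z$-indexed word has $w[m]_i=w_{m+i}$; shifts do not affect finite words. Words $u,w$ are equivalent if $u=w[m]$ or $u=w^{-1}[m]$ for some $m\in\mathbb Z$. A word $w$ is relation-admissible if neither $w$ nor $w^{-1}$ contains, as consecutive letters, $r^*$ for some $r\in Z$. A finite word $w$ is end-admissible if there is no special loop $s$ such that $ws^*$ or $w^{-1}s^*$ is a word. A string is a finite end-admissible relation-admissible word, and it is symmetric if $w=w^{-1}$; a band is a $\mathbb Z$-indexed relation-admissible word $w$ with $w[m]=w$ for some $m>0$ (the least such $m$ is its period), and it is symmetric if $w^{-1}$ is a shift of $w$. For $i\in I$ let $w_{>i}=w_{i+1}w_{i+2}\cdots$ and $(w_{\le i})^{-1}=w_i^{-1}w_{i-1}^{-1}\cdots$. One-sided words with the same head and sign are ordered by: $u\,y\cdots<u\,x^{-1}\cdots$, $u\,y\cdots<u$ and $u<u\,x^{-1}\cdots$, for $u$ a finite word and $x,y$ ordinary arrows. An index $i$ with $w_i$ a $*$-letter is a symmetry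 if $(w_{\le i-1})^{-1}=w_{>i}$, naturally direct if $(w_{\le i-1})^{-1}>w_{>i}$, and naturally inverse if $(w_{\le i-1})^{-1}<w_{>i}$. Let $\Omega$ be a set of representatives of the equivalence classes of strings and bands. **The sets $J_w$.** $J_w=\{0,\dots,n\}$ for an asymmetric string of length $n$; $J_w=\{0,\dots,k\}$ for a symmetric string of length $2k+1$; $J_w=\{0,\dots,n-1\}$ for an asymmetric band of period $n$; $J_w=\{-p,\dots,r\}$ for a symmetric band, where $-p$ is its largest symmetry $\le0$ and $r+1$ its smallest symmetry $>0$. **The functors $F_{C_w}$.** A walk $C$ is defined like a word, but with letters $a$ and $a^{-1}$ for all arrows $a$, such that replacing each letter $s^{\pm1}$ with $s$ special by $s^*$ gives a word. For a string or band $w$, the walk $C=C_w$ is obtained by replacing each $w_i=s^*$ by $s$ if $i$ is naturally direct or is a symmetry with $i\le0$, and by $s^{-1}$ if $i$ is naturally inverse or is a symmetry with $i>0$. Its quiver $Q_C$ has vertex set $I$, with an arrow $i\to i-1$ labelled $a$ if $C_i=a$, and an arrow $i-1\to i$ labelled $a$ if $C_i=a^{-1}$. Let $M(C)$ be the $R$-module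 with generators $b_i$ ($i\in I$) and relations $e_\ell b_i=b_i$ for $\ell=v_i(C)$; $ab_i=b_j$ for each arrow $i\to j$ of $Q_C$ labelled $a$; and $ab_i=0$ if $a$ is an ordinary arrow with tail $v_i(C)$ and no arrow of $Q_C$ with tail $i$ is labelled $a$. Choose automorphisms $\pi_i$ of $K$ with $\pi_j=\sigma_a\pi_i$ for each arrow $i\to j$ of $Q_C$ labelled $a$; then $M(C)$ is an $R$-$K$-bimodule with $b_i\lambda=\pi_i(\lambda)b_i$, so that $T_C(M)=\operatorname{Hom}_R(M(C),M)$ is a left $K$-module for every $R$-module $M$. For a vertex $\ell$ and a sign $\epsilon$ let $1^-_{\ell,\epsilon}(M)=b\,e_{t(b)}M$ if there is an arrow $b$ with head $\ell$ such that $b^*$ has sign $\epsilon$ (there is at most one), and $1^-_{\ell,\epsilon}(M)=0$ otherwise. If $I=\mathbb Z$, let $B_C^+(M)$ (respectively $B_C^-(M)$) be the set of $\theta\in T_C(M)$ with $\theta(b_i)=0$ for $i\ll0$ (respectively $i\gg0$). If $I=\{0,\dots,n\}$, let $B_C^+(M)$ be the set of $\theta\in T_C(M)$ with $\theta(b_0)\in1^-_{v_0(C),-\epsilon}(M)$,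 and $B_C^-(M)$ the set of those with $\theta(b_n)\in1^-_{v_n(C),-\epsilon'}(M)$, where $\epsilon,\epsilon'$ are the signs of $C$ and $C^{-1}$. Let $B_C=B_C^++B_C^-$ and $F_C=T_C/B_C$, a functor from $R$-modules to left $K$-modules. **Theorem.** Let $M,M'$ be finite-dimensional $R$-modules and $\theta:M\to M'$ an $R$-module homomorphism. (i) Each $F_{C_w}(M)$ with $w\in\Omega$ is finite-dimensional over $K$, $F_{C_w}(M)=0$ for all but finitely many $w\in\Omega$, and $$\dim_KM=\sum_{w\in\Omega}|J_w|\,\dim_KF_{C_w}(M).$$ (ii) If $F_{C_w}(\theta)$ is an isomorphism for all $w\in\Omega$, then $\theta$ is an isomorphism. -/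

import Mathlib

noncomputable section

/-! ### Skew polynomial rings and quadratics -/

namespace SkewQuadratic

variable {K : Type*} [DivisionRing K]

/-- The action of the monoid `{x ^ n}` on `K` in which `x` acts as the automorphism `σ`. -/
abbrev action (σ : RingAut K) : MulSemiringAction (Multiplicative ℕ) K :=
  MulSemiringAction.compHom K (powersHom (RingAut K) σ)

/-- The skew polynomial ring `K[x; σ]`, in which `x * c = σ c * x` for `c` in `K`. -/
def SkewPoly (_σ : RingAut K) : Type _ := SkewPolynomial K

instance (σ : RingAut K) : Ring (SkewPoly σ) :=
  letI := action σ
  inferInstanceAs (Ring (SkewPolynomial K))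

/-- The variable `x` of `K[x; σ]`. -/
def X (σ : RingAut K) : SkewPoly σ := (SkewPolynomial.X : SkewPolynomial K)

/-- The constant polynomials in `K[x; σ]`. -/
def C (σ : RingAut K) (c : K) : SkewPoly σ := (SkewPolynomial.C c : SkewPolynomial K)

/-- The monic quadratic `x ^ 2 - β x + γ` in `K[x; σ]`. -/
def quadratic (σ : RingAut K) (β γ : K) : SkewPoly σ :=
  X σ ^ 2 - C σ β * X σ + C σ γ

/-- An element `q` of a ring `S` is normal if `q S = S q`. -/
def IsNormalElement {S : Type*} [Ring S] (q : S) : Prop :=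
  Set.range (fun r : S => q * r) = Set.range (fun r : S => r * q)

end SkewQuadratic

/-! ### Semilinear path algebras and semilinear clannish algebras -/

/-- Generators of the semilinear path algebra: scalars, vertices (trivial paths) and arrows. -/
inductive SCGen (K V A : Type*) where
  | scalar (c : K)
  | vertex (v : V)
  | arrow (a : A)

/-- The data of a semilinear clannish algebra over `K` on a quiver with vertex set `V` and arrow
set `A`: head and tail maps, automorphisms `σ a`, a set of special loops `s`, with quadratics
`x ^ 2 - β s x + γ s` (the values of `β` and `γ` at arrows that are not special play no role), and
a set `Z` of zero relations. A path `a₁ a₂ ⋯ aₙ` is the list `[a₁, a₂, …, aₙ]`. -/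
structure SCData (K V A : Type*) [DivisionRing K] where
  head : A → V
  tail : A → V
  σ : A → RingAut K
  special : Set A
  β : A → K
  γ : A → K
  Z : Set (List A)

namespace SCData

variable {K V A : Type*} [DivisionRing K] (D : SCData K V A)

/-- A list `[a₁, …, aₙ]` of arrows is a path if the tail of `aᵢ` is the head of `aᵢ₊₁`. -/
def IsPath (p : List A) : Prop := p.IsChain (fun a b => D.tail a = D.head b)

/-- The conditions on the data defining a semilinear clannish algebra. -/
structure IsClannish : Prop where
  special_loop : ∀ s ∈ D.special, D.head s = D.tail s
  zero_isPath : ∀ r ∈ D.Z, D.IsPath r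
  zero_length : ∀ r ∈ D.Z, 2 ≤ r.length
  zero_head : ∀ r ∈ D.Z, ∀ a ∈ r.head?, a ∉ D.special
  zero_last : ∀ r ∈ D.Z, ∀ a ∈ r.getLast?, a ∉ D.special
  zero_square : ∀ r ∈ D.Z, ∀ s ∈ D.special, ¬ [s, s] <:+: r
  tail_le_two : ∀ v, {a | D.tail a = v}.encard ≤ 2
  head_le_two : ∀ v, {a | D.head a = v}.encard ≤ 2
  left_unique : ∀ a, a ∉ D.special → {c | D.tail c = D.head a ∧ [c, a] ∉ D.Z}.Subsingleton
  right_unique : ∀ a, a ∉ D.special → {c | D.tail a = D.head c ∧ [a, c] ∉ D.Z}.Subsingleton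

/-- The quadratic `q_s(x) = x ^ 2 - β_s x + γ_s` in `K[x; σ_s]`. -/
def quad (s : A) : SkewQuadratic.SkewPoly (D.σ s) :=
  SkewQuadratic.quadratic (D.σ s) (D.β s) (D.γ s)

/-- Normally bound: every `q_s` is a normal element of `K[x; σ_s]`. -/
def IsNormallyBound : Prop := ∀ s ∈ D.special, SkewQuadratic.IsNormalElement (D.quad s)

/-- Of non-singular type: every `q_s` has non-zero constant term. -/
def IsNonSingularType : Prop := ∀ s ∈ D.special, D.γ s ≠ 0

/-- Of semisimple type: every `K[x; σ_s] / ⟨q_s⟩` is a semisimple artinian ring. -/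
def IsSemisimpleType : Prop :=
  ∀ s ∈ D.special, IsSemisimpleRing (TwoSidedIdeal.span {D.quad s}).ringCon.Quotient

/-! #### The ring -/

section Ring

variable [Fintype V]

/-- The free ring on scalars, vertices and arrows. -/
abbrev Free (_D : SCData K V A) : Type _ := FreeAlgebra ℤ (SCGen K V A)

/-- Free generator: a scalar. -/
def fS (c : K) : D.Free := FreeAlgebra.ι ℤ (SCGen.scalar c)

/-- Free generator: a vertex. -/
def fV (v : V) : D.Free := FreeAlgebra.ι ℤ (SCGen.vertex v)

/-- Free generator: an arrow. -/
def fA (a : A) : D.Free := FreeAlgebra.ι ℤ (SCGen.arrow a)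

/-- Defining relations of the semilinear path algebra. The first three make it a `K`-ring. -/
inductive PathRel : D.Free → D.Free → Prop
  | scalar_one : PathRel (D.fS 1) 1
  | scalar_add (c d : K) : PathRel (D.fS (c + d)) (D.fS c + D.fS d)
  | scalar_mul (c d : K) : PathRel (D.fS (c * d)) (D.fS c * D.fS d)
  | vertex_idem (v : V) : PathRel (D.fV v * D.fV v) (D.fV v)
  | vertex_orth (v w : V) (h : v ≠ w) : PathRel (D.fV v * D.fV w) 0
  | vertex_sum : PathRel (∑ v, D.fV v) 1
  | head_mul (a : A) : PathRel (D.fV (D.head a) * D.fA a) (D.fA a)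
  | mul_tail (a : A) : PathRel (D.fA a * D.fV (D.tail a)) (D.fA a)
  | vertex_scalar (v : V) (c : K) : PathRel (D.fV v * D.fS c) (D.fS c * D.fV v)
  | arrow_scalar (a : A) (c : K) : PathRel (D.fA a * D.fS c) (D.fS (D.σ a c) * D.fA a)

/-- The semilinear path algebra `K_σ Q`. -/
def PathAlgebra : Type _ := RingQuot D.PathRel

instance : Ring D.PathAlgebra := inferInstanceAs (Ring (RingQuot D.PathRel))

/-- The quotient map from the free ring to the semilinear path algebra. -/
def toPath : D.Free →+* D.PathAlgebra := RingQuot.mkRingHom D.PathRel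

/-- The defining relations of `R` over the path algebra: `r = 0` for `r` in `Z`, and
`s ^ 2 - β_s s + γ_s e_i = 0` for a special loop `s` at `i`. -/
inductive AlgRel : D.PathAlgebra → D.PathAlgebra → Prop
  | zero (r : List A) (h : r ∈ D.Z) : AlgRel ((r.map fun a => D.toPath (D.fA a)).prod) 0
  | quad (s : A) (h : s ∈ D.special) :
      AlgRel (D.toPath (D.fA s) ^ 2 - D.toPath (D.fS (D.β s)) * D.toPath (D.fA s)
        + D.toPath (D.fS (D.γ s)) * D.toPath (D.fV (D.head s))) 0

/-- The ring `R = K_σ Q / I`. -/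
def Alg : Type _ := RingQuot D.AlgRel

instance : Ring D.Alg := inferInstanceAs (Ring (RingQuot D.AlgRel))

/-- The quotient map from the free ring to `R`. -/
def toAlg : D.Free →+* D.Alg := (RingQuot.mkRingHom D.AlgRel).comp D.toPath

/-- The trivial path `e_v` in `R`. -/
def e (v : V) : D.Alg := D.toAlg (D.fV v)

/-- The arrow `a` in `R`. -/
def arr (a : A) : D.Alg := D.toAlg (D.fA a)

theorem toAlg_rel {x y : D.Free} (h : D.PathRel x y) : D.toAlg x = D.toAlg y :=
  congrArg (RingQuot.mkRingHom D.AlgRel) (RingQuot.mkRingHom_rel h)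

/-- The structure homomorphism `K → R`. -/
def scalar : K →+* D.Alg where
  toFun c := D.toAlg (D.fS c)
  map_one' := by rw [D.toAlg_rel PathRel.scalar_one, map_one]
  map_mul' c d := by rw [D.toAlg_rel (PathRel.scalar_mul c d), map_mul]
  map_add' c d := by rw [D.toAlg_rel (PathRel.scalar_add c d), map_add]
  map_zero' := by
    have h := D.toAlg_rel (PathRel.scalar_add (0 : K) 0)
    rw [map_add, add_zero] at h
    exact left_eq_add.mp h

/-- `R` as a left `K`-module, via `K → R`. -/
instance : Module K D.Alg := Module.compHom D.Alg D.scalar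

theorem smul_def (c : K) (x : D.Alg) : c • x = D.scalar c * x := rfl

theorem e_mul_scalar (v : V) (c : K) : D.e v * D.scalar c = D.scalar c * D.e v := by
  have h := D.toAlg_rel (PathRel.vertex_scalar v c)
  rwa [map_mul, map_mul] at h

theorem arr_mul_scalar (a : A) (c : K) : D.arr a * D.scalar c = D.scalar (D.σ a c) * D.arr a := by
  have h := D.toAlg_rel (PathRel.arrow_scalar a c)
  rwa [map_mul, map_mul] at h

theorem scalar_smul {M : Type*} [AddCommGroup M] [Module D.Alg M] [Module K M]
    [IsScalarTower K D.Alg M] (c : K) (m : M) : D.scalar c • m = c • m := by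
  have h := smul_assoc c (1 : D.Alg) m
  rwa [smul_def, mul_one, one_smul] at h

end Ring

end SCData

/-! ### Words, strings and bands

Strings are indexed by `{0, …, n}` and bands by `ℤ`, so only these two index sets are used. -/

/-- The index sets `{0, …, n}` and `ℤ`. -/
inductive SCShape where
  | finite (n : ℕ)
  | full

/-- The index set `I` as a set of integers. -/
def SCShape.index : SCShape → Set ℤ
  | finite n => Set.Icc 0 (n : ℤ)
  | full => Set.univ

/-- The underlying data of a word or walk `w` with letters in `L`: its index set `I`, the letters
`w_i` (present for those `i` with `i, i - 1 ∈ I`), the vertices `v_i(w)` (present for `i ∈ I`), and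
its sign. -/
@[ext]
structure SCStrand (L V : Type*) where
  shape : SCShape
  letter : ℤ → Option L
  vertex : ℤ → Option V
  sign : ℤˣ

/-- Letters of walks: an arrow `a` or its formal inverse. -/
inductive SCWalkLetter (A : Type*) where
  | dir (a : A)
  | inv (a : A)

namespace SCData

variable {K V A : Type*} [DivisionRing K] (D : SCData K V A)

/-- Letters of words: `a` and `a⁻¹` for `a` an ordinary arrow, and `s^*` for `s` a special loop. -/
inductive Letter where
  | dir (a : A) (h : a ∉ D.special)
  | inv (a : A) (h : a ∉ D.special)
  | star (s : A) (h : s ∈ D.special)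

namespace Letter

variable {D}

/-- The head of a letter. -/
def head : D.Letter → V
  | dir a _ => D.head a
  | inv a _ => D.tail a
  | star s _ => D.head s

/-- The tail of a letter. -/
def tail : D.Letter → V
  | dir a _ => D.tail a
  | inv a _ => D.head a
  | star s _ => D.tail s

/-- The inverse of a letter. -/
def inverse : D.Letter → D.Letter
  | dir a h => inv a h
  | inv a h => dir a h
  | star s h => star s h

/-- The letter `a^*`: this is `a` for `a` ordinary and the `*`-letter for `a` special. -/
def ofArrow (D : SCData K V A) (a : A) : D.Letter :=
  open Classical in if h : a ∈ D.special then star a h else dir a h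

end Letter

/-- A choice of signs of the letters: if distinct letters have the same head and sign, then
they are `a⁻¹` and `b` for some zero relation `ab`. -/
structure SignChoice where
  sgn : D.Letter → ℤˣ
  eq_of_sgn_eq : ∀ x y : D.Letter, x ≠ y → x.head = y.head → sgn x = sgn y →
    ∃ (a b : A) (ha : a ∉ D.special) (hb : b ∉ D.special), [a, b] ∈ D.Z ∧
      ((x = Letter.inv a ha ∧ y = Letter.dir b hb) ∨ (x = Letter.dir b hb ∧ y = Letter.inv a ha))

/-- Data of words and of walks. -/
abbrev Word : Type _ := SCStrand D.Letter V

/-- Data of walks. -/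
abbrev Walk (_D : SCData K V A) : Type _ := SCStrand (SCWalkLetter A) V

/-- The word `C^*` underlying a walk `C`. -/
def Walk.star {D : SCData K V A} (C : D.Walk) : D.Word where
  shape := C.shape
  letter i := (C.letter i).map fun
    | .dir a => Letter.ofArrow D a
    | .inv a => (Letter.ofArrow D a).inverse
  vertex := C.vertex
  sign := C.sign

section Order

/-! #### Subwords, the ordering of one-sided words, symmetries, and the canonical walk -/

variable {D}

/-- `w` contains, as consecutive letters, the sequence `r^*`. -/
def Contains (w : D.Word) (r : List A) : Prop :=
  ∃ i : ℤ, ∀ (j : ℕ) (h : j < r.length), w.letter (i + j) = some (Letter.ofArrow D r[j])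

/-- The sequence of letters of `w_{>i}`, ending in `none` for a finite word. -/
def after (w : D.Word) (i : ℤ) : ℕ → Option D.Letter := fun j => w.letter (i + 1 + j)

/-- The sequence of letters of `(w_{≤i})⁻¹`, ending in `none` for a finite word. -/
def before (w : D.Word) (i : ℤ) : ℕ → Option D.Letter :=
  fun j => (w.letter (i - j)).map Letter.inverse

/-- The ordering on one-sided words `f`, `g` with the same head and sign: with `u` the common part
of length `k`, either (a) `f = u y ⋯` and `g = u x⁻¹ ⋯`, or (b) `f = u y ⋯` and `g = u`, or
(c) `f = u` and `g = u x⁻¹ ⋯`, where `x`, `y` are ordinary arrows. -/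
def SeqLT (f g : ℕ → Option D.Letter) : Prop :=
  ∃ k : ℕ, (∀ j < k, f j = g j ∧ (f j).isSome) ∧
    ((∃ x hx y hy, f k = some (.dir y hy) ∧ g k = some (.inv x hx)) ∨
     (∃ y hy, f k = some (.dir y hy) ∧ g k = none) ∨
     (∃ x hx, f k = none ∧ g k = some (.inv x hx)))

/-- `w_i` is a `*`-letter and `(w_{≤i-1})⁻¹ = w_{>i}`. -/
def IsSymmetry (w : D.Word) (i : ℤ) : Prop :=
  (∃ s hs, w.letter i = some (.star s hs)) ∧ before w (i - 1) = after w i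

/-- The position `i` of a `*`-letter is naturally direct if `(w_{≤i-1})⁻¹ > w_{>i}`. It is a
symmetry if there is equality, and naturally inverse otherwise. -/
def IsNaturallyDirect (w : D.Word) (i : ℤ) : Prop :=
  SeqLT (after w i) (before w (i - 1))

variable (D) in
open Classical in
/-- The canonically associated walk `C_w`: a letter `s^*` at position `i` becomes `s` if `i` is
naturally direct, or `i` is a symmetry and `i ≤ 0`; it becomes `s⁻¹` if `i` is naturally inverse, or
`i` is a symmetry and `i > 0`. -/
def canonicalWalk (w : D.Word) : D.Walk where
  shape := w.shape
  letter i := (w.letter i).map fun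
    | .dir a _ => .dir a
    | .inv a _ => .inv a
    | .star s _ =>
      if IsNaturallyDirect w i ∨ (IsSymmetry w i ∧ i ≤ 0) then .dir s else .inv s
  vertex := w.vertex
  sign := w.sign

end Order

namespace SignChoice

variable {D} (S : D.SignChoice)

/-- The conditions for the data `w` to be a word. -/
structure IsWord (w : D.Word) : Prop where
  letter_isSome : ∀ i, (w.letter i).isSome ↔ i ∈ w.shape.index ∧ i - 1 ∈ w.shape.index
  vertex_isSome : ∀ i, (w.vertex i).isSome ↔ i ∈ w.shape.index
  head_eq : ∀ i, ∀ x ∈ w.letter i, w.vertex (i - 1) = some x.head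
  tail_eq : ∀ i, ∀ x ∈ w.letter i, w.vertex i = some x.tail
  consecutive : ∀ i, ∀ x ∈ w.letter i, ∀ y ∈ w.letter (i + 1), S.sgn y = - S.sgn x.inverse
  sign_right : ∀ x ∈ w.letter 1, S.sgn x = w.sign
  sign_left : ∀ x ∈ w.letter 0, S.sgn x.inverse = - w.sign

/-- The inverse word, with `(w⁻¹)_i = (w_{n+1-i})⁻¹` for `w` of length `n` and
`(w⁻¹)_i = (w_{-i})⁻¹` for `w` indexed by `ℤ`. The sign of `w⁻¹` is that of its first letter
`(w⁻¹)_1`, and the inverse of a trivial word has the opposite sign. -/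
def inv (w : D.Word) : D.Word :=
  match w.shape with
  | .finite n =>
    { shape := .finite n
      letter := fun i => (w.letter (n + 1 - i)).map Letter.inverse
      vertex := fun i => w.vertex (n - i)
      sign := match w.letter n with
        | some x => S.sgn x.inverse
        | none => - w.sign }
  | .full =>
    { shape := .full
      letter := fun i => (w.letter (-i)).map Letter.inverse
      vertex := fun i => w.vertex (-i - 1)
      sign := match w.letter (-1) with
        | some x => S.sgn x.inverse
        | none => - w.sign }

/-- The shift `w[n]`, which has no effect on finite words. -/
def shift (w : D.Word) (n : ℤ) : D.Word :=
  match w.shape with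
  | .finite _ => w
  | .full =>
    { shape := .full
      letter := fun i => w.letter (n + i)
      vertex := fun i => w.vertex (n + i)
      sign := match w.letter (n + 1) with
        | some x => S.sgn x
        | none => w.sign }

/-- Equivalence of words: `u = w[n]` or `u = (w⁻¹)[n]` for some `n`. -/
def Equivalent (u w : D.Word) : Prop :=
  ∃ n : ℤ, u = S.shift w n ∨ u = S.shift (S.inv w) n

/-- Neither `w` nor `w⁻¹` contains `r^*` for a zero relation `r`. -/
def IsRelationAdmissible (w : D.Word) : Prop :=
  ∀ r ∈ D.Z, ¬ Contains w r ∧ ¬ Contains (S.inv w) r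

/-- There is no special loop `s` such that `w s^*` is a word; this product is defined if `w⁻¹` and
`s^*` have the same head and opposite signs. -/
def IsRightEndAdmissible (w : D.Word) : Prop :=
  match w.shape with
  | .finite n => ∀ (s : A) (h : s ∈ D.special),
      ¬ (w.vertex n = some (D.head s) ∧ S.sgn (Letter.star s h) = - (S.inv w).sign)
  | .full => True

/-- `w` and its inverse are right-end-admissible. -/
def IsEndAdmissible (w : D.Word) : Prop :=
  S.IsRightEndAdmissible w ∧ S.IsRightEndAdmissible (S.inv w)

/-- A string is a finite end-admissible relation-admissible word. -/
def IsString (w : D.Word) : Prop :=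
  S.IsWord w ∧ (∃ n, w.shape = .finite n) ∧ S.IsEndAdmissible w ∧ S.IsRelationAdmissible w

/-- A band is a relation-admissible periodic `ℤ`-indexed word. -/
def IsBand (w : D.Word) : Prop :=
  S.IsWord w ∧ w.shape = .full ∧ (∃ n : ℕ, 0 < n ∧ S.shift w n = w) ∧ S.IsRelationAdmissible w

/-- The period of a periodic word. -/
def period (w : D.Word) : ℕ := sInf {n : ℕ | 0 < n ∧ S.shift w n = w}

/-- `Ω` is a set of representatives of the equivalence classes of strings and bands. -/
structure IsRepresentatives (Ω : Set D.Word) : Prop where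
  mem : ∀ w ∈ Ω, S.IsString w ∨ S.IsBand w
  unique : ∀ w, S.IsString w ∨ S.IsBand w → ∃! z, z ∈ Ω ∧ S.Equivalent z w

open Classical in
/-- The finite set `J_w` for a string or band `w`:
* `{0, …, n}` for an asymmetric string of length `n`;
* `{0, …, k}` for a symmetric string of length `n = 2 k + 1`;
* `{0, …, n - 1}` for an asymmetric band of period `n`;
* `{-p, …, r}` for a symmetric band whose symmetries closest to `0` are `-p ≤ 0` and
  `r + 1 > 0`. -/
def J (w : D.Word) : Finset ℤ :=
  match w.shape with
  | .finite n => if S.inv w = w then Finset.Icc 0 ((n / 2 : ℕ) : ℤ) else Finset.Icc 0 (n : ℤ)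
  | .full =>
    if ∃ m : ℤ, S.inv w = S.shift w m then
      Finset.Ico (sSup {i : ℤ | i ≤ 0 ∧ IsSymmetry w i}) (sInf {i : ℤ | 0 < i ∧ IsSymmetry w i})
    else Finset.Ico 0 (S.period w : ℤ)

end SignChoice

/-! ### The modules `M(C)` and the functors `F_C` -/

/-- There is an arrow `i → j` in the quiver `Q_C`, which is sent to `a` in `Q`. -/
def Walk.HasArrow {D : SCData K V A} (C : D.Walk) (i j : ℤ) (a : A) : Prop :=
  (j = i - 1 ∧ C.letter i = some (.dir a)) ∨ (j = i + 1 ∧ C.letter (i + 1) = some (.inv a))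

/-- A choice of automorphisms `π_i` with `π_j = σ_a π_i` whenever there is an arrow `i → j` in `Q_C`
which is sent to `a`. -/
structure Twist (C : D.Walk) where
  π : ℤ → RingAut K
  compat : ∀ i j a, C.HasArrow i j a → π j = D.σ a * π i

/-- Such a choice exists, with `π_0` the identity. -/
theorem Twist.exists_zero_eq_one (C : D.Walk) : ∃ T : D.Twist C, T.π 0 = 1 := by
  let g : ℤ → RingAut K := fun i => match C.letter i with
    | some (.dir a) => (D.σ a)⁻¹
    | some (.inv a) => D.σ a
    | none => 1
  obtain ⟨p, hp0, hp⟩ : ∃ p : ℤ → RingAut K, p 0 = 1 ∧ ∀ i, p i = g i * p (i - 1) := by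
    let up : ℕ → RingAut K := fun n => Nat.rec 1 (fun k x => g ((k : ℤ) + 1) * x) n
    let dn : ℕ → RingAut K := fun n => Nat.rec 1 (fun k x => (g (-(k : ℤ)))⁻¹ * x) n
    refine ⟨fun i => if 0 ≤ i then up i.toNat else dn (-i).toNat, by simp [up], fun i => ?_⟩
    rcases lt_trichotomy i 0 with h | h | h
    · obtain ⟨k, rfl⟩ : ∃ k : ℕ, i = -((k : ℤ) + 1) := ⟨(-i - 1).toNat, by omega⟩
      have h1 : ¬ (0 : ℤ) ≤ -((k : ℤ) + 1) := by omega
      have h2 : ¬ (0 : ℤ) ≤ -((k : ℤ) + 1) - 1 := by omega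
      have h3 : (- -((k : ℤ) + 1)).toNat = k + 1 := by omega
      have h4 : (-(-((k : ℤ) + 1) - 1)).toNat = k + 1 + 1 := by omega
      simp only [h1, h2, h3, h4, if_false]
      have h5 : dn (k + 1 + 1) = (g (-((k : ℤ) + 1)))⁻¹ * dn (k + 1) := by
        simp only [dn]; push_cast; rfl
      rw [h5, mul_inv_cancel_left]
    · subst h
      simp [up, dn]
    · obtain ⟨k, rfl⟩ : ∃ k : ℕ, i = (k : ℤ) + 1 := ⟨(i - 1).toNat, by omega⟩
      have h1 : (0 : ℤ) ≤ (k : ℤ) + 1 := by omega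
      have h2 : (0 : ℤ) ≤ (k : ℤ) + 1 - 1 := by omega
      have h3 : ((k : ℤ) + 1).toNat = k + 1 := by omega
      have h4 : ((k : ℤ) + 1 - 1).toNat = k := by omega
      simp only [h1, h2, h3, h4, if_true]
      rfl
  refine ⟨⟨p, ?_⟩, hp0⟩
  rintro i j a (⟨rfl, h⟩ | ⟨rfl, h⟩)
  · have := hp i
    simp only [g, h] at this
    rw [this, mul_inv_cancel_left]
  · have := hp (i + 1)
    simpa only [g, h, add_sub_cancel_right] using this

section Functors

variable [Fintype V]

/-- The relations defining `M(C)`: (i) `e_ℓ b_i = b_i` for `ℓ = v_i(C)`; (ii) `a b_i = b_j` for an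
arrow `i → j` in `Q_C` sent to `a`; (iii) `a b_i = 0` for an ordinary arrow `a` with tail `v_i(C)`
such that no arrow in `Q_C` with tail `i` is sent to `a`. -/
inductive ModRel (C : D.Walk) : (C.shape.index →₀ D.Alg) → Prop
  | vertex (i : C.shape.index) (l : V) (h : C.vertex i = some l) :
      ModRel C (Finsupp.single i (D.e l) - Finsupp.single i 1)
  | arrow (i j : C.shape.index) (a : A) (h : C.HasArrow i j a) :
      ModRel C (Finsupp.single i (D.arr a) - Finsupp.single j 1)
  | zero (i : C.shape.index) (a : A) (ha : a ∉ D.special) (ht : C.vertex i = some (D.tail a))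
      (h : ∀ j, ¬ C.HasArrow i j a) : ModRel C (Finsupp.single i (D.arr a))

/-- The submodule of relations of `M(C)`. -/
def modRels (C : D.Walk) : Submodule D.Alg (C.shape.index →₀ D.Alg) :=
  Submodule.span D.Alg {x | D.ModRel C x}

/-- The `R`-module `M(C)` with generators `b_i`, for `i` in the index set of `C`. -/
def ModC (C : D.Walk) : Type _ := (C.shape.index →₀ D.Alg) ⧸ D.modRels C

instance (C : D.Walk) : AddCommGroup (D.ModC C) :=
  inferInstanceAs (AddCommGroup ((C.shape.index →₀ D.Alg) ⧸ D.modRels C))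

instance (C : D.Walk) : Module D.Alg (D.ModC C) :=
  inferInstanceAs (Module D.Alg ((C.shape.index →₀ D.Alg) ⧸ D.modRels C))

/-- The generators `b_i` of `M(C)`. -/
def b (C : D.Walk) (i : C.shape.index) : D.ModC C :=
  (D.modRels C).mkQ (Finsupp.single i 1)

variable {D}

theorem ModC.hom_ext {C : D.Walk} {M : Type*} [AddCommGroup M] [Module D.Alg M]
    {f g : D.ModC C →ₗ[D.Alg] M} (h : ∀ i, f (D.b C i) = g (D.b C i)) : f = g := by
  have hfg : f.comp (D.modRels C).mkQ = g.comp (D.modRels C).mkQ :=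
    Finsupp.lhom_ext' fun i => LinearMap.ext_ring (h i)
  exact Submodule.linearMap_qext (D.modRels C) hfg

/-- On the free module with basis `b_i`, the `R`-linear map with `b_i ↦ π_i(c) b_i`. -/
def Twist.freeRightMul {C : D.Walk} (T : D.Twist C) (c : K) :
    (C.shape.index →₀ D.Alg) →ₗ[D.Alg] (C.shape.index →₀ D.Alg) :=
  Finsupp.linearCombination D.Alg fun i => Finsupp.single i (D.scalar (T.π i c))

theorem Twist.freeRightMul_single {C : D.Walk} (T : D.Twist C) (c : K) (i : C.shape.index)
    (r : D.Alg) :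
    T.freeRightMul c (Finsupp.single i r) = Finsupp.single i (r * D.scalar (T.π i c)) := by
  simp [Twist.freeRightMul, Finsupp.linearCombination_single]

theorem Twist.modRels_le {C : D.Walk} (T : D.Twist C) (c : K) :
    D.modRels C ≤ (D.modRels C).comap (T.freeRightMul c) := by
  refine Submodule.span_le.mpr ?_
  rintro x (⟨i, l, h⟩ | ⟨i, j, a, h⟩ | ⟨i, a, ha, ht, h⟩)
  · have := (D.modRels C).smul_mem (D.scalar (T.π i c))
      (Submodule.subset_span (ModRel.vertex (D := D) i l h))
    simpa [Twist.freeRightMul_single, e_mul_scalar, smul_sub] using this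
  · have := (D.modRels C).smul_mem (D.scalar (T.π j c))
      (Submodule.subset_span (ModRel.arrow (D := D) i j a h))
    simpa [Twist.freeRightMul_single, arr_mul_scalar, smul_sub, T.compat i j a h] using this
  · have := (D.modRels C).smul_mem (D.scalar (D.σ a (T.π i c)))
      (Submodule.subset_span (ModRel.zero (D := D) i a ha ht h))
    simpa [Twist.freeRightMul_single, arr_mul_scalar] using this

/-- The right action of `c` in `K` on the bimodule `M(C)`, with `b_i c = π_i(c) b_i`. -/
def Twist.rightMul {C : D.Walk} (T : D.Twist C) (c : K) : D.ModC C →ₗ[D.Alg] D.ModC C :=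
  Submodule.mapQ (D.modRels C) (D.modRels C) (T.freeRightMul c) (T.modRels_le c)

theorem Twist.rightMul_b {C : D.Walk} (T : D.Twist C) (c : K) (i : C.shape.index) :
    T.rightMul c (D.b C i) = D.scalar (T.π i c) • D.b C i := by
  change (D.modRels C).mkQ (T.freeRightMul c (Finsupp.single i 1)) = _
  have h : Finsupp.single i (D.scalar (T.π i c)) =
      D.scalar (T.π i c) • (Finsupp.single i 1 : C.shape.index →₀ D.Alg) := by
    rw [Finsupp.smul_single, smul_eq_mul, mul_one]
  rw [Twist.freeRightMul_single, one_mul, h]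
  exact map_smul (D.modRels C).mkQ _ _

/-- The functor `T_C = Hom_R(M(C), -)`. -/
def Top {C : D.Walk} (_T : D.Twist C) (M : Type*) [AddCommGroup M] [Module D.Alg M] : Type _ :=
  D.ModC C →ₗ[D.Alg] M

section Objects

variable {C : D.Walk} (T : D.Twist C) (M : Type*) [AddCommGroup M] [Module D.Alg M]

instance : AddCommGroup (Top T M) := inferInstanceAs (AddCommGroup (D.ModC C →ₗ[D.Alg] M))

variable {T M} in
/-- An element of `T_C(M)` as a homomorphism. -/
def Top.hom (θ : Top T M) : D.ModC C →ₗ[D.Alg] M := θ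

/-- The left `K`-module structure on `T_C(M)` given by the right action on `M(C)`:
`(c θ)(m) = θ(m c)`. -/
instance : Module K (Top T M) where
  smul c θ := (θ.hom.comp (T.rightMul c) : D.ModC C →ₗ[D.Alg] M)
  one_smul θ := ModC.hom_ext (f := θ.hom.comp (T.rightMul 1)) (g := θ.hom) fun i => by
    simp [Twist.rightMul_b]
  mul_smul c d θ := ModC.hom_ext (f := θ.hom.comp (T.rightMul (c * d)))
    (g := (θ.hom.comp (T.rightMul d)).comp (T.rightMul c)) fun i => by
      simp [Twist.rightMul_b, mul_smul]
  smul_zero _ := LinearMap.zero_comp _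
  smul_add _ _ _ := LinearMap.add_comp _ _ _
  add_smul c d θ := ModC.hom_ext (f := θ.hom.comp (T.rightMul (c + d)))
    (g := θ.hom.comp (T.rightMul c) + θ.hom.comp (T.rightMul d)) fun i => by
      simp [Twist.rightMul_b, add_smul]
  zero_smul θ := ModC.hom_ext (f := θ.hom.comp (T.rightMul 0)) (g := 0) fun i => by
      simp [Twist.rightMul_b]

variable [Module K M] [IsScalarTower K D.Alg M]

variable {T M} in
theorem Top.smul_hom_b (c : K) (θ : Top T M) (i : C.shape.index) :
    (c • θ).hom (D.b C i) = T.π i c • θ.hom (D.b C i) := by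
  change θ.hom (T.rightMul c (D.b C i)) = _
  rw [Twist.rightMul_b, map_smul, scalar_smul]

variable (D) in
/-- The `K`-subspace `a e_{t(a)} M` of `M`, for an arrow `a`. -/
def arrowImage (a : A) : Submodule K M where
  carrier := {m | ∃ m' : M, D.arr a • D.e (D.tail a) • m' = m}
  zero_mem' := ⟨0, by simp⟩
  add_mem' := by
    rintro _ _ ⟨x, rfl⟩ ⟨y, rfl⟩
    exact ⟨x + y, by simp only [smul_add]⟩
  smul_mem' := by
    rintro c _ ⟨x, rfl⟩
    refine ⟨D.scalar ((D.σ a).symm c) • x, ?_⟩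
    rw [← scalar_smul (D := D) c]
    simp only [← mul_smul]
    rw [e_mul_scalar, ← mul_assoc, arr_mul_scalar, RingEquiv.apply_symm_apply, mul_assoc]

/-- The subspace `1_{ℓ,ε}^-(M)` of `M`: it is `a e_{t(a)} M` if there is an arrow `a` with head `ℓ`
such that the letter `a^*` has sign `ε`, and `0` otherwise. (There is at most one such arrow.) -/
def SignChoice.oneMinus (S : D.SignChoice) (l : V) (ε : ℤˣ) : Submodule K M :=
  ⨆ (a : A) (_ : D.head a = l ∧ S.sgn (Letter.ofArrow D a) = ε), D.arrowImage M a

/-- The `θ` in `T_C(M)` with `θ(b_i) = 0` for `i ≪ 0`. -/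
def Top.vanishBelow : Submodule K (Top T M) where
  carrier := {θ | ∃ N : ℤ, ∀ i : C.shape.index, (i : ℤ) < N → θ.hom (D.b C i) = 0}
  zero_mem' := ⟨0, fun _ _ => rfl⟩
  add_mem' := by
    rintro f g ⟨N, hN⟩ ⟨N', hN'⟩
    refine ⟨min N N', fun i hi => ?_⟩
    change f.hom _ + g.hom _ = 0
    rw [hN i (lt_min_iff.mp hi).1, hN' i (lt_min_iff.mp hi).2, add_zero]
  smul_mem' := by
    rintro c f ⟨N, hN⟩
    exact ⟨N, fun i hi => by rw [Top.smul_hom_b, hN i hi, smul_zero]⟩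

/-- The `θ` in `T_C(M)` with `θ(b_i) = 0` for `i ≫ 0`. -/
def Top.vanishAbove : Submodule K (Top T M) where
  carrier := {θ | ∃ N : ℤ, ∀ i : C.shape.index, N < (i : ℤ) → θ.hom (D.b C i) = 0}
  zero_mem' := ⟨0, fun _ _ => rfl⟩
  add_mem' := by
    rintro f g ⟨N, hN⟩ ⟨N', hN'⟩
    refine ⟨max N N', fun i hi => ?_⟩
    change f.hom _ + g.hom _ = 0
    rw [hN i (max_lt_iff.mp hi).1, hN' i (max_lt_iff.mp hi).2, add_zero]
  smul_mem' := by
    rintro c f ⟨N, hN⟩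
    exact ⟨N, fun i hi => by rw [Top.smul_hom_b, hN i hi, smul_zero]⟩

/-- The `θ` in `T_C(M)` with `θ(b_i) ∈ 1_{ℓ,ε}^-(M)`, where `ℓ = v_i(C)`. -/
def Top.boundary (S : D.SignChoice) (i : ℤ) (ε : ℤˣ) : Submodule K (Top T M) where
  carrier := {θ | ∀ (j : C.shape.index) (l : V), (j : ℤ) = i → C.vertex j = some l →
    θ.hom (D.b C j) ∈ S.oneMinus M l ε}
  zero_mem' := fun _ _ _ _ => Submodule.zero_mem _
  add_mem' := fun hf hg j l hj hl => Submodule.add_mem _ (hf j l hj hl) (hg j l hj hl)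
  smul_mem' := fun c f hf j l hj hl => by
    rw [Top.smul_hom_b]
    exact Submodule.smul_mem _ _ (hf j l hj hl)

/-- The subspace `B_C^+(M)` of `T_C(M)`. -/
def SignChoice.Bplus (S : D.SignChoice) : Submodule K (Top T M) :=
  match C.shape with
  | .full => Top.vanishBelow T M
  | .finite _ => Top.boundary T M S 0 (- C.sign)

/-- The subspace `B_C^-(M)` of `T_C(M)`. -/
def SignChoice.Bminus (S : D.SignChoice) : Submodule K (Top T M) :=
  match C.shape with
  | .full => Top.vanishAbove T M
  | .finite n => Top.boundary T M S n (- (S.inv C.star).sign)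

/-- The subspace `B_C(M) = B_C^+(M) + B_C^-(M)` of `T_C(M)`. -/
def SignChoice.B (S : D.SignChoice) : Submodule K (Top T M) := S.Bplus T M ⊔ S.Bminus T M

/-- The functor `F_C = T_C / B_C` on objects, with values in left `K`-modules. -/
abbrev SignChoice.F (S : D.SignChoice) : Type _ := Top T M ⧸ S.B T M

end Objects

section Morphisms

variable {C : D.Walk} (T : D.Twist C) {M M' : Type*} [AddCommGroup M] [Module D.Alg M]
  [AddCommGroup M'] [Module D.Alg M']

/-- The functor `T_C` on homomorphisms. -/
def Top.map (f : M →ₗ[D.Alg] M') : Top T M →ₗ[K] Top T M' where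
  toFun θ := (f.comp θ.hom : D.ModC C →ₗ[D.Alg] M')
  map_add' _ _ := LinearMap.comp_add _ _ _
  map_smul' _ _ := rfl

theorem Top.map_hom (f : M →ₗ[D.Alg] M') (θ : Top T M) (m : D.ModC C) :
    (Top.map T f θ).hom m = f (θ.hom m) := rfl

variable [Module K M] [IsScalarTower K D.Alg M] [Module K M'] [IsScalarTower K D.Alg M']

theorem SignChoice.map_oneMinus (S : D.SignChoice) (f : M →ₗ[D.Alg] M') (l : V) (ε : ℤˣ) {m : M}
    (hm : m ∈ S.oneMinus M l ε) : f m ∈ S.oneMinus M' l ε := by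
  let g : M →ₗ[K] M' :=
    { toFun := f
      map_add' := map_add f
      map_smul' := fun c x => by
        rw [← scalar_smul (D := D), map_smul, scalar_smul, RingHom.id_apply] }
  have hle : S.oneMinus M l ε ≤ (S.oneMinus M' l ε).comap g := by
    refine iSup₂_le fun a ha => ?_
    rintro _ ⟨x, rfl⟩
    have h1 : D.arrowImage M' a ≤ S.oneMinus M' l ε :=
      le_iSup₂_of_le (f := fun (a : A) (_ : D.head a = l ∧ S.sgn (Letter.ofArrow D a) = ε) =>
        D.arrowImage M' a) a ha le_rfl
    refine h1 ⟨f x, ?_⟩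
    change _ = f _
    rw [map_smul, map_smul]
  exact hle hm

theorem SignChoice.B_le_comap (S : D.SignChoice) (f : M →ₗ[D.Alg] M') :
    S.B T M ≤ (S.B T M').comap (Top.map T f) := by
  have hb : ∀ (i : ℤ) (ε : ℤˣ),
      Top.boundary T M S i ε ≤ (Top.boundary T M' S i ε).comap (Top.map T f) :=
    fun i ε θ hθ j l hj hl => S.map_oneMinus f l ε (hθ j l hj hl)
  refine sup_le (le_trans ?_ (Submodule.comap_mono le_sup_left))
    (le_trans ?_ (Submodule.comap_mono le_sup_right))
  · unfold SignChoice.Bplus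
    split
    · rintro θ ⟨N, hN⟩
      exact ⟨N, fun i hi => by rw [Top.map_hom, hN i hi, map_zero]⟩
    · exact hb _ _
  · unfold SignChoice.Bminus
    split
    · rintro θ ⟨N, hN⟩
      exact ⟨N, fun i hi => by rw [Top.map_hom, hN i hi, map_zero]⟩
    · exact hb _ _

/-- The functor `F_C` on homomorphisms. -/
def SignChoice.Fmap (S : D.SignChoice) (f : M →ₗ[D.Alg] M') : S.F T M →ₗ[K] S.F T M' :=
  Submodule.mapQ (S.B T M) (S.B T M') (Top.map T f) (S.B_le_comap T f)

end Morphisms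

end Functors

end SCData

end

set_option linter.unusedSectionVars false

namespace SCData

/-! ### The action of letters on subspaces -/

section Vertex

variable {K V A : Type*} [DivisionRing K] [Fintype V] (D : SCData K V A)

/-! The proof is the functorial filtration method. Fix a vertex v and a sign ε. Letters act on
subspaces of M: arrows by images, inverse arrows by preimages, special loops by images. A one-sided
word x with head v and sign ε (a ray, possibly infinite, not required to avoid the zero relations)
thereby gives an interval x^- ≤ x^+ of subspaces of e_v M. If x < y, then x^+ ≤ y^-, because the
order on words reflects the relations ab = 0. Every non-zero element of e_v M lies in some x^+ but
not in x^-: the ray is found letter by letter, since the possible next letters, together with the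
option to stop, account for all gaps in 0 ≤ 1^- ≤ 1^+ ≤ e_v M (`exists_ray`).

The two signs thus give two flags of e_v M (`isIntervalFlag`). By their common refinement, dim e_v M
is the sum, over pairs (x, y) of rays of opposite signs, of the dimensions of (x^+ ∩ y^+) / (x^+ ∩
y^- + x^- ∩ y^+). The pairs with non-zero quotient are the points, and there are finitely many of
them (`finsum_points`, `points_finite`).

A point (x, y) is the word x⁻¹y with a marked position. The local heart of the proof (`IsStep`) is
that num / den is transported when the mark moves across a letter. For a special loop s this rests
on s² = βs - γ with γ ≠ 0: a subspace containing m and sm also contains s²m and s⁻¹m. That suffices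
if s is oriented from the smaller to the larger of the two intervals on its sides, which is the
orientation prescribed by C_w.

It follows that evaluation at b_i identifies F_{C_w}(M), semilinearly, with the subquotient at any
position i of w (`mem_B_iff`, `exists_equiv`). A word carrying a point contains no zero relation,
and an infinite one must repeat a point and is therefore periodic; so points come exactly from
strings and bands (`exists_string_or_band`). Finally J_w is a fundamental domain for the
translations and reflections preserving w, so each point occurs at exactly one position in J_w for
exactly one w in Ω. Counting dimensions gives (i).

For (ii), a non-zero element m of the kernel can be changed modulo some x^- into an element m' that
is non-zero in a subquotient (`exists_refined`). The image of m' is minus the image of m - m', hence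
lies in x^- and vanishes in the corresponding subquotient of M', contradicting injectivity of
F_{C_w}(θ). So θ is injective, and by (i) the two dimensions agree. -/

theorem e_mul_e_self (v : V) : D.e v * D.e v = D.e v := by
  have h := D.toAlg_rel (PathRel.vertex_idem v)
  rwa [map_mul] at h

theorem e_mul_e_of_ne {v w : V} (hvw : v ≠ w) : D.e v * D.e w = 0 := by
  have h := D.toAlg_rel (PathRel.vertex_orth v w hvw)
  rwa [map_mul, map_zero] at h

theorem sum_e : ∑ v, D.e v = 1 := by
  have h := D.toAlg_rel PathRel.vertex_sum
  rwa [map_sum, map_one] at h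

theorem e_head_mul_arr (a : A) : D.e (D.head a) * D.arr a = D.arr a := by
  have h := D.toAlg_rel (PathRel.head_mul a)
  rwa [map_mul] at h

theorem arr_mul_e_tail (a : A) : D.arr a * D.e (D.tail a) = D.arr a := by
  have h := D.toAlg_rel (PathRel.mul_tail a)
  rwa [map_mul] at h

theorem prod_arr_eq_zero {r : List A} (h : r ∈ D.Z) : (r.map D.arr).prod = 0 := by
  have h' := RingQuot.mkRingHom_rel (AlgRel.zero (D := D) r h)
  rw [map_list_prod, List.map_map, map_zero] at h'
  exact h'

theorem arr_sq {s : A} (h : s ∈ D.special) :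
    D.arr s * D.arr s =
      D.scalar (D.β s) * D.arr s - D.scalar (D.γ s) * D.e (D.head s) := by
  have h' : D.arr s ^ 2 - D.scalar (D.β s) * D.arr s + D.scalar (D.γ s) * D.e (D.head s) = 0 := by
    have h' := RingQuot.mkRingHom_rel (AlgRel.quad (D := D) s h)
    simp only [map_add, map_sub, map_mul, map_pow, map_zero] at h'
    exact h'
  rw [← pow_two, eq_sub_iff_add_eq, ← sub_eq_zero, ← h']
  abel

variable (M : Type*) [AddCommGroup M] [Module K M] [Module D.Alg M] [IsScalarTower K D.Alg M]

/-- The subspace `e_v M`. -/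
def vertexSpace (v : V) : Submodule K M where
  carrier := {m | D.e v • m = m}
  zero_mem' := smul_zero _
  add_mem' := fun hx hy => by
    rw [Set.mem_ofPred_eq] at *
    rw [smul_add, hx, hy]
  smul_mem' := fun c m hm => by
    rw [Set.mem_ofPred_eq] at *
    rw [← scalar_smul (D := D), ← mul_smul, e_mul_scalar, mul_smul, hm]

/-- The action of an arrow as a semilinear map. -/
def arrMap (a : A) : M →ₛₗ[((D.σ a : K ≃+* K) : K →+* K)] M where
  toFun m := D.arr a • m
  map_add' := smul_add _
  map_smul' := fun c m => by
    rw [← scalar_smul (D := D), ← mul_smul, arr_mul_scalar, mul_smul, scalar_smul]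
    rfl

variable {D M}

@[simp]
theorem arrMap_apply (a : A) (m : M) : D.arrMap M a m = D.arr a • m := rfl

theorem mem_vertexSpace {v : V} {m : M} : m ∈ D.vertexSpace M v ↔ D.e v • m = m := Iff.rfl

theorem arr_smul_mem (a : A) (m : M) : D.arr a • m ∈ D.vertexSpace M (D.head a) := by
  rw [mem_vertexSpace, ← mul_smul, e_head_mul_arr]

theorem arr_smul_smul (a : A) (c : K) (m : M) : D.arr a • c • m = D.σ a c • D.arr a • m :=
  (D.arrMap M a).map_smulₛₗ c m

theorem arr_smul_e_smul (a : A) (m : M) : D.arr a • D.e (D.tail a) • m = D.arr a • m := by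
  rw [← mul_smul, arr_mul_e_tail]

theorem e_smul_mem (v : V) (m : M) : D.e v • m ∈ D.vertexSpace M v := by
  rw [mem_vertexSpace, ← mul_smul, e_mul_e_self]

theorem arr_arr_smul_eq_zero {a b : A} (h : [a, b] ∈ D.Z) (m : M) :
    D.arr a • D.arr b • m = 0 := by
  have := D.prod_arr_eq_zero h
  rw [List.map_cons, List.map_cons, List.map_nil, List.prod_cons, List.prod_cons, List.prod_nil,
    mul_one] at this
  rw [← mul_smul, this, zero_smul]

theorem mem_arrowImage {a : A} {m : M} :
    m ∈ D.arrowImage M a ↔ ∃ m' ∈ D.vertexSpace M (D.tail a), D.arr a • m' = m := by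
  constructor
  · rintro ⟨m', rfl⟩
    exact ⟨_, e_smul_mem _ _, rfl⟩
  · rintro ⟨m', h, rfl⟩
    exact ⟨m', by rw [arr_smul_e_smul]⟩

theorem special_sq_smul {s : A} (hs : s ∈ D.special) {m : M}
    (hm : m ∈ D.vertexSpace M (D.head s)) :
    D.arr s • D.arr s • m = D.β s • D.arr s • m - D.γ s • m := by
  rw [← mul_smul, arr_sq D hs, sub_smul, mul_smul, mul_smul, hm, scalar_smul, scalar_smul]

/-- A special loop acts invertibly, its inverse being a `K`-combination of `1` and itself. -/
theorem exists_special_inverse (hns : D.IsNonSingularType) {s : A} (hs : s ∈ D.special) :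
    ∃ c d : K, ∀ m ∈ D.vertexSpace M (D.head s), D.arr s • (c • m + d • D.arr s • m) = m := by
  -- Solving s² = βs - γ for the inverse gives s · (γ'β' - γ's) = 1 up to twisting; the coefficients
  -- are pulled back along σ_s because scalars change by σ_s when they pass s.
  refine ⟨(D.σ s).symm ((D.γ s)⁻¹ * D.β s), -(D.σ s).symm (D.γ s)⁻¹, fun m hm => ?_⟩
  have hγ := hns s hs
  rw [smul_add, arr_smul_smul, arr_smul_smul, special_sq_smul hs hm, map_neg,
    RingEquiv.apply_symm_apply, RingEquiv.apply_symm_apply, neg_smul, smul_sub, smul_smul,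
    smul_smul, inv_mul_cancel₀ hγ, one_smul]
  abel

theorem special_injective (hns : D.IsNonSingularType) {s : A} (hs : s ∈ D.special) {m m' : M}
    (hm : m ∈ D.vertexSpace M (D.head s)) (hm' : m' ∈ D.vertexSpace M (D.head s))
    (h : D.arr s • m = D.arr s • m') : m = m' := by
  have h1 := special_sq_smul hs (sub_mem hm hm')
  rw [smul_sub, sub_eq_zero.mpr h, smul_zero, smul_zero, zero_sub, eq_comm, neg_eq_zero] at h1
  exact sub_eq_zero.mp ((smul_eq_zero.mp h1).resolve_left (hns s hs))

theorem special_sq_mem {s : A} (hs : s ∈ D.special) {U : Submodule K M} {m : M}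
    (hm : m ∈ D.vertexSpace M (D.head s)) (hU : m ∈ U) (hsU : D.arr s • m ∈ U) :
    D.arr s • D.arr s • m ∈ U := by
  rw [special_sq_smul hs hm]
  exact sub_mem (U.smul_mem _ hsU) (U.smul_mem _ hU)

/-- Since s⁻¹m is a K-combination of m and sm, it lies in any subspace containing both. This and
`special_sq_mem` are the two facts that let a special loop be handled like its own inverse. -/
theorem mem_map_special (hns : D.IsNonSingularType) {s : A} (hs : s ∈ D.special)
    {U : Submodule K M} {m : M} (hm : m ∈ D.vertexSpace M (D.head s)) (hU : m ∈ U)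
    (hsU : D.arr s • m ∈ U) : m ∈ U.map (D.arrMap M s) := by
  obtain ⟨c, d, h⟩ := exists_special_inverse (M := M) hns hs
  exact ⟨c • m + d • D.arr s • m, add_mem (U.smul_mem _ hU) (U.smul_mem _ hsU), h m hm⟩

end Vertex

section Letters

variable {K V A : Type*} [DivisionRing K] {D : SCData K V A}

@[simp]
theorem Letter.inverse_inverse (l : D.Letter) : l.inverse.inverse = l := by cases l <;> rfl

theorem Letter.head_inverse (l : D.Letter) (hD : D.IsClannish) : l.inverse.head = l.tail := by
  cases l with
  | star s h => exact hD.special_loop s h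
  | _ => rfl

theorem Letter.tail_inverse (l : D.Letter) (hD : D.IsClannish) : l.inverse.tail = l.head := by
  cases l with
  | star s h => exact (hD.special_loop s h).symm
  | _ => rfl

variable [Fintype V] (M : Type*) [AddCommGroup M] [Module K M] [Module D.Alg M]
  [IsScalarTower K D.Alg M]

/-- The action of a letter on subspaces: a direct letter and a `*`-letter act by images, an inverse
letter by preimages. -/
def Letter.act : D.Letter → Submodule K M → Submodule K M
  | .dir a _, U => U.map (D.arrMap M a)
  | .inv a _, U => D.vertexSpace M (D.tail a) ⊓ U.comap (D.arrMap M a)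
  | .star s _, U => U.map (D.arrMap M s)

variable {M}

theorem Letter.act_mono (l : D.Letter) {U U' : Submodule K M} (h : U ≤ U') :
    l.act M U ≤ l.act M U' := by
  cases l with
  | inv a ha => exact inf_le_inf_left _ (Submodule.comap_mono h)
  | _ => exact Submodule.map_mono h

theorem Letter.act_le (l : D.Letter) (U : Submodule K M) :
    l.act M U ≤ D.vertexSpace M l.head := by
  cases l with
  | inv a ha => exact inf_le_left
  | _ => rintro _ ⟨u, -, rfl⟩; exact arr_smul_mem _ _

end Letters

/-! ### Rays and their filtrations -/

namespace SignChoice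

section Rays

variable {K V A : Type*} [DivisionRing K] {D : SCData K V A} (S : D.SignChoice)

/-- No `*`-letter has head `o` and sign `ε`. -/
def NoStar (o : Option V) (ε : ℤˣ) : Prop :=
  ∀ s hs, ¬ (o = some (D.head s) ∧ S.sgn (.star s hs) = ε)

/-- A predicate on one-sided words (with head and sign) which is closed under removing the first
letter, and whose trivial members are end-admissible. -/
def RayClosed (P : Option V → ℤˣ → (ℕ → Option D.Letter) → Prop) : Prop :=
  ∀ o ε x, P o ε x → ((∀ j, x j = none) ∧ S.NoStar o ε) ∨
    ∃ l : D.Letter, x 0 = some l ∧ o = some l.head ∧ ε = S.sgn l ∧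
      P (some l.tail) (-S.sgn l.inverse) (fun j => x (j + 1))

/-- The end-admissible one-sided words with head `o` and sign `ε`. -/
def IsRay (o : Option V) (ε : ℤˣ) (x : ℕ → Option D.Letter) : Prop :=
  ∃ P, S.RayClosed P ∧ P o ε x

variable {S}

theorem ofArrow_of_notMem {a : A} (h : a ∉ D.special) : Letter.ofArrow D a = .dir a h := by
  rw [Letter.ofArrow, dif_neg h]

theorem ofArrow_of_mem {a : A} (h : a ∈ D.special) : Letter.ofArrow D a = .star a h := by
  rw [Letter.ofArrow, dif_pos h]

/-- `IsRay` is the union of all `RayClosed` predicates, hence itself closed: rays are defined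
coinductively, which treats finite and infinite words uniformly. -/
theorem IsRay.cases {o : Option V} {ε : ℤˣ} {x : ℕ → Option D.Letter} (h : S.IsRay o ε x) :
    ((∀ j, x j = none) ∧ S.NoStar o ε) ∨
      ∃ l : D.Letter, x 0 = some l ∧ o = some l.head ∧ ε = S.sgn l ∧
        S.IsRay (some l.tail) (-S.sgn l.inverse) (fun j => x (j + 1)) := by
  obtain ⟨P, hP, hx⟩ := h
  rcases hP o ε x hx with h | ⟨l, h1, h2, h3, h4⟩
  · exact .inl h
  · exact .inr ⟨l, h1, h2, h3, P, hP, h4⟩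

theorem IsRay.of_some {o : Option V} {ε : ℤˣ} {x : ℕ → Option D.Letter} (h : S.IsRay o ε x)
    {l : D.Letter} (hl : x 0 = some l) : o = some l.head ∧ ε = S.sgn l ∧
        S.IsRay (some l.tail) (-S.sgn l.inverse) (fun j => x (j + 1)) := by
  rcases h.cases with ⟨h, -⟩ | ⟨l', h1, h⟩
  · simp [h 0] at hl
  · rw [hl, Option.some.injEq] at h1
    subst h1
    exact h

theorem IsRay.of_none {o : Option V} {ε : ℤˣ} {x : ℕ → Option D.Letter} (h : S.IsRay o ε x)
    (hl : x 0 = none) : (∀ j, x j = none) ∧ S.NoStar o ε := by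
  rcases h.cases with h | ⟨l', h1, -⟩
  · exact h
  · simp [hl] at h1

theorem seqLT_of_tail {f g : ℕ → Option D.Letter} {l : D.Letter} (hf : f 0 = some l)
    (hg : g 0 = some l) (h : SeqLT (fun j => f (j + 1)) (fun j => g (j + 1))) : SeqLT f g := by
  obtain ⟨k, h1, h2⟩ := h
  refine ⟨k + 1, fun j hj => ?_, h2⟩
  cases j with
  | zero => simp [hf, hg]
  | succ j => exact h1 j (by omega)

theorem zero_relation_of_sgn_eq {a b : A} {ha : a ∉ D.special} {hb : b ∉ D.special}
    (h1 : D.tail a = D.head b) (h2 : S.sgn (.inv a ha) = S.sgn (.dir b hb)) : [a, b] ∈ D.Z := by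
  obtain ⟨a', b', ha', hb', hZ, h | h⟩ :=
    S.eq_of_sgn_eq (.inv a ha) (.dir b hb) (by simp) h1 h2
  · obtain ⟨h3, h4⟩ := h
    cases h3
    cases h4
    exact hZ
  · cases h.1

/-- The exception allowed in a choice of signs concerns ordinary arrows only, so a *-letter is alone
among the letters with its head and sign. -/
theorem star_eq_of_sgn_eq {s : A} {hs : s ∈ D.special} {l : D.Letter}
    (h1 : D.head s = l.head) (h2 : S.sgn (.star s hs) = S.sgn l) : l = .star s hs := by
  by_contra hne
  obtain ⟨a', b', ha', hb', hZ, h | h⟩ :=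
    S.eq_of_sgn_eq (.star s hs) l (Ne.symm hne) h1 h2 <;> cases h.1

theorem dir_eq_of_sgn_eq {a b : A} {ha : a ∉ D.special} {hb : b ∉ D.special}
    (h1 : D.head a = D.head b) (h2 : S.sgn (.dir a ha) = S.sgn (.dir b hb)) : a = b := by
  by_contra hne
  obtain ⟨a', b', ha', hb', hZ, h | h⟩ :=
    S.eq_of_sgn_eq (.dir a ha) (.dir b hb) (by simpa using hne) h1 h2
  · cases h.1
  · cases h.2

theorem inv_eq_of_sgn_eq {a b : A} {ha : a ∉ D.special} {hb : b ∉ D.special}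
    (h1 : D.tail a = D.tail b) (h2 : S.sgn (.inv a ha) = S.sgn (.inv b hb)) : a = b := by
  by_contra hne
  obtain ⟨a', b', ha', hb', hZ, h | h⟩ :=
    S.eq_of_sgn_eq (.inv a ha) (.inv b hb) (by simpa using hne) h1 h2
  · cases h.2
  · cases h.1

/-- Where two rays part, no *-letter can be involved: against another letter by the choice of signs,
against the end of a word by end-admissibility. What remains are exactly the cases in which the
order is defined. -/
theorem IsRay.seqLT_or_of_ne {o : Option V} {ε : ℤˣ} {x y : ℕ → Option D.Letter}
    (hx : S.IsRay o ε x) (hy : S.IsRay o ε y) (hk : x 0 ≠ y 0) : SeqLT x y ∨ SeqLT y x := by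
  rcases hx.cases with ⟨hx0, hns⟩ | ⟨l, hl, ho, hε, -⟩
  · rcases hy.cases with ⟨hy0, -⟩ | ⟨l', hl', ho', hε', -⟩
    · simp [hx0, hy0] at hk
    · cases l' with
      | dir a ha => exact .inr ⟨0, by simp, .inr (.inl ⟨a, ha, hl', hx0 0⟩)⟩
      | inv a ha => exact .inl ⟨0, by simp, .inr (.inr ⟨a, ha, hx0 0, hl'⟩)⟩
      | star s hs => exact absurd ⟨ho', hε'.symm⟩ (hns s hs)
  · rcases hy.cases with ⟨hy0, hns⟩ | ⟨l', hl', ho', hε', -⟩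
    · cases l with
      | dir a ha => exact .inl ⟨0, by simp, .inr (.inl ⟨a, ha, hl, hy0 0⟩)⟩
      | inv a ha => exact .inr ⟨0, by simp, .inr (.inr ⟨a, ha, hy0 0, hl⟩)⟩
      | star s hs => exact absurd ⟨ho, hε.symm⟩ (hns s hs)
    · rw [hl, hl', Ne, Option.some.injEq] at hk
      obtain ⟨a, b, ha, hb, hZ, ⟨rfl, rfl⟩ | ⟨rfl, rfl⟩⟩ :=
        S.eq_of_sgn_eq l l' hk (Option.some.inj (ho.symm.trans ho')) (hε.symm.trans hε')
      · exact .inr ⟨0, by simp, .inl ⟨a, ha, b, hb, hl', hl⟩⟩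
      · exact .inl ⟨0, by simp, .inl ⟨a, ha, b, hb, hl, hl'⟩⟩

/-- Rays with the same head and sign are linearly ordered. -/
theorem IsRay.trichotomy {o : Option V} {ε : ℤˣ} {x y : ℕ → Option D.Letter}
    (hx : S.IsRay o ε x) (hy : S.IsRay o ε y) : x = y ∨ SeqLT x y ∨ SeqLT y x := by
  by_cases hxy : x = y
  · exact .inl hxy
  refine .inr ?_
  obtain ⟨k, hk⟩ : ∃ k, x k ≠ y k := by
    by_contra! h
    exact hxy (funext h)
  induction k generalizing o ε x y with
  | zero => exact hx.seqLT_or_of_ne hy hk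
  | succ k ih =>
    by_cases h0 : x 0 = y 0
    · cases hl : x 0 with
      | none =>
        rw [(hx.of_none hl).1, (hy.of_none (h0 ▸ hl)).1] at hk
        exact absurd rfl hk
      | some l =>
        have hl' : y 0 = some l := h0 ▸ hl
        have h := ih (hx.of_some hl).2.2 (hy.of_some hl').2.2
          (fun h => hk (congrFun h k)) hk
        exact h.imp (seqLT_of_tail hl hl') (seqLT_of_tail hl' hl)
    · exact hx.seqLT_or_of_ne hy h0

end Rays

/-! ### The intervals of subspaces attached to rays -/

section Filtration

variable {K V A : Type*} [DivisionRing K] [Fintype V] {D : SCData K V A} (S : D.SignChoice)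
  (M : Type*) [AddCommGroup M] [Module K M] [Module D.Alg M] [IsScalarTower K D.Alg M]

/-- The subspace of `e_l M` killed by the ordinary arrows `a` such that `a⁻¹` has head `l` and
sign `ε`. -/
def onePlus (l : V) (ε : ℤˣ) : Submodule K M where
  carrier := {m | m ∈ D.vertexSpace M l ∧ ∀ a ha, D.tail a = l → S.sgn (.inv a ha) = ε →
    D.arr a • m = 0}
  zero_mem' := ⟨zero_mem _, fun _ _ _ _ => smul_zero _⟩
  add_mem' := fun hx hy => ⟨add_mem hx.1 hy.1, fun a ha h1 h2 => by
    rw [smul_add, hx.2 a ha h1 h2, hy.2 a ha h1 h2, add_zero]⟩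
  smul_mem' := fun c _ hx => ⟨Submodule.smul_mem _ c hx.1, fun a ha h1 h2 => by
    rw [arr_smul_smul, hx.2 a ha h1 h2, smul_zero]⟩

/-- The subspace `x^+` for the one-sided word `x` truncated to `d` letters. -/
def plus : ℕ → Option V → ℤˣ → (ℕ → Option D.Letter) → Submodule K M
  | 0, o, _, _ => o.elim ⊥ (D.vertexSpace M)
  | d + 1, o, ε, x => match x 0 with
    | none => o.elim ⊥ fun l => S.onePlus M l ε
    | some l => l.act M (plus d (some l.tail) (-S.sgn l.inverse) fun j => x (j + 1))

/-- The subspace `x^-` for the one-sided word `x` truncated to `d` letters. -/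
def minus : ℕ → Option V → ℤˣ → (ℕ → Option D.Letter) → Submodule K M
  | 0, _, _, _ => ⊥
  | d + 1, o, ε, x => match x 0 with
    | none => o.elim ⊥ fun l => S.oneMinus M l ε
    | some l => l.act M (minus d (some l.tail) (-S.sgn l.inverse) fun j => x (j + 1))

variable {S M}

theorem minus_zero (o : Option V) (ε : ℤˣ) (x : ℕ → Option D.Letter) :
    S.minus M 0 o ε x = ⊥ := rfl

theorem plus_succ_of_some {d : ℕ} {o : Option V} {ε : ℤˣ} {x : ℕ → Option D.Letter}
    {l : D.Letter} (h : x 0 = some l) : S.plus M (d + 1) o ε x =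
      l.act M (S.plus M d (some l.tail) (-S.sgn l.inverse) fun j => x (j + 1)) := by
  rw [plus, h]

theorem minus_succ_of_some {d : ℕ} {o : Option V} {ε : ℤˣ} {x : ℕ → Option D.Letter}
    {l : D.Letter} (h : x 0 = some l) : S.minus M (d + 1) o ε x =
      l.act M (S.minus M d (some l.tail) (-S.sgn l.inverse) fun j => x (j + 1)) := by
  rw [minus, h]

theorem plus_succ_of_none {d : ℕ} {o : Option V} {ε : ℤˣ} {x : ℕ → Option D.Letter}
    (h : x 0 = none) : S.plus M (d + 1) o ε x = o.elim ⊥ fun l => S.onePlus M l ε := by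
  rw [plus, h]

theorem minus_succ_of_none {d : ℕ} {o : Option V} {ε : ℤˣ} {x : ℕ → Option D.Letter}
    (h : x 0 = none) : S.minus M (d + 1) o ε x = o.elim ⊥ fun l => S.oneMinus M l ε := by
  rw [minus, h]

theorem onePlus_le (l : V) (ε : ℤˣ) : S.onePlus M l ε ≤ D.vertexSpace M l := fun _ h => h.1

theorem arrowImage_le_oneMinus {b : A} {hb : b ∉ D.special} {ε : ℤˣ}
    (h : S.sgn (.dir b hb) = ε) : D.arrowImage M b ≤ S.oneMinus M (D.head b) ε :=
  le_iSup₂_of_le (f := fun (a : A) (_ : D.head a = D.head b ∧ S.sgn (Letter.ofArrow D a) = ε) =>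
    D.arrowImage M a) b ⟨rfl, by rw [ofArrow_of_notMem hb, h]⟩ le_rfl

theorem onePlus_le_inv {a : A} {ha : a ∉ D.special} {U : Submodule K M} :
    S.onePlus M (D.tail a) (S.sgn (.inv a ha)) ≤ Letter.act M (.inv a ha) U := by
  intro m hm
  refine ⟨hm.1, ?_⟩
  rw [SetLike.mem_coe, Submodule.mem_comap, arrMap_apply, hm.2 a ha rfl rfl]
  exact zero_mem _

/-- If a⁻¹ and b have the same head and sign, then ab is a zero relation, so outgoing arrows of this
sign kill the image of the incoming one. A special loop of this sign leaves no room for any a⁻¹. -/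
theorem oneMinus_le_onePlus (l : V) (ε : ℤˣ) : S.oneMinus M l ε ≤ S.onePlus M l ε := by
  refine iSup₂_le ?_
  rintro b ⟨rfl, rfl⟩ _ ⟨m', rfl⟩
  refine ⟨arr_smul_mem _ _, fun a ha h1 h2 => ?_⟩
  by_cases hb : b ∈ D.special
  · rw [ofArrow_of_mem hb] at h2
    have := star_eq_of_sgn_eq (l := .inv a ha) (hs := hb) h1.symm h2.symm
    cases this
  · rw [ofArrow_of_notMem hb] at h2
    exact arr_arr_smul_eq_zero (zero_relation_of_sgn_eq h1 h2) _

theorem minus_le_plus (d : ℕ) (o : Option V) (ε : ℤˣ) (x : ℕ → Option D.Letter) :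
    S.minus M d o ε x ≤ S.plus M d o ε x := by
  induction d generalizing o ε x with
  | zero => exact bot_le
  | succ d ih =>
    cases h : x 0 with
    | none =>
      rw [minus_succ_of_none h, plus_succ_of_none h]
      cases o with
      | none => exact le_rfl
      | some v => exact oneMinus_le_onePlus v ε
    | some l =>
      rw [minus_succ_of_some h, plus_succ_of_some h]
      exact l.act_mono (ih _ _ _)

theorem plus_le (d : ℕ) {v : V} {ε : ℤˣ} {x : ℕ → Option D.Letter} (hx : S.IsRay (some v) ε x) :
    S.plus M d (some v) ε x ≤ D.vertexSpace M v := by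
  cases d with
  | zero => exact le_rfl
  | succ d =>
    cases h : x 0 with
    | none =>
      rw [plus_succ_of_none h]
      exact onePlus_le v ε
    | some l =>
      rw [plus_succ_of_some h, Option.some.inj (hx.of_some h).1]
      exact l.act_le _

theorem plus_antitone {o : Option V} {ε : ℤˣ} {x : ℕ → Option D.Letter} (hx : S.IsRay o ε x) :
    Antitone fun d => S.plus M d o ε x := by
  refine antitone_nat_of_succ_le fun d => ?_
  induction d generalizing o ε x with
  | zero =>
    cases o with
    | none =>
      cases h : x 0 with
      | none => exact (plus_succ_of_none h).le
      | some l => cases (hx.of_some h).1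
    | some v => exact plus_le _ hx
  | succ d ih =>
    cases h : x 0 with
    | none => rw [plus_succ_of_none h, plus_succ_of_none h]
    | some l =>
      rw [plus_succ_of_some h, plus_succ_of_some h]
      exact l.act_mono (ih (hx.of_some h).2.2)

theorem minus_monotone (o : Option V) (ε : ℤˣ) (x : ℕ → Option D.Letter) :
    Monotone fun d => S.minus M d o ε x := by
  refine monotone_nat_of_le_succ fun d => ?_
  induction d generalizing o ε x with
  | zero => exact bot_le
  | succ d ih =>
    cases h : x 0 with
    | none => rw [minus_succ_of_none h, minus_succ_of_none h]
    | some l =>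
      rw [minus_succ_of_some h, minus_succ_of_some h]
      exact l.act_mono (ih _ _ _)

theorem minus_le_plus' {o : Option V} {ε : ℤˣ} {x : ℕ → Option D.Letter} (hx : S.IsRay o ε x)
    (d d' : ℕ) : S.minus M d o ε x ≤ S.plus M d' o ε x :=
  (minus_monotone o ε x (le_max_left d d')).trans
    ((minus_le_plus _ o ε x).trans (plus_antitone hx (le_max_right d d')))

/-- The three cases of the order correspond to three inclusions: bM lies in a⁻¹0 because ab = 0; bM
lies in 1^-; and 1^+ lies in a⁻¹0. Only the first letter matters, so this holds at every depth at
least 1. -/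
theorem plus_le_minus_of_head {o : Option V} {ε : ℤˣ} {x y : ℕ → Option D.Letter}
    (hx : S.IsRay o ε x) (hy : S.IsRay o ε y)
    (h : (∃ a ha b hb, x 0 = some (.dir b hb) ∧ y 0 = some (.inv a ha)) ∨
      (∃ b hb, x 0 = some (.dir b hb) ∧ y 0 = none) ∨
      (∃ a ha, x 0 = none ∧ y 0 = some (.inv a ha))) (d : ℕ) :
    S.plus M (d + 1) o ε x ≤ S.minus M (d + 1) o ε y := by
  rcases h with ⟨a, ha, b, hb, h3, h4⟩ | ⟨b, hb, h3, h4⟩ | ⟨a, ha, h3, h4⟩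
  · obtain ⟨h5, h6, -⟩ := hx.of_some h3
    obtain ⟨h7, h8, -⟩ := hy.of_some h4
    have h9 : D.tail a = D.head b := Option.some.inj (h7.symm.trans h5)
    rw [plus_succ_of_some h3, minus_succ_of_some h4]
    rintro _ ⟨u, -, rfl⟩
    refine ⟨?_, ?_⟩
    · rw [arrMap_apply, SetLike.mem_coe, h9]
      exact arr_smul_mem b u
    · rw [SetLike.mem_coe, Submodule.mem_comap, arrMap_apply, arrMap_apply,
        arr_arr_smul_eq_zero (zero_relation_of_sgn_eq h9 (h8.symm.trans h6))]
      exact zero_mem _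
  · obtain ⟨h5, h6, hx'⟩ := hx.of_some h3
    rw [plus_succ_of_some h3, minus_succ_of_none h4, h5]
    refine le_trans ?_ (arrowImage_le_oneMinus h6.symm)
    rintro _ ⟨u, hu, rfl⟩
    exact mem_arrowImage.mpr ⟨u, plus_le _ hx' hu, rfl⟩
  · obtain ⟨h5, h6, -⟩ := hy.of_some h4
    rw [plus_succ_of_none h3, minus_succ_of_some h4, h5, h6]
    exact onePlus_le_inv

/-- For rays `x < y`, either `x^+ ≤ y^-` already after truncation to `d` letters, or the two
truncations coincide. -/
theorem plus_le_minus_or_eq {o : Option V} {ε : ℤˣ} {x y : ℕ → Option D.Letter}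
    (hx : S.IsRay o ε x) (hy : S.IsRay o ε y) (h : SeqLT x y) (d : ℕ) :
    S.plus M d o ε x ≤ S.minus M d o ε y ∨
      (S.plus M d o ε x = S.plus M d o ε y ∧ S.minus M d o ε x = S.minus M d o ε y) := by
  induction d generalizing o ε x y with
  | zero => exact .inr ⟨rfl, rfl⟩
  | succ d ih =>
    obtain ⟨k, h1, h2⟩ := h
    cases k with
    | zero => exact .inl (plus_le_minus_of_head hx hy h2 d)
    | succ k =>
      obtain ⟨h3, h4⟩ := h1 0 k.succ_pos
      obtain ⟨l, hl⟩ := Option.isSome_iff_exists.mp h4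
      have hl' : y 0 = some l := h3 ▸ hl
      rw [plus_succ_of_some hl, minus_succ_of_some hl, plus_succ_of_some hl',
        minus_succ_of_some hl']
      rcases ih (hx.of_some hl).2.2 (hy.of_some hl').2.2
        ⟨k, fun j hj => h1 (j + 1) (by omega), h2⟩ with h | ⟨h5, h6⟩
      · exact .inl (l.act_mono h)
      · exact .inr ⟨by rw [h5], by rw [h6]⟩

theorem plus_le_plus_of_seqLT {o : Option V} {ε : ℤˣ} {x y : ℕ → Option D.Letter}
    (hx : S.IsRay o ε x) (hy : S.IsRay o ε y) (h : SeqLT x y) (d : ℕ) :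
    S.plus M d o ε x ≤ S.plus M d o ε y := by
  rcases plus_le_minus_or_eq (M := M) hx hy h d with h | h
  · exact h.trans (minus_le_plus d o ε y)
  · exact h.1.le

/-- Letters act monotonically, so the comparison at the first difference propagates through the
common prefix. The depth needed is one more than the length of that prefix. -/
theorem exists_plus_le_minus {o : Option V} {ε : ℤˣ} {x y : ℕ → Option D.Letter}
    (hx : S.IsRay o ε x) (hy : S.IsRay o ε y) (h : SeqLT x y) :
    ∃ d, S.plus M d o ε x ≤ S.minus M d o ε y := by
  obtain ⟨k, h1, h2⟩ := h
  induction k generalizing o ε x y with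
  | zero => exact ⟨1, plus_le_minus_of_head (M := M) hx hy h2 0⟩
  | succ k ih =>
    obtain ⟨h3, h4⟩ := h1 0 k.succ_pos
    obtain ⟨l, hl⟩ := Option.isSome_iff_exists.mp h4
    have hl' : y 0 = some l := h3 ▸ hl
    obtain ⟨d, hd⟩ := ih (hx.of_some hl).2.2 (hy.of_some hl').2.2
      (fun j hj => h1 (j + 1) (by omega)) h2
    refine ⟨d + 1, ?_⟩
    rw [plus_succ_of_some hl, minus_succ_of_some hl']
    exact l.act_mono hd

variable (S M)

/-- The subspace `x^+`. -/
def plusInf (o : Option V) (ε : ℤˣ) (x : ℕ → Option D.Letter) : Submodule K M :=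
  ⨅ d, S.plus M d o ε x

/-- The subspace `x^-`. -/
def minusInf (o : Option V) (ε : ℤˣ) (x : ℕ → Option D.Letter) : Submodule K M :=
  ⨆ d, S.minus M d o ε x

variable {S M}

theorem plusInf_le (d : ℕ) (o : Option V) (ε : ℤˣ) (x : ℕ → Option D.Letter) :
    S.plusInf M o ε x ≤ S.plus M d o ε x := iInf_le _ d

theorem le_minusInf (d : ℕ) (o : Option V) (ε : ℤˣ) (x : ℕ → Option D.Letter) :
    S.minus M d o ε x ≤ S.minusInf M o ε x := le_iSup (fun d => S.minus M d o ε x) d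

theorem minusInf_le_plusInf {o : Option V} {ε : ℤˣ} {x : ℕ → Option D.Letter}
    (hx : S.IsRay o ε x) : S.minusInf M o ε x ≤ S.plusInf M o ε x :=
  iSup_le fun d => le_iInf fun d' => minus_le_plus' hx d d'

theorem mem_minusInf {o : Option V} {ε : ℤˣ} {x : ℕ → Option D.Letter} {m : M} :
    m ∈ S.minusInf M o ε x ↔ ∃ d, m ∈ S.minus M d o ε x :=
  Submodule.mem_iSup_of_directed _ (minus_monotone o ε x).directed_le

theorem plusInf_le_vertexSpace {v : V} {ε : ℤˣ} {x : ℕ → Option D.Letter} :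
    S.plusInf M (some v) ε x ≤ D.vertexSpace M v := plusInf_le 0 (some v) ε x

theorem plusInf_le_minusInf {o : Option V} {ε : ℤˣ} {x y : ℕ → Option D.Letter}
    (hx : S.IsRay o ε x) (hy : S.IsRay o ε y) (h : SeqLT x y) :
    S.plusInf M o ε x ≤ S.minusInf M o ε y := by
  obtain ⟨d, hd⟩ := exists_plus_le_minus (M := M) hx hy h
  exact (plusInf_le d o ε x).trans (hd.trans (le_minusInf d o ε y))

theorem minusInf_of_none {o : Option V} {ε : ℤˣ} {x : ℕ → Option D.Letter}
    (h : x 0 = none) : S.minusInf M o ε x = o.elim ⊥ fun l => S.oneMinus M l ε := by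
  refine le_antisymm (iSup_le fun d => ?_)
    ((minus_succ_of_none (d := 0) h).ge.trans (le_minusInf 1 o ε x))
  exact (minus_monotone o ε x d.le_succ).trans (minus_succ_of_none h).le

section Finite

variable [Module.Finite K M]

theorem exists_stable {o : Option V} {ε : ℤˣ} {x : ℕ → Option D.Letter} (hx : S.IsRay o ε x) :
    ∃ d, ∀ d' ≥ d, S.plus M d' o ε x = S.plusInf M o ε x ∧
      S.minus M d' o ε x = S.minusInf M o ε x := by
  obtain ⟨d₁, h1⟩ := WellFoundedGT.monotone_chain_condition
    (⟨fun d => OrderDual.toDual (S.plus M d o ε x), fun _ _ h => plus_antitone hx h⟩ :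
      ℕ →o (Submodule K M)ᵒᵈ)
  obtain ⟨d₂, h2⟩ := WellFoundedGT.monotone_chain_condition
    (⟨fun d => S.minus M d o ε x, minus_monotone o ε x⟩ : ℕ →o Submodule K M)
  refine ⟨max d₁ d₂, fun d' hd => ⟨le_antisymm (le_iInf fun d => ?_) (plusInf_le _ _ _ _),
    le_antisymm (le_minusInf _ _ _ _) (iSup_le fun d => ?_)⟩⟩
  · have h3 : S.plus M d₁ o ε x = S.plus M d' o ε x := h1 d' ((le_max_left _ _).trans hd)
    have h4 : S.plus M d₁ o ε x = S.plus M (max d₁ d) o ε x := h1 _ (le_max_left _ _)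
    rw [← h3, h4]
    exact plus_antitone hx (le_max_right _ _)
  · have h3 : S.minus M d₂ o ε x = S.minus M d' o ε x := h2 d' ((le_max_right _ _).trans hd)
    have h4 : S.minus M d₂ o ε x = S.minus M (max d₂ d) o ε x := h2 _ (le_max_left _ _)
    rw [← h3, h4]
    exact minus_monotone o ε x (le_max_right _ _)

/-- Images do not commute with infinite intersections. Finite dimension makes the truncated
subspaces stationary, so the limit is reached at a finite depth, where the recursion applies. -/
theorem plusInf_of_some {o : Option V} {ε : ℤˣ} {x : ℕ → Option D.Letter} (hx : S.IsRay o ε x)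
    {l : D.Letter} (h : x 0 = some l) : S.plusInf M o ε x =
      l.act M (S.plusInf M (some l.tail) (-S.sgn l.inverse) fun j => x (j + 1)) := by
  obtain ⟨d, hd⟩ := exists_stable (M := M) (hx.of_some h).2.2
  obtain ⟨d', hd'⟩ := exists_stable (M := M) hx
  rw [← (hd (max d d') (le_max_left _ _)).1, ← plus_succ_of_some (o := o) (ε := ε) h,
    (hd' (max d d' + 1) (by omega)).1]

theorem minusInf_of_some {o : Option V} {ε : ℤˣ} {x : ℕ → Option D.Letter} (hx : S.IsRay o ε x)
    {l : D.Letter} (h : x 0 = some l) : S.minusInf M o ε x =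
      l.act M (S.minusInf M (some l.tail) (-S.sgn l.inverse) fun j => x (j + 1)) := by
  obtain ⟨d, hd⟩ := exists_stable (M := M) (hx.of_some h).2.2
  obtain ⟨d', hd'⟩ := exists_stable (M := M) hx
  rw [← (hd (max d d') (le_max_left _ _)).2, ← minus_succ_of_some (o := o) (ε := ε) h,
    (hd' (max d d' + 1) (by omega)).2]

end Finite

end Filtration

/-! ### Every non-zero element is separated from zero by a ray -/

section Covering

variable {K V A : Type*} [DivisionRing K] [Fintype V] {D : SCData K V A} {S : D.SignChoice}
  {M : Type*} [AddCommGroup M] [Module K M] [Module D.Alg M] [IsScalarTower K D.Alg M]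

theorem act_star_vertexSpace (hns : D.IsNonSingularType) {s : A} (hs : s ∈ D.special) :
    Letter.act M (.star s hs) (D.vertexSpace M (D.tail s)) = D.vertexSpace M (D.head s) := by
  refine le_antisymm (Letter.act_le (.star s hs) _) fun m hm => ?_
  obtain ⟨c, d, h⟩ := exists_special_inverse (M := M) hns hs
  exact ⟨D.e (D.tail s) • (c • m + d • D.arr s • m), e_smul_mem _ _, by
    rw [arrMap_apply, arr_smul_e_smul, h m hm]⟩

theorem act_dir_vertexSpace {b : A} (hb : b ∉ D.special) :
    Letter.act M (.dir b hb) (D.vertexSpace M (D.tail b)) = D.arrowImage M b := by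
  ext m
  rw [mem_arrowImage]
  rfl

theorem act_inv_vertexSpace {a : A} (ha : a ∉ D.special) :
    Letter.act M (.inv a ha) (D.vertexSpace M (D.head a)) = D.vertexSpace M (D.tail a) :=
  inf_eq_left.mpr fun m _ => arr_smul_mem a m

/-- The signs determine a among the ordinary arrows leaving its tail, so being killed by a is the
only condition in 1^+. -/
theorem act_inv_bot {a : A} (ha : a ∉ D.special) :
    Letter.act M (.inv a ha) ⊥ = S.onePlus M (D.tail a) (S.sgn (.inv a ha)) := by
  refine le_antisymm ?_ onePlus_le_inv
  rintro m ⟨h1, h2⟩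
  refine ⟨h1, fun a' ha' h3 h4 => ?_⟩
  rw [inv_eq_of_sgn_eq h3 h4]
  exact h2

theorem act_map_bot (l : D.Letter) (hl : ∀ a ha, l ≠ .inv a ha) :
    l.act M ⊥ = ⊥ := by
  cases l with
  | inv a ha => exact absurd rfl (hl a ha)
  | _ => exact Submodule.map_bot _

/-- One step in the construction of a ray separating `m` from `0`. -/
theorem covering_step (hns : D.IsNonSingularType) (v : V) (ε : ℤˣ) (m : M)
    (Φ : Submodule K M → Submodule K M) (h1 : m ∈ Φ (D.vertexSpace M v)) (h2 : m ∉ Φ ⊥) :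
    (S.NoStar (some v) ε ∧ m ∈ Φ (S.onePlus M v ε) ∧ m ∉ Φ (S.oneMinus M v ε)) ∨
      ∃ l : D.Letter, v = l.head ∧ ε = S.sgn l ∧ m ∈ Φ (l.act M (D.vertexSpace M l.tail)) ∧
        m ∉ Φ (l.act M ⊥) := by
  -- Φ is the action of the letters found so far. If a special loop is available it must be the next
  -- letter, and it is harmless since it maps 0 and e_v M to themselves. Otherwise m falls into a
  -- gap of Φ0 ≤ Φ1^- ≤ Φ1^+ ≤ Φ(e_v M): in the first gap the next letter is b, in the second the
  -- ray stops, in the third the next letter is a⁻¹.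
  by_cases hst : S.NoStar (some v) ε
  swap
  · simp only [NoStar, not_forall, not_not] at hst
    obtain ⟨s, hs, h3, rfl⟩ := hst
    cases h3
    refine .inr ⟨.star s hs, rfl, rfl, ?_, ?_⟩
    · exact (act_star_vertexSpace (M := M) hns hs).symm ▸ h1
    · rwa [act_map_bot _ (by simp)]
  by_cases hm : m ∈ Φ (S.oneMinus M v ε)
  · by_cases hb : ∃ b, ∃ hb : b ∉ D.special, D.head b = v ∧ S.sgn (.dir b hb) = ε
    · obtain ⟨b, hb, rfl, rfl⟩ := hb
      refine .inr ⟨.dir b hb, rfl, rfl, ?_, ?_⟩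
      · have h : S.oneMinus M (D.head b) (S.sgn (.dir b hb)) = D.arrowImage M b := by
          refine le_antisymm (iSup₂_le ?_) (arrowImage_le_oneMinus rfl)
          rintro b' ⟨h3, h4⟩
          by_cases hb' : b' ∈ D.special
          · rw [ofArrow_of_mem hb'] at h4
            cases star_eq_of_sgn_eq (l := .dir b hb) (hs := hb') h3 h4
          · rw [ofArrow_of_notMem hb'] at h4
            rw [dir_eq_of_sgn_eq h3 h4]
        rw [Letter.tail, act_dir_vertexSpace, ← h]
        exact hm
      · rwa [act_map_bot _ (by simp)]
    · have h : S.oneMinus M v ε = ⊥ := by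
        refine eq_bot_iff.mpr (iSup₂_le ?_)
        rintro b ⟨h3, h4⟩
        by_cases hb' : b ∈ D.special
        · rw [ofArrow_of_mem hb'] at h4
          exact absurd ⟨congrArg some h3.symm, h4⟩ (hst b hb')
        · rw [ofArrow_of_notMem hb'] at h4
          exact absurd ⟨b, hb', h3, h4⟩ hb
      rw [h] at hm
      exact absurd hm h2
  · by_cases hm' : m ∈ Φ (S.onePlus M v ε)
    · exact .inl ⟨hst, hm', hm⟩
    · by_cases ha : ∃ a, ∃ ha : a ∉ D.special, D.tail a = v ∧ S.sgn (.inv a ha) = ε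
      · obtain ⟨a, ha, rfl, rfl⟩ := ha
        refine .inr ⟨.inv a ha, rfl, rfl, ?_, ?_⟩
        · rw [Letter.tail, act_inv_vertexSpace]
          exact h1
        · rwa [act_inv_bot (S := S)]
      · have h : S.onePlus M v ε = D.vertexSpace M v :=
          le_antisymm (onePlus_le v ε) fun u hu =>
            ⟨hu, fun a ha' h3 h4 => absurd ⟨a, ha', h3, h4⟩ ha⟩
        rw [h] at hm'
        exact absurd h1 hm'

/-- Every non-zero element of `e_v M` is separated from `0` by some ray. -/
theorem exists_ray (hns : D.IsNonSingularType) (v : V) (ε : ℤˣ) (m : M)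
    (h1 : m ∈ D.vertexSpace M v) (h2 : m ≠ 0) :
    ∃ x, S.IsRay (some v) ε x ∧ m ∈ S.plusInf M (some v) ε x ∧
      m ∉ S.minusInf M (some v) ε x := by
  -- A state records the head and sign of the rest of the ray and the action of the prefix already
  -- chosen; its invariant is that m still lies strictly between the images of 0 and of the vertex
  -- space.
  let St := {p : V × ℤˣ × (Submodule K M → Submodule K M) //
    m ∈ p.2.2 (D.vertexSpace M p.1) ∧ m ∉ p.2.2 ⊥}
  have hstep : ∀ p : St, ∃ q : Option (D.Letter × St),
      (q = none → S.NoStar (some p.1.1) p.1.2.1 ∧ m ∈ p.1.2.2 (S.onePlus M p.1.1 p.1.2.1) ∧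
        m ∉ p.1.2.2 (S.oneMinus M p.1.1 p.1.2.1)) ∧
      ∀ l p', q = some (l, p') → p.1.1 = l.head ∧ p.1.2.1 = S.sgn l ∧
        p'.1 = (l.tail, -S.sgn l.inverse, fun U => p.1.2.2 (l.act M U)) := by
    rintro ⟨⟨v, ε, Φ⟩, h1, h2⟩
    rcases covering_step (S := S) hns v ε m Φ h1 h2 with h | ⟨l, h3, h4, h5, h6⟩
    · exact ⟨none, fun _ => h, by simp⟩
    · refine ⟨some (l, ⟨(l.tail, -S.sgn l.inverse, fun U => Φ (l.act M U)), h5, h6⟩), by simp, ?_⟩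
      rintro l' p' h
      cases h
      exact ⟨h3, h4, rfl⟩
  choose nxt hnone hsome using hstep
  let gen : ℕ → St → Option D.Letter := fun j => Nat.rec (fun p => (nxt p).map Prod.fst)
    (fun _ ih p => (nxt p).elim none fun q => ih q.2) j
  have gen_zero : ∀ p, gen 0 p = (nxt p).map Prod.fst := fun _ => rfl
  have gen_succ : ∀ j p, gen (j + 1) p = (nxt p).elim none fun q => gen j q.2 := fun _ _ => rfl
  -- The prefix is carried inside the statement, so an induction on the truncation depth d, over all
  -- states at once, suffices even for an infinite ray.
  have hmem : ∀ d (p : St),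
      m ∈ p.1.2.2 (S.plus M d (some p.1.1) p.1.2.1 fun j => gen j p) ∧
      m ∉ p.1.2.2 (S.minus M d (some p.1.1) p.1.2.1 fun j => gen j p) := by
    intro d
    induction d with
    | zero => exact fun p => p.2
    | succ d ih =>
      intro p
      cases h : nxt p with
      | none =>
        have h0 : gen 0 p = none := by rw [gen_zero, h]; rfl
        rw [plus_succ_of_none h0, minus_succ_of_none h0]
        exact (hnone p h).2
      | some q =>
        have h0 : gen 0 p = some q.1 := by rw [gen_zero, h]; rfl
        have h3 := (hsome p q.1 q.2 h).2.2
        have h4 : (fun j => gen (j + 1) p) = fun j => gen j q.2 := by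
          funext j
          rw [gen_succ, h]
          rfl
        rw [plus_succ_of_some h0, minus_succ_of_some h0, h4]
        have := ih q.2
        rw [h3] at this
        exact this
  let p₀ : St := ⟨(v, ε, id), h1, by simpa using h2⟩
  refine ⟨fun j => gen j p₀, ⟨fun o ε x => ∃ p : St, o = some p.1.1 ∧ ε = p.1.2.1 ∧
    x = fun j => gen j p, ?_, p₀, rfl, rfl, rfl⟩, ?_, ?_⟩
  · rintro _ _ _ ⟨p, rfl, rfl, rfl⟩
    cases h : nxt p with
    | none =>
      refine .inl ⟨fun j => ?_, (hnone p h).1⟩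
      cases j with
      | zero => simp only [gen_zero, h, Option.map_none]
      | succ j => simp only [gen_succ, h, Option.elim_none]
    | some q =>
      obtain ⟨h3, h4, h5⟩ := hsome p q.1 q.2 h
      refine .inr ⟨q.1, by simp only [gen_zero, h, Option.map_some], by rw [h3], h4, q.2, by rw [h5],
        by rw [h5], ?_⟩
      funext j
      change gen (j + 1) p = _
      rw [gen_succ, h]
      rfl
  · exact (Submodule.mem_iInf _).mpr fun d => (hmem d p₀).1
  · rw [mem_minusInf]
    rintro ⟨d, hd⟩
    exact (hmem d p₀).2 hd

end Covering

end SignChoice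

end SCData

/-! ### Filtrations given by linearly ordered intervals -/

section Flag

variable {K M ι κ : Type*} [DivisionRing K] [AddCommGroup M] [Module K M]

/-- Intervals `lo x ≤ hi x` of subspaces of `U`, for `x` in `T`, which are linearly ordered and
separate every non-zero element of `U` from `0`. -/
structure IsIntervalFlag (T : Set ι) (lo hi : ι → Submodule K M) (U : Submodule K M) : Prop where
  lo_le_hi : ∀ x ∈ T, lo x ≤ hi x
  linear : ∀ x ∈ T, ∀ y ∈ T, x = y ∨ hi x ≤ lo y ∨ hi y ≤ lo x
  hi_le : ∀ x ∈ T, hi x ≤ U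
  cover : ∀ m ∈ U, m ≠ 0 → ∃ x ∈ T, m ∈ hi x ∧ m ∉ lo x

namespace IsIntervalFlag

variable {T : Set ι} {lo hi : ι → Submodule K M} {U : Submodule K M}

theorem restrict (h : IsIntervalFlag T lo hi U) :
    IsIntervalFlag {x ∈ T | lo x ≠ hi x} lo hi U where
  lo_le_hi x hx := h.lo_le_hi x hx.1
  linear x hx y hy := h.linear x hx.1 y hy.1
  hi_le x hx := h.hi_le x hx.1
  cover m hm hm0 := by
    obtain ⟨x, hx, h1, h2⟩ := h.cover m hm hm0
    exact ⟨x, ⟨hx, fun h3 => h2 (h3 ▸ h1)⟩, h1, h2⟩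

variable [Module.Finite K M]

/-- Non-trivial intervals are strictly stacked, so their upper ends have distinct dimensions, all
bounded by dim M. -/
theorem finite (h : IsIntervalFlag T lo hi U) : {x ∈ T | lo x ≠ hi x}.Finite := by
  refine Set.Finite.of_injOn (f := fun x => Module.finrank K (hi x))
    (t := Set.Iic (Module.finrank K M)) (fun x _ => Submodule.finrank_le _) ?_ (Set.finite_Iic _)
  rintro x ⟨hx, hx'⟩ y ⟨hy, hy'⟩ hxy
  have hlt : ∀ x ∈ T, lo x ≠ hi x → Module.finrank K (lo x) < Module.finrank K (hi x) :=
    fun x hx hx' => Submodule.finrank_lt_finrank_of_lt (lt_of_le_of_ne (h.lo_le_hi x hx) hx')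
  have h1 := hlt x hx hx'
  have h2 := hlt y hy hy'
  rcases h.linear x hx y hy with h3 | h3 | h3
  · exact h3
  · have := Submodule.finrank_mono h3
    simp only at hxy
    omega
  · have := Submodule.finrank_mono h3
    simp only at hxy
    omega

/-- The increments of a function on subspaces along a flag of intervals add up to the total
increment. -/
theorem sum_sub_finset (φ : Submodule K M → ℤ) (s : Finset ι) (hne : ∀ x ∈ s, lo x ≠ hi x)
    (h : IsIntervalFlag (s : Set ι) lo hi U) :
    ∑ x ∈ s, (φ (hi x) - φ (lo x)) = φ U - φ ⊥ := by
  classical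
  induction hn : s.card generalizing s U with
  | zero =>
    obtain rfl := Finset.card_eq_zero.mp hn
    have hU : U = ⊥ := by
      refine (Submodule.eq_bot_iff U).mpr fun m hm => ?_
      by_contra hm0
      obtain ⟨x, hx, -⟩ := h.cover m hm hm0
      simp at hx
    simp [hU]
  | succ n ih =>
    -- Peel off the top interval. By covering its upper end must be U, and the remaining intervals
    -- form a flag of its lower end.
    obtain ⟨z, hz, hmax⟩ := s.exists_max_image (fun x => Module.finrank K (hi x))
      (Finset.card_pos.mp (by omega))
    have hzlt : ∀ x ∈ s, x ≠ z → hi x ≤ lo z := by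
      intro x hx hxz
      rcases h.linear x hx z hz with h1 | h1 | h1
      · exact absurd h1 hxz
      · exact h1
      · have h2 := Submodule.finrank_lt_finrank_of_lt
          (lt_of_le_of_ne (h.lo_le_hi x hx) (hne x hx))
        have h3 := Submodule.finrank_mono h1
        have h4 := hmax x hx
        omega
    have hU : U = hi z := by
      refine le_antisymm (fun m hm => ?_) (h.hi_le z hz)
      by_cases hm0 : m = 0
      · rw [hm0]; exact zero_mem _
      obtain ⟨x, hx, h1, -⟩ := h.cover m hm hm0
      by_cases hxz : x = z
      · exact hxz ▸ h1
      · exact h.lo_le_hi z hz (hzlt x hx hxz h1)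
    have h' : IsIntervalFlag ((s.erase z : Finset ι) : Set ι) lo hi (lo z) := by
      refine ⟨fun x hx => h.lo_le_hi x (Finset.mem_of_mem_erase hx), fun x hx y hy =>
        h.linear x (Finset.mem_of_mem_erase hx) y (Finset.mem_of_mem_erase hy), fun x hx =>
        hzlt x (Finset.mem_of_mem_erase hx) (Finset.ne_of_mem_erase hx), fun m hm hm0 => ?_⟩
      obtain ⟨x, hx, h1, h2⟩ := h.cover m (hU ▸ h.lo_le_hi z hz hm) hm0
      refine ⟨x, Finset.mem_erase.mpr ⟨?_, hx⟩, h1, h2⟩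
      rintro rfl
      exact h2 hm
    have h5 := ih (s.erase z) (fun x hx => hne x (Finset.mem_of_mem_erase hx)) h'
      (by rw [Finset.card_erase_of_mem hz]; omega)
    rw [← Finset.add_sum_erase s _ hz, h5, hU]
    ring

theorem sum_sub (h : IsIntervalFlag T lo hi U) (φ : Submodule K M → ℤ) :
    ∑ x ∈ h.finite.toFinset, (φ (hi x) - φ (lo x)) = φ U - φ ⊥ := by
  refine sum_sub_finset φ _ (fun x hx => ?_) ?_
  · exact ((Set.Finite.mem_toFinset _).mp hx).2
  · rw [Set.Finite.coe_toFinset]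
    exact h.restrict

/-- The dimension of a space with two flags of intervals is the sum of the dimensions of the
subquotients of the common refinement. -/
theorem sum_sum_finrank {T' : Set κ} {lo' hi' : κ → Submodule K M}
    (h : IsIntervalFlag T lo hi U) (h' : IsIntervalFlag T' lo' hi' U) :
    ∑ x ∈ h.finite.toFinset, ∑ y ∈ h'.finite.toFinset,
      (Module.finrank K (hi x ⊓ hi' y : Submodule K M) -
        Module.finrank K (hi x ⊓ lo' y ⊔ lo x ⊓ hi' y : Submodule K M)) =
      Module.finrank K U := by
  -- The two summands of the denominator meet in lo x ∩ lo' y, so the dimension of each subquotient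
  -- is a mixed second difference of (X, Y) ↦ dim (X ∩ Y).
  have h1 : ∀ x ∈ h.finite.toFinset, ∀ y ∈ h'.finite.toFinset,
      ((Module.finrank K (hi x ⊓ hi' y : Submodule K M) -
        Module.finrank K (hi x ⊓ lo' y ⊔ lo x ⊓ hi' y : Submodule K M) : ℕ) : ℤ) =
      ((Module.finrank K (hi x ⊓ hi' y : Submodule K M) : ℤ) -
        Module.finrank K (lo x ⊓ hi' y : Submodule K M)) -
      ((Module.finrank K (hi x ⊓ lo' y : Submodule K M) : ℤ) -
        Module.finrank K (lo x ⊓ lo' y : Submodule K M)) := by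
    intro x hx y hy
    have hx' := h.lo_le_hi x ((Set.Finite.mem_toFinset _).mp hx).1
    have hy' := h'.lo_le_hi y ((Set.Finite.mem_toFinset _).mp hy).1
    have h2 : (hi x ⊓ lo' y ⊔ lo x ⊓ hi' y : Submodule K M) ≤ hi x ⊓ hi' y :=
      sup_le (inf_le_inf_left _ hy') (inf_le_inf_right _ hx')
    have h3 : (hi x ⊓ lo' y) ⊓ (lo x ⊓ hi' y) = lo x ⊓ lo' y := by
      refine le_antisymm (le_inf (inf_le_right.trans inf_le_left) (inf_le_left.trans inf_le_right))
        (le_inf (inf_le_inf_right _ hx') (inf_le_inf_left _ hy'))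
    have h4 := Submodule.finrank_sup_add_finrank_inf_eq (hi x ⊓ lo' y) (lo x ⊓ hi' y)
    rw [h3] at h4
    have h5 := Submodule.finrank_mono h2
    omega
  zify
  rw [Finset.sum_congr rfl fun x hx => Finset.sum_congr rfl (h1 x hx)]
  -- The second differences telescope, first along the flag in Y and then along the flag in X.
  rw [Finset.sum_congr rfl fun x _ => h'.sum_sub fun Y =>
    (Module.finrank K (hi x ⊓ Y : Submodule K M) : ℤ) - Module.finrank K (lo x ⊓ Y : Submodule K M)]
  have h6 := h.sum_sub fun X => (Module.finrank K (X : Submodule K M) : ℤ)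
  rw [finrank_bot, Nat.cast_zero, sub_zero] at h6
  rw [← h6]
  refine Finset.sum_congr rfl fun x hx => ?_
  have hx' := (Set.Finite.mem_toFinset _).mp hx
  rw [inf_eq_left.mpr (h.hi_le x hx'.1),
    inf_eq_left.mpr ((h.lo_le_hi x hx'.1).trans (h.hi_le x hx'.1)), inf_bot_eq, inf_bot_eq,
    finrank_bot]
  ring

/-- A non-zero element can be replaced, without leaving `x^+` and modulo `x^-`, by one which is
non-zero in a subquotient of the common refinement of two flags. -/
theorem exists_refined {T' : Set κ} {lo' hi' : κ → Submodule K M}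
    (h : IsIntervalFlag T lo hi U) (h' : IsIntervalFlag T' lo' hi' U) {m : M} (hm : m ∈ U)
    (hm0 : m ≠ 0) : ∃ x ∈ T, ∃ y ∈ T', ∃ m' ∈ hi x ⊓ hi' y, m - m' ∈ lo x ∧
      m' ∉ hi x ⊓ lo' y ⊔ lo x ⊓ hi' y := by
  obtain ⟨x, hx, hmx, hmx'⟩ := h.cover m hm hm0
  have hex : ∃ y ∈ {y ∈ T' | lo' y ≠ hi' y}, ∃ m' ∈ hi x ⊓ hi' y, m - m' ∈ lo x := by
    obtain ⟨y, hy, h1, h2⟩ := h'.restrict.cover m hm hm0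
    exact ⟨y, hy, m, ⟨hmx, h1⟩, by simp⟩
  -- Among the representatives of m modulo lo x inside hi x, take one in the lowest possible
  -- interval of the second flag. If it were p + q in the denominator, then p would be a
  -- representative in a strictly lower interval.
  have hex' : ∃ n, ∃ y ∈ {y ∈ T' | lo' y ≠ hi' y}, Module.finrank K (hi' y) = n ∧
      ∃ m' ∈ hi x ⊓ hi' y, m - m' ∈ lo x := by
    obtain ⟨y, hy, hm'⟩ := hex
    exact ⟨_, y, hy, rfl, hm'⟩
  classical
  obtain ⟨y, hy, h1, m', hm', hmm'⟩ := Nat.find_spec hex'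
  have hmin := fun k => Nat.find_min (m := k) hex'
  generalize Nat.find hex' = n at h1 hmin
  refine ⟨x, hx, y, hy.1, m', hm', hmm', fun hden => ?_⟩
  obtain ⟨p, hp, q, hq, rfl⟩ := Submodule.mem_sup.mp hden
  have hp0 : p ≠ 0 := by
    rintro rfl
    apply hmx'
    have := add_mem hmm' hq.1
    simpa using this
  obtain ⟨z, hz, h2, h3⟩ := h'.restrict.cover p (h'.hi_le y hy.1 (h'.lo_le_hi y hy.1 hp.2)) hp0
  refine hmin (Module.finrank K (hi' z)) ?_ ⟨z, hz, rfl, p, ⟨hp.1, h2⟩, ?_⟩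
  · have h5 := Submodule.finrank_lt_finrank_of_lt (lt_of_le_of_ne (h'.lo_le_hi y hy.1) hy.2)
    rcases h'.linear z hz.1 y hy.1 with rfl | h4 | h4
    · exact absurd hp.2 h3
    · have := Submodule.finrank_mono h4
      omega
    · exact absurd (h4 (h'.lo_le_hi y hy.1 hp.2)) h3
  · have := add_mem hmm' hq.1
    rw [show m - p = m - (p + q) + q by abel]
    exact this

end IsIntervalFlag

end Flag

namespace SCData

/-! ### The decomposition of M by vertices -/

section VertexSum

variable {K V A : Type*} [DivisionRing K] [Fintype V] (D : SCData K V A)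
  (M : Type*) [AddCommGroup M] [Module K M] [Module D.Alg M] [IsScalarTower K D.Alg M]

/-- The decomposition of `M` as the sum of the spaces `e_v M`. -/
def vertexEquiv : M ≃ₗ[K] (∀ v, D.vertexSpace M v) where
  toFun m v := ⟨D.e v • m, e_smul_mem v m⟩
  invFun f := ∑ v, (f v : M)
  map_add' m m' := by
    funext v
    exact Subtype.ext (smul_add _ _ _)
  map_smul' c m := by
    funext v
    refine Subtype.ext ?_
    change D.e v • c • m = c • D.e v • m
    rw [← scalar_smul (D := D), ← mul_smul, e_mul_scalar, mul_smul, scalar_smul]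
  left_inv m := by
    change ∑ v, D.e v • m = m
    rw [← Finset.sum_smul, sum_e, one_smul]
  right_inv f := by
    funext v
    refine Subtype.ext ?_
    change D.e v • ∑ w, (f w : M) = f v
    rw [Finset.smul_sum, Finset.sum_eq_single v]
    · exact (f v).2
    · intro w _ hw
      rw [← (f w).2, ← mul_smul, e_mul_e_of_ne D hw.symm, zero_smul]
    · simp

theorem sum_finrank_vertexSpace [Module.Finite K M] :
    ∑ v, Module.finrank K (D.vertexSpace M v) = Module.finrank K M := by
  rw [(D.vertexEquiv M).finrank_eq, Module.finrank_pi_fintype]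

end VertexSum

namespace SignChoice

/-! ### The common refinement of the two flags at each vertex -/

section Points

variable {K V A : Type*} [DivisionRing K] [Fintype V] {D : SCData K V A} (S : D.SignChoice)
  (M : Type*) [AddCommGroup M] [Module K M] [Module D.Alg M] [IsScalarTower K D.Alg M]

/-- For one-sided words `x`, `y` with head `o` and signs `-ε`, `ε`, the subspace `x^+ ∩ y^+`. -/
def num (o : Option V) (ε : ℤˣ) (x y : ℕ → Option D.Letter) : Submodule K M :=
  S.plusInf M o (-ε) x ⊓ S.plusInf M o ε y

/-- For one-sided words `x`, `y` with head `o` and signs `-ε`, `ε`, the subspace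
`x^+ ∩ y^- + x^- ∩ y^+`. -/
def den (o : Option V) (ε : ℤˣ) (x y : ℕ → Option D.Letter) : Submodule K M :=
  S.plusInf M o (-ε) x ⊓ S.minusInf M o ε y ⊔ S.minusInf M o (-ε) x ⊓ S.plusInf M o ε y

/-- The dimension of `(x^+ ∩ y^+) / (x^+ ∩ y^- + x^- ∩ y^+)`. -/
noncomputable def mult (o : Option V) (ε : ℤˣ) (x y : ℕ → Option D.Letter) : ℕ :=
  Module.finrank K (S.num M o ε x y) - Module.finrank K (S.den M o ε x y)

/-- The pairs of rays with signs `-1` and `1` for which the subquotient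
`(x^+ ∩ y^+) / (x^+ ∩ y^- + x^- ∩ y^+)` is non-zero. -/
def points : Set (Σ _ : V, (ℕ → Option D.Letter) × (ℕ → Option D.Letter)) :=
  {p | S.IsRay (some p.1) (-1) p.2.1 ∧ S.IsRay (some p.1) 1 p.2.2 ∧
    ¬ S.num M (some p.1) 1 p.2.1 p.2.2 ≤ S.den M (some p.1) 1 p.2.1 p.2.2}

variable {S M}

theorem num_swap (o : Option V) (ε : ℤˣ) (x y : ℕ → Option D.Letter) :
    S.num M o (-ε) y x = S.num M o ε x y := by
  rw [num, num, neg_neg, inf_comm]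

theorem den_swap (o : Option V) (ε : ℤˣ) (x y : ℕ → Option D.Letter) :
    S.den M o (-ε) y x = S.den M o ε x y := by
  rw [den, den, neg_neg, sup_comm, inf_comm, inf_comm (S.plusInf M o ε y)]

theorem mult_swap (o : Option V) (ε : ℤˣ) (x y : ℕ → Option D.Letter) :
    S.mult M o (-ε) y x = S.mult M o ε x y := by
  rw [mult, mult, num_swap, den_swap]

theorem den_le_num {o : Option V} {ε : ℤˣ} {x y : ℕ → Option D.Letter}
    (hx : S.IsRay o (-ε) x) (hy : S.IsRay o ε y) : S.den M o ε x y ≤ S.num M o ε x y :=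
  sup_le (inf_le_inf_left _ (minusInf_le_plusInf hy)) (inf_le_inf_right _ (minusInf_le_plusInf hx))

theorem num_le_den_of_left {o : Option V} {ε : ℤˣ} {x y : ℕ → Option D.Letter}
    (h : S.plusInf M o (-ε) x ⊓ S.plusInf M o ε y ≤ S.minusInf M o (-ε) x) :
    S.num M o ε x y ≤ S.den M o ε x y :=
  le_sup_of_le_right (le_inf h inf_le_right)

theorem num_le_den_of_right {o : Option V} {ε : ℤˣ} {x y : ℕ → Option D.Letter}
    (h : S.plusInf M o (-ε) x ⊓ S.plusInf M o ε y ≤ S.minusInf M o ε y) :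
    S.num M o ε x y ≤ S.den M o ε x y :=
  le_sup_of_le_left (le_inf inf_le_left h)

/-- Linearity comes from the total order on rays together with the comparison x^+ ≤ y^- for x < y;
covering is `exists_ray`. -/
theorem isIntervalFlag (hns : D.IsNonSingularType) (v : V) (ε : ℤˣ) :
    IsIntervalFlag {x | S.IsRay (some v) ε x} (S.minusInf M (some v) ε)
      (S.plusInf M (some v) ε) (D.vertexSpace M v) where
  lo_le_hi _ hx := minusInf_le_plusInf hx
  linear _ hx _ hy := (hx.trichotomy hy).imp_right fun h =>
    h.imp (plusInf_le_minusInf hx hy) (plusInf_le_minusInf hy hx)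
  hi_le _ _ := plusInf_le_vertexSpace
  cover m hm hm0 := exists_ray hns v ε m hm hm0

variable [Module.Finite K M]

theorem mult_eq_zero {o : Option V} {ε : ℤˣ} {x y : ℕ → Option D.Letter}
    (h : S.num M o ε x y ≤ S.den M o ε x y) : S.mult M o ε x y = 0 :=
  Nat.sub_eq_zero_of_le (Submodule.finrank_mono h)

variable (S M) in
/-- A finite set containing all points. -/
noncomputable def pointsBound (hns : D.IsNonSingularType) :
    Finset (Σ _ : V, (ℕ → Option D.Letter) × (ℕ → Option D.Letter)) :=
  Finset.univ.sigma fun v => (isIntervalFlag (S := S) (M := M) hns v (-1)).finite.toFinset ×ˢ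
    (isIntervalFlag (S := S) (M := M) hns v 1).finite.toFinset

theorem points_subset (hns : D.IsNonSingularType) :
    S.points M ⊆ S.pointsBound M hns := by
  rintro ⟨v, x, y⟩ ⟨hx, hy, h⟩
  simp only [pointsBound, Finset.coe_sigma, Set.mem_sigma_iff, Finset.coe_univ, Set.mem_univ,
    true_and, Finset.mem_coe, Finset.mem_product, Set.Finite.mem_toFinset]
  refine ⟨⟨hx, fun h' => h (num_le_den_of_left ?_)⟩, ⟨hy, fun h' => h (num_le_den_of_right ?_)⟩⟩
  · exact inf_le_left.trans h'.ge
  · exact inf_le_right.trans h'.ge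

theorem points_finite (hns : D.IsNonSingularType) : (S.points M).Finite :=
  (Finset.finite_toSet _).subset (points_subset hns)

/-- The dimension formula before strings and bands enter: `sum_sum_finrank` for the flags of signs
-1 and 1, summed over the vertices. Pairs that are not points contribute zero. -/
theorem finsum_points (hns : D.IsNonSingularType) :
    ∑ᶠ p ∈ S.points M, S.mult M (some p.1) 1 p.2.1 p.2.2 = Module.finrank K M := by
  rw [finsum_mem_eq_sum_of_inter_support_eq (t := S.pointsBound M hns), pointsBound,
    Finset.sum_sigma, ← D.sum_finrank_vertexSpace M]
  · refine Finset.sum_congr rfl fun v _ => ?_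
    rw [Finset.sum_product]
    exact IsIntervalFlag.sum_sum_finrank (isIntervalFlag hns v (-1)) (isIntervalFlag hns v 1)
  · ext p
    refine ⟨fun h => ⟨points_subset hns h.1, h.2⟩, fun h => ⟨?_, h.2⟩⟩
    have h1 := h.1
    simp only [pointsBound, Finset.coe_sigma, Set.mem_sigma_iff, Finset.coe_univ, Set.mem_univ,
      true_and, Finset.mem_coe, Finset.mem_product, Set.Finite.mem_toFinset] at h1
    exact ⟨h1.1.1, h1.2.1, fun h2 => h.2 (mult_eq_zero h2)⟩

end Points

end SignChoice

end SCData

/-- The inverse of a letter of a walk. -/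
def SCWalkLetter.inverse {A : Type*} : SCWalkLetter A → SCWalkLetter A
  | dir a => inv a
  | inv a => dir a

namespace SCData

/-! ### Passing a letter -/

section Step

variable {K V A : Type*} [DivisionRing K] [Fintype V] {D : SCData K V A}
  {M : Type*} [AddCommGroup M] [Module K M] [Module D.Alg M] [IsScalarTower K D.Alg M]

variable (D M) in
/-- The linear relation on `M` given by a letter of a walk. -/
def Rel : SCWalkLetter A → M → M → Prop
  | .dir a, m, m' => m = D.arr a • m'
  | .inv a, m, m' => m' = D.arr a • m

theorem rel_inverse (c : SCWalkLetter A) (m m' : M) : D.Rel M c.inverse m m' ↔ D.Rel M c m' m := by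
  cases c <;> rfl

theorem Rel.sub {c : SCWalkLetter A} {m m' n n' : M} (h : D.Rel M c m m') (h' : D.Rel M c n n') :
    D.Rel M c (m - n) (m' - n') := by
  cases c <;> simp only [Rel] at * <;> rw [h, h', smul_sub]

theorem Rel.zero (c : SCWalkLetter A) : D.Rel M c 0 0 := by
  cases c <;> simp only [Rel] <;> rw [smul_zero]

/-- The walk letter `c` replaces the letter `l` in such a way that a special loop maps the smaller
one of the two intervals `[Xm, Xp]` and `[Ym, Yp]` on its sides to the larger one. -/
inductive Compat (Xm Xp Ym Yp : Submodule K M) : SCWalkLetter A → D.Letter → Prop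
  | dir (a : A) (ha : a ∉ D.special) : Compat Xm Xp Ym Yp (.dir a) (.dir a ha)
  | inv (a : A) (ha : a ∉ D.special) : Compat Xm Xp Ym Yp (.inv a) (.inv a ha)
  | star_dir (s : A) (hs : s ∈ D.special) (h : Yp ≤ Xp) (h' : Yp ≤ Xm ∨ Xm = Ym) :
      Compat Xm Xp Ym Yp (.dir s) (.star s hs)
  | star_inv (s : A) (hs : s ∈ D.special) (h : Xp ≤ Yp) (h' : Xp ≤ Ym ∨ Ym = Xm) :
      Compat Xm Xp Ym Yp (.inv s) (.star s hs)

/-- The situation on the two sides of a letter of a walk. -/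
structure IsStep (c : SCWalkLetter A) (l : D.Letter) (Xm Xp Ym Yp : Submodule K M) : Prop where
  compat : Compat Xm Xp Ym Yp c l
  left_le : Xm ≤ Xp
  right_le : Ym ≤ Yp
  left_vertex : Xp ≤ D.vertexSpace M l.head
  right_vertex : Yp ≤ D.vertexSpace M l.tail

namespace IsStep

variable {c : SCWalkLetter A} {l : D.Letter} {Xm Xp Ym Yp : Submodule K M}

/-- The situation is symmetric under inverting the letter and exchanging its sides, so each later
statement is needed in one direction only. -/
theorem swap (h : IsStep c l Xm Xp Ym Yp) (hD : D.IsClannish) :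
    IsStep c.inverse l.inverse Ym Yp Xm Xp := by
  obtain ⟨h1, h2, h3, h4, h5⟩ := h
  refine ⟨?_, h3, h2, by rwa [Letter.head_inverse l hD], by rwa [Letter.tail_inverse l hD]⟩
  cases h1 with
  | dir a ha => exact .inv a ha
  | inv a ha => exact .dir a ha
  | star_dir s hs h h' => exact .star_inv s hs h h'
  | star_inv s hs h h' => exact .star_dir s hs h h'

theorem right_vertex_special (hD : D.IsClannish) {s : A} {hs : s ∈ D.special}
    (h : IsStep c (.star s hs) Xm Xp Ym Yp) : Yp ≤ D.vertexSpace M (D.head s) := by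
  rw [hD.special_loop s hs]
  exact h.right_vertex

theorem left_vertex_special {s : A} {hs : s ∈ D.special}
    (h : IsStep c (.star s hs) Xm Xp Ym Yp) : Xp ≤ D.vertexSpace M (D.head s) := h.left_vertex

/-- For a special loop with m = sm' and Y^+ ≤ X^+, both m' and sm' lie in X^+, so m' lies in sX^+ by
the quadratic relation. Hence related elements of X^+ and Y^+ lie in the subspaces of both
neighbouring positions. -/
theorem mem_right (hns : D.IsNonSingularType) (hD : D.IsClannish)
    (h : IsStep c l Xm Xp Ym Yp) {m m' : M} (hr : D.Rel M c m m') (hm : m ∈ Xp) (hm' : m' ∈ Yp) :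
    m' ∈ l.inverse.act M Xp := by
  obtain ⟨h1, h2, h3, h4, h5⟩ := id h
  cases h1 with
  | dir a ha =>
    refine ⟨h5 hm', ?_⟩
    have hr' : m = D.arr a • m' := hr
    rw [hr'] at hm
    exact hm
  | inv a ha => exact ⟨m, hm, hr.symm⟩
  | star_dir s hs h6 h7 =>
    have hr' : m = D.arr s • m' := hr
    rw [hr'] at hm
    exact mem_map_special hns hs (h.right_vertex_special hD hm') (h6 hm') hm
  | star_inv s hs h6 h7 => exact ⟨m, hm, hr.symm⟩

theorem mem_left (hns : D.IsNonSingularType) (hD : D.IsClannish)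
    (h : IsStep c l Xm Xp Ym Yp) {m m' : M} (hr : D.Rel M c m m') (hm : m ∈ Xp) (hm' : m' ∈ Yp) :
    m ∈ l.act M Yp := by
  have := (h.swap hD).mem_right hns hD ((rel_inverse c _ _).mpr hr) hm' hm
  rwa [Letter.inverse_inverse] at this

theorem lift_right (hns : D.IsNonSingularType) (hD : D.IsClannish)
    (h : IsStep c l Xm Xp Ym Yp) {m : M} (hm : m ∈ Xp ⊓ l.act M Yp) :
    ∃ m' ∈ l.inverse.act M Xp ⊓ Yp, D.Rel M c m m' := by
  suffices ∃ m' ∈ Yp, D.Rel M c m m' by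
    obtain ⟨m', hm', hr⟩ := this
    exact ⟨m', ⟨h.mem_right hns hD hr hm.1 hm', hm'⟩, hr⟩
  obtain ⟨h1, h2, h3, h4, h5⟩ := id h
  cases h1 with
  | dir a ha =>
    obtain ⟨m', hm', hr⟩ := hm.2
    exact ⟨m', hm', hr.symm⟩
  | inv a ha => exact ⟨_, hm.2.2, rfl⟩
  | star_dir s hs h6 h7 =>
    obtain ⟨m', hm', hr⟩ := hm.2
    exact ⟨m', hm', hr.symm⟩
  | star_inv s hs h6 h7 =>
    obtain ⟨m', hm', hr⟩ := hm.2
    have hr' : D.arr s • m' = m := hr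
    -- The letter acts by m = sm', but the walk runs through s⁻¹ and requires the partner sm = s²m'.
    -- It lies in Y^+ because m' and sm' do.
    refine ⟨_, ?_, rfl⟩
    rw [← hr']
    exact special_sq_mem hs (h.right_vertex_special hD hm') hm' (hr' ▸ h6 hm.1)

theorem lift_left (hns : D.IsNonSingularType) (hD : D.IsClannish)
    (h : IsStep c l Xm Xp Ym Yp) {m' : M} (hm' : m' ∈ l.inverse.act M Xp ⊓ Yp) :
    ∃ m ∈ Xp ⊓ l.act M Yp, D.Rel M c m m' := by
  obtain ⟨m, hm, hr⟩ := (h.swap hD).lift_right hns hD hm'.symm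
  rw [Letter.inverse_inverse] at hm
  exact ⟨m, hm.symm, (rel_inverse c _ _).mp hr⟩

/-- For ordinary arrows the decomposition of m lifts along a. For a special loop, which is
injective, the decomposition has to be rearranged by means of the quadratic relation; this is where
the orientation of the loop and the second alternative in `Compat` are used. -/
theorem den_right_of_dir (hns : D.IsNonSingularType) (hD : D.IsClannish) {a : A}
    (h : IsStep (.dir a) l Xm Xp Ym Yp) {m m' : M} (hr : m = D.arr a • m')
    (hm' : m' ∈ l.inverse.act M Xp ⊓ Yp)
    (hden : m ∈ Xp ⊓ l.act M Ym ⊔ Xm ⊓ l.act M Yp) :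
    m' ∈ l.inverse.act M Xp ⊓ Ym ⊔ l.inverse.act M Xm ⊓ Yp := by
  obtain ⟨p, ⟨hp1, hp2⟩, q, ⟨hq1, hq2⟩, hpq⟩ := Submodule.mem_sup.mp hden
  obtain ⟨h1, h2, h3, h4, h5⟩ := id h
  cases h1 with
  | dir a ha =>
    obtain ⟨p', hp', hrp⟩ := hp2
    obtain ⟨q', hq', hrq⟩ := hq2
    have hrp' : D.arr a • p' = p := hrp
    have hrq' : D.arr a • q' = q := hrq
    -- Lift only p; the rest m' - p' is automatically a preimage of q, although it need not equal
    -- the chosen lift q'.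
    rw [show m' = p' + (m' - p') by abel]
    refine Submodule.add_mem_sup ⟨⟨h5 (h3 hp'), ?_⟩, hp'⟩
      ⟨⟨h5 (sub_mem hm'.2 (h3 hp')), ?_⟩, sub_mem hm'.2 (h3 hp')⟩
    · rw [SetLike.mem_coe, Submodule.mem_comap, arrMap_apply, hrp']
      exact hp1
    · rw [SetLike.mem_coe, Submodule.mem_comap, arrMap_apply, smul_sub, ← hr, hrp', ← hpq,
        add_sub_cancel_left]
      exact hq1
  | star_dir _ hs h6 h7 =>
    have hE := h.right_vertex_special hD
    obtain ⟨p', hp', hrp⟩ := hp2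
    obtain ⟨q', hq', hrq⟩ := hq2
    have hrp' : D.arr a • p' = p := hrp
    have hrq' : D.arr a • q' = q := hrq
    have hm'' : m' = p' + q' := by
      refine special_injective hns hs (hE hm'.2) (hE (add_mem (h3 hp') hq')) ?_
      rw [← hr, smul_add, hrp', hrq', hpq]
    have hp'' : p' ∈ Xp.map (D.arrMap M a) :=
      mem_map_special hns hs (hE (h3 hp')) (h6 (h3 hp')) (hrp'.symm ▸ hp1)
    rw [hm'']
    refine add_mem (Submodule.mem_sup_left ⟨hp'', hp'⟩) ?_
    rcases h7 with h7 | h7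
    · exact Submodule.mem_sup_right
        ⟨mem_map_special hns hs (hE hq') (h7 hq') (hrq'.symm ▸ hq1), hq'⟩
    -- When the smaller subspaces coincide, q' = s⁻¹q is a combination of q and sq, and these go
    -- into different summands: q into sX^+ ∩ Y^- and the multiple of sq into sX^- ∩ Y^+.
    · obtain ⟨u, v, huv⟩ := exists_special_inverse (M := M) hns hs
      have hqE : q ∈ D.vertexSpace M (D.head a) := h.left_vertex_special (h2 hq1)
      have heq : q' = u • q + v • D.arr a • q := by
        refine special_injective hns hs (hE hq') (add_mem (Submodule.smul_mem _ _ hqE)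
          (Submodule.smul_mem _ _ (arr_smul_mem _ _))) ?_
        rw [huv q hqE, hrq']
      have hqY : q ∈ Ym := h7 ▸ hq1
      have h8 : v • D.arr a • q ∈ Yp := by
        rw [show v • D.arr a • q = q' - u • q by rw [heq]; abel]
        exact sub_mem hq' (Submodule.smul_mem _ _ (h3 hqY))
      rw [heq]
      exact Submodule.add_mem_sup
        ⟨Submodule.smul_mem _ _ ⟨q', h6 hq', hrq'⟩, Submodule.smul_mem _ _ hqY⟩
        ⟨Submodule.smul_mem _ _ ⟨q, hq1, rfl⟩, h8⟩

theorem den_left_of_dir (hns : D.IsNonSingularType) (hD : D.IsClannish) {a : A}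
    (h : IsStep (.dir a) l Xm Xp Ym Yp) {m m' : M} (hr : m = D.arr a • m')
    (hden : m' ∈ l.inverse.act M Xp ⊓ Ym ⊔ l.inverse.act M Xm ⊓ Yp) :
    m ∈ Xp ⊓ l.act M Ym ⊔ Xm ⊓ l.act M Yp := by
  obtain ⟨p, ⟨hp1, hp2⟩, q, ⟨hq1, hq2⟩, rfl⟩ := Submodule.mem_sup.mp hden
  rw [hr, smul_add]
  obtain ⟨h1, h2, h3, h4, h5⟩ := id h
  cases h1 with
  | dir a ha => exact Submodule.add_mem_sup ⟨hp1.2, p, hp2, rfl⟩ ⟨hq1.2, q, hq2, rfl⟩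
  | star_dir _ hs h6 h7 =>
    have hE := h.right_vertex_special hD
    obtain ⟨p', hp', hrp⟩ := hp1
    obtain ⟨q', hq', hrq⟩ := hq1
    have hrp' : D.arr a • p' = p := hrp
    have hrq' : D.arr a • q' = q := hrq
    refine add_mem (Submodule.mem_sup_left ⟨?_, p, hp2, rfl⟩) ?_
    · rw [← hrp']
      exact special_sq_mem hs (h.left_vertex_special hp') hp' (hrp'.symm ▸ h6 (h3 hp2))
    · have hqE : q' ∈ D.vertexSpace M (D.head a) := h.left_vertex_special (h2 hq')
      rcases h7 with h7 | h7
      · refine Submodule.mem_sup_right ⟨?_, q, hq2, rfl⟩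
        rw [← hrq']
        exact special_sq_mem hs hqE hq' (hrq'.symm ▸ h7 hq2)
      -- Here sq = βq - γq' with q = sq'. The term βq belongs to X^+ ∩ sY^- and the term γq' to X^-
      -- ∩ sY^+.
      · have hqY : q' ∈ Ym := h7 ▸ hq'
        rw [← hrq', special_sq_smul hs hqE, sub_eq_add_neg]
        refine Submodule.add_mem_sup ⟨Submodule.smul_mem _ _ (hrq'.symm ▸ h6 hq2),
          Submodule.smul_mem _ _ ⟨q', hqY, rfl⟩⟩ ⟨neg_mem (Submodule.smul_mem _ _ hq'),
          neg_mem (Submodule.smul_mem _ _ ?_)⟩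
        exact mem_map_special hns hs hqE (h3 hqY) (hrq'.symm ▸ hq2)

theorem den_right (hns : D.IsNonSingularType) (hD : D.IsClannish)
    (h : IsStep c l Xm Xp Ym Yp) {m m' : M} (hr : D.Rel M c m m')
    (hm' : m' ∈ l.inverse.act M Xp ⊓ Yp)
    (hden : m ∈ Xp ⊓ l.act M Ym ⊔ Xm ⊓ l.act M Yp) :
    m' ∈ l.inverse.act M Xp ⊓ Ym ⊔ l.inverse.act M Xm ⊓ Yp := by
  cases c with
  | dir a => exact h.den_right_of_dir hns hD hr hm' hden
  | inv a =>
    rw [sup_comm, inf_comm, inf_comm (l.inverse.act M Xp)]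
    refine (h.swap hD).den_left_of_dir hns hD hr ?_
    rwa [Letter.inverse_inverse, sup_comm, inf_comm _ Xm, inf_comm _ Xp]

theorem den_left (hns : D.IsNonSingularType) (hD : D.IsClannish)
    (h : IsStep c l Xm Xp Ym Yp) {m m' : M} (hr : D.Rel M c m m')
    (hm : m ∈ Xp ⊓ l.act M Yp)
    (hden : m' ∈ l.inverse.act M Xp ⊓ Ym ⊔ l.inverse.act M Xm ⊓ Yp) :
    m ∈ Xp ⊓ l.act M Ym ⊔ Xm ⊓ l.act M Yp := by
  have := (h.swap hD).den_right hns hD ((rel_inverse c _ _).mpr hr)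
    (by rw [Letter.inverse_inverse]; exact hm.symm)
    (by rwa [sup_comm, inf_comm Yp, inf_comm Ym])
  rwa [Letter.inverse_inverse, sup_comm, inf_comm (l.act M Yp), inf_comm (l.act M Ym)] at this

/-- An element of the smaller interval on the left of the point after the letter comes from the
interval before the letter, up to the smaller interval on the right. -/
theorem exists_rel_sub (hns : D.IsNonSingularType)
    (h : IsStep c l Xm Xp Ym Yp) {m' : M} (hm' : m' ∈ l.inverse.act M Xm ⊓ Yp) :
    ∃ p ∈ Xm ⊓ l.act M Yp, ∃ q ∈ l.inverse.act M Xp ⊓ Ym, D.Rel M c p (m' - q) := by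
  obtain ⟨h1, h2, h3, h4, h5⟩ := id h
  cases h1 with
  | dir a ha =>
    refine ⟨D.arr a • m', ⟨hm'.1.2, m', hm'.2, rfl⟩, 0, zero_mem _, ?_⟩
    rw [sub_zero]
    rfl
  | inv a ha =>
    obtain ⟨⟨u, hu, hr⟩, hmY⟩ := hm'
    have hr' : D.arr a • u = m' := hr
    refine ⟨u, ⟨hu, h4 (h2 hu), ?_⟩, 0, zero_mem _, ?_⟩
    · rw [SetLike.mem_coe, Submodule.mem_comap, arrMap_apply, hr']
      exact hmY
    · rw [sub_zero]
      exact hr'.symm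
  | star_inv s hs h6 h7 =>
    obtain ⟨⟨u, hu, hr⟩, hmY⟩ := hm'
    have hr' : D.arr s • u = m' := hr
    refine ⟨u, ⟨hu, ?_⟩, 0, zero_mem _, ?_⟩
    · exact mem_map_special hns hs (h.left_vertex_special (h2 hu)) (h6 (h2 hu)) (hr'.symm ▸ hmY)
    · rw [sub_zero]
      exact hr'.symm
  | star_dir s hs h6 h7 =>
    obtain ⟨⟨u, hu, hr⟩, hmY⟩ := hm'
    have hr' : D.arr s • u = m' := hr
    have huE : u ∈ D.vertexSpace M (D.head s) := h.left_vertex_special (h2 hu)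
    rcases h7 with h7 | h7
    · refine ⟨D.arr s • m', ⟨?_, m', hmY, rfl⟩, 0, zero_mem _, ?_⟩
      · rw [← hr']
        exact special_sq_mem hs huE hu (hr'.symm ▸ h7 hmY)
      · rw [sub_zero]
        rfl
    -- With m' = su, the choice q = σ_s⁻¹(β)u makes s(m' - q) = s²u - βsu = -γu, which lies in X^-.
    -- So correcting by q completes the square away.
    · have huY : u ∈ Ym := h7 ▸ hu
      have hsu : u ∈ Yp.map (D.arrMap M s) :=
        mem_map_special hns hs huE (h3 huY) (hr'.symm ▸ hmY)
      have hsu' : u ∈ Xp.map (D.arrMap M s) :=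
        mem_map_special hns hs huE (h2 hu) (hr'.symm ▸ h6 hmY)
      refine ⟨-(D.γ s • u), ⟨neg_mem (Submodule.smul_mem _ _ hu),
        neg_mem (Submodule.smul_mem _ _ hsu)⟩, (D.σ s).symm (D.β s) • u,
        ⟨Submodule.smul_mem _ _ hsu', Submodule.smul_mem _ _ huY⟩, ?_⟩
      change _ = D.arr s • (_ - _)
      rw [smul_sub, arr_smul_smul, RingEquiv.apply_symm_apply, ← hr', special_sq_smul hs huE]
      abel

end IsStep

end Step

/-! ### Positions in words -/

theorem after_succ {K V A : Type*} [DivisionRing K] {D : SCData K V A} (w : D.Word) (i : ℤ) :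
    (fun j => after w (i - 1) (j + 1)) = after w i := by
  funext j
  unfold after
  congr 1
  push_cast
  ring

theorem after_zero {K V A : Type*} [DivisionRing K] {D : SCData K V A} (w : D.Word) (i : ℤ) :
    after w (i - 1) 0 = w.letter i := by
  simp [after]

theorem before_succ {K V A : Type*} [DivisionRing K] {D : SCData K V A} (w : D.Word) (i : ℤ) :
    (fun j => before w i (j + 1)) = before w (i - 1) := by
  funext j
  unfold before
  congr 2
  push_cast
  ring

theorem before_zero {K V A : Type*} [DivisionRing K] {D : SCData K V A} (w : D.Word) (i : ℤ) :
    before w i 0 = (w.letter i).map Letter.inverse := by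
  simp [before]

theorem before_zero_of_some {K V A : Type*} [DivisionRing K] {D : SCData K V A} {w : D.Word}
    {i : ℤ} {l : D.Letter} (hl : w.letter i = some l) : before w i 0 = some l.inverse := by
  rw [before_zero, hl, Option.map_some]

namespace SignChoice

section Words

variable {K V A : Type*} [DivisionRing K] {D : SCData K V A} (S : D.SignChoice)

/-- The sign of `w_{>i}`. -/
def sgnAt (w : D.Word) (i : ℤ) : ℤˣ :=
  match w.letter (i + 1) with
  | some l => S.sgn l
  | none => match w.letter i with
    | some l => -S.sgn l.inverse
    | none => w.sign

variable {S}

theorem sgnAt_of_some {w : D.Word} {i : ℤ} {l : D.Letter} (h : w.letter (i + 1) = some l) :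
    S.sgnAt w i = S.sgn l := by
  rw [sgnAt, h]

theorem sgnAt_of_none {w : D.Word} {i : ℤ} {l : D.Letter} (h : w.letter (i + 1) = none)
    (h' : w.letter i = some l) : S.sgnAt w i = -S.sgn l.inverse := by
  rw [sgnAt, h, h']

theorem sgnAt_of_none_none {w : D.Word} {i : ℤ} (h : w.letter (i + 1) = none)
    (h' : w.letter i = none) : S.sgnAt w i = w.sign := by
  rw [sgnAt, h, h']

/-- The index set of a strand is an interval. -/
theorem index_ordConnected (s : SCShape) {i j k : ℤ} (hi : i ∈ s.index) (hk : k ∈ s.index)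
    (h1 : i ≤ j) (h2 : j ≤ k) : j ∈ s.index := by
  cases s with
  | finite n =>
    obtain ⟨h3, -⟩ := hi
    obtain ⟨-, h4⟩ := hk
    exact ⟨h3.trans h1, h2.trans h4⟩
  | full => trivial

theorem zero_mem_index (s : SCShape) : (0 : ℤ) ∈ s.index := by
  cases s with
  | finite n => exact ⟨le_rfl, by positivity⟩
  | full => trivial

namespace IsWord

variable {w : D.Word}

theorem sgnAt_left (_hw : S.IsWord w) {i : ℤ} {l : D.Letter} (h : w.letter i = some l) :
    S.sgnAt w (i - 1) = S.sgn l :=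
  sgnAt_of_some (by rwa [sub_add_cancel])

theorem sgnAt_right (hw : S.IsWord w) {i : ℤ} {l : D.Letter} (h : w.letter i = some l) :
    S.sgnAt w i = -S.sgn l.inverse := by
  cases h' : w.letter (i + 1) with
  | none => exact sgnAt_of_none h' h
  | some l' => rw [sgnAt_of_some h', hw.consecutive i l h l' h']

theorem sgnAt_zero (hw : S.IsWord w) : S.sgnAt w 0 = w.sign := by
  cases h : w.letter (0 + 1) with
  | some l => rw [sgnAt_of_some h, hw.sign_right l h]
  | none =>
    cases h' : w.letter 0 with
    | some l => rw [sgnAt_of_none h h', hw.sign_left l h', neg_neg]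
    | none => exact sgnAt_of_none_none h h'

theorem vertex_left (hw : S.IsWord w) {i : ℤ} {l : D.Letter} (h : w.letter i = some l) :
    w.vertex (i - 1) = some l.head := hw.head_eq i l h

theorem vertex_right (hw : S.IsWord w) {i : ℤ} {l : D.Letter} (h : w.letter i = some l) :
    w.vertex i = some l.tail := hw.tail_eq i l h

theorem mem_index (hw : S.IsWord w) {i : ℤ} {l : D.Letter} (h : w.letter i = some l) :
    i ∈ w.shape.index ∧ i - 1 ∈ w.shape.index :=
  (hw.letter_isSome i).mp (by rw [h]; rfl)

theorem exists_letter (hw : S.IsWord w) {i : ℤ} (h : i ∈ w.shape.index)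
    (h' : i - 1 ∈ w.shape.index) : ∃ l, w.letter i = some l :=
  Option.isSome_iff_exists.mp ((hw.letter_isSome i).mpr ⟨h, h'⟩)

theorem letter_eq_none_iff (hw : S.IsWord w) {i : ℤ} :
    w.letter i = none ↔ ¬ (i ∈ w.shape.index ∧ i - 1 ∈ w.shape.index) := by
  rw [← hw.letter_isSome, Option.not_isSome_iff_eq_none]

theorem exists_vertex (hw : S.IsWord w) {i : ℤ} (h : i ∈ w.shape.index) :
    ∃ v, w.vertex i = some v :=
  Option.isSome_iff_exists.mp ((hw.vertex_isSome i).mpr h)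

theorem vertex_eq_none (hw : S.IsWord w) {i : ℤ} (h : i ∉ w.shape.index) : w.vertex i = none := by
  rw [← Option.not_isSome_iff_eq_none, hw.vertex_isSome]
  exact h

theorem vertex_eq_tail (hw : S.IsWord w) {i j : ℤ} (hi : i ∈ w.shape.index) (hij : i < j) :
    w.vertex j = (w.letter j).map Letter.tail := by
  cases h : w.letter j with
  | some l => exact hw.vertex_right h
  | none =>
    refine hw.vertex_eq_none fun hj => (hw.letter_eq_none_iff.mp h) ⟨hj, ?_⟩
    exact index_ordConnected _ hi hj (by omega) (by omega)

theorem vertex_eq_head (hw : S.IsWord w) {i j : ℤ} (hi : i ∈ w.shape.index) (hij : j < i) :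
    w.vertex j = (w.letter (j + 1)).map Letter.head := by
  cases h : w.letter (j + 1) with
  | some l => simpa using hw.vertex_left h
  | none =>
    refine hw.vertex_eq_none fun hj => (hw.letter_eq_none_iff.mp h) ⟨?_, by simpa using hj⟩
    exact index_ordConnected _ hj hi (by omega) (by omega)

end IsWord

variable (S) in
/-- End-admissible words. -/
structure IsEndWord (w : D.Word) : Prop extends S.IsWord w where
  noStar_right : ∀ i ∈ w.shape.index, i + 1 ∉ w.shape.index → S.NoStar (w.vertex i) (S.sgnAt w i)
  noStar_left : ∀ i ∈ w.shape.index, i - 1 ∉ w.shape.index → S.NoStar (w.vertex i) (-S.sgnAt w i)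

theorem IsEndWord.isRay_after {w : D.Word} (hw : S.IsEndWord w) {i : ℤ}
    (hi : i ∈ w.shape.index) : S.IsRay (w.vertex i) (S.sgnAt w i) (after w i) := by
  refine ⟨fun o ε x => ∃ i ∈ w.shape.index, o = w.vertex i ∧ ε = S.sgnAt w i ∧ x = after w i, ?_,
    i, hi, rfl, rfl, rfl⟩
  rintro _ _ _ ⟨i, hi, rfl, rfl, rfl⟩
  have h0 : after w i 0 = w.letter (i + 1) := by simp [after]
  by_cases h : i + 1 ∈ w.shape.index
  · obtain ⟨l, hl⟩ := hw.exists_letter h (by simpa using hi)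
    have h1 := hw.vertex_left hl
    rw [add_sub_cancel_right] at h1
    refine .inr ⟨l, h0.trans hl, h1, sgnAt_of_some hl, i + 1, h, (hw.vertex_right hl).symm,
      (hw.sgnAt_right hl).symm, ?_⟩
    rw [← after_succ w (i + 1), add_sub_cancel_right]
  · refine .inl ⟨fun j => hw.letter_eq_none_iff.mpr ?_, hw.noStar_right i hi h⟩
    rintro ⟨h1, -⟩
    exact h (index_ordConnected _ hi h1 (by omega) (by omega))

theorem IsEndWord.isRay_before (hD : D.IsClannish) {w : D.Word} (hw : S.IsEndWord w) {i : ℤ}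
    (hi : i ∈ w.shape.index) : S.IsRay (w.vertex i) (-S.sgnAt w i) (before w i) := by
  refine ⟨fun o ε x => ∃ i ∈ w.shape.index, o = w.vertex i ∧ ε = -S.sgnAt w i ∧ x = before w i, ?_,
    i, hi, rfl, rfl, rfl⟩
  rintro _ _ _ ⟨i, hi, rfl, rfl, rfl⟩
  by_cases h : i - 1 ∈ w.shape.index
  · obtain ⟨l, hl⟩ := hw.exists_letter hi h
    refine .inr ⟨l.inverse, by rw [before_zero, hl]; rfl, ?_, ?_, i - 1, h, ?_, ?_, before_succ w i⟩
    · rw [Letter.head_inverse l hD, hw.vertex_right hl]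
    · rw [hw.sgnAt_right hl, neg_neg]
    · rw [Letter.tail_inverse l hD, hw.vertex_left hl]
    · rw [Letter.inverse_inverse, hw.sgnAt_left hl]
  · refine .inl ⟨fun j => ?_, hw.noStar_left i hi h⟩
    rw [before, hw.letter_eq_none_iff.mpr, Option.map_none]
    rintro ⟨-, h1⟩
    exact h (index_ordConnected _ h1 hi (by omega) (by omega))

/-- The inverse of `w` at `i` is obtained from `w` at `center w - i`. -/
def center (w : D.Word) : ℤ :=
  match w.shape with
  | .finite n => n
  | .full => -1

theorem inv_shape (w : D.Word) : (S.inv w).shape = w.shape := by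
  rcases w with ⟨_ | _, _, _, _⟩ <;> rfl

theorem inv_letter (w : D.Word) (i : ℤ) :
    (S.inv w).letter i = (w.letter (center w + 1 - i)).map Letter.inverse := by
  rcases w with ⟨_ | _, l, _, _⟩
  · rfl
  · change (l (-i)).map _ = (l (-1 + 1 - i)).map _
    congr 2
    ring

theorem inv_vertex (w : D.Word) (i : ℤ) :
    (S.inv w).vertex i = w.vertex (center w - i) := by
  rcases w with ⟨_ | _, _, v, _⟩
  · rfl
  · change v (-i - 1) = v (-1 - i)
    congr 1
    ring

theorem center_sub_mem_index {w : D.Word} {i : ℤ} :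
    center w - i ∈ w.shape.index ↔ i ∈ w.shape.index := by
  rcases w with ⟨n | _, _, _, _⟩
  · change (0 ≤ (n : ℤ) - i ∧ (n : ℤ) - i ≤ n) ↔ (0 ≤ i ∧ i ≤ n)
    omega
  · exact Iff.rfl

theorem after_inv (w : D.Word) (i : ℤ) : after (S.inv w) i = before w (center w - i) := by
  funext j
  rw [after, inv_letter, before]
  congr 2
  ring

theorem before_inv (w : D.Word) (i : ℤ) : before (S.inv w) i = after w (center w - i) := by
  funext j
  rw [after, before, inv_letter, Option.map_map]
  have : Letter.inverse ∘ Letter.inverse = (id : D.Letter → D.Letter) :=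
    funext Letter.inverse_inverse
  rw [this, Option.map_id_fun, id]
  congr 1
  ring

theorem IsWord.inv_sign {w : D.Word} (hw : S.IsWord w) :
    (S.inv w).sign = -S.sgnAt w (center w) := by
  rcases hs : w.shape with n | _
  · have h1 : center w = n := by rw [center, hs]
    have h2 : w.letter (n + 1) = none := by
      rw [hw.letter_eq_none_iff, hs]
      rintro ⟨⟨_, h⟩, -⟩
      omega
    have h3 : (S.inv w).sign = match w.letter n with
        | some x => S.sgn x.inverse
        | none => -w.sign := by
      rcases w with ⟨_, _, _, _⟩
      cases hs
      rfl
    rw [h1, h3]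
    cases h : w.letter n with
    | some l => rw [sgnAt_of_none h2 h, neg_neg]
    | none => rw [sgnAt_of_none_none h2 h]
  · have h1 : center w = -1 := by rw [center, hs]
    have h3 : (S.inv w).sign = match w.letter (-1) with
        | some x => S.sgn x.inverse
        | none => -w.sign := by
      rcases w with ⟨_, _, _, _⟩
      cases hs
      rfl
    obtain ⟨l, hl⟩ := hw.exists_letter (i := -1) (by rw [hs]; trivial) (by rw [hs]; trivial)
    rw [h1, h3, hl, hw.sgnAt_right hl, neg_neg]

theorem IsWord.sgnAt_inv {w : D.Word} (hw : S.IsWord w) {i : ℤ} (hi : i ∈ w.shape.index) :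
    S.sgnAt (S.inv w) i = -S.sgnAt w (center w - i) := by
  cases h : w.letter (center w - i) with
  | some l =>
    rw [sgnAt_of_some (l := l.inverse), hw.sgnAt_right h, neg_neg]
    rw [inv_letter, show center w + 1 - (i + 1) = center w - i by ring, h, Option.map_some]
  | none =>
    have h1 : (S.inv w).letter (i + 1) = none := by
      rw [inv_letter, show center w + 1 - (i + 1) = center w - i by ring, h, Option.map_none]
    cases h' : w.letter (center w - i + 1) with
    | some l =>
      have h3 := hw.sgnAt_left h'
      rw [add_sub_cancel_right] at h3
      rw [sgnAt_of_none (l := l.inverse) h1, Letter.inverse_inverse, h3]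
      rw [inv_letter, show center w + 1 - i = center w - i + 1 by ring, h', Option.map_some]
    | none =>
      have h2 : (S.inv w).letter i = none := by
        rw [inv_letter, show center w + 1 - i = center w - i + 1 by ring, h', Option.map_none]
      rw [sgnAt_of_none_none h1 h2, hw.inv_sign, sgnAt_of_none_none h' h]
      congr 1
      -- Letters are missing on both sides only in a word of length 0, whose single position is 0.
      -- This is the case in which the stored sign of the word is needed.
      have h3 : center w - i = center w := by
        have h4 := hw.letter_eq_none_iff.mp h
        have h5 := hw.letter_eq_none_iff.mp h'
        have h6 := center_sub_mem_index.mpr hi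
        rcases hs : w.shape with n | _
        · have h7 : center w = n := by rw [center, hs]
          rw [hs] at h4 h5 h6
          rw [h7] at h4 h5 h6 ⊢
          obtain ⟨h8, h9⟩ := h6
          change ¬ ((0 ≤ _ ∧ _ ≤ _) ∧ (0 ≤ _ ∧ _ ≤ _)) at h4 h5
          omega
        · rw [hs] at h4
          exact absurd ⟨trivial, trivial⟩ h4
      rw [← h3, sgnAt_of_none_none h' h]

theorem IsWord.inv (hD : D.IsClannish) {w : D.Word} (hw : S.IsWord w) : S.IsWord (S.inv w) := by
  have key : ∀ i x, (S.inv w).letter i = some x →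
      w.letter (center w + 1 - i) = some x.inverse := by
    intro i x hx
    rw [inv_letter] at hx
    obtain ⟨l, hl, rfl⟩ := Option.map_eq_some_iff.mp hx
    rw [hl, Letter.inverse_inverse]
  refine ⟨fun i => ?_, fun i => ?_, fun i x hx => ?_, fun i x hx => ?_, fun i x hx y hy => ?_,
    fun x hx => ?_, fun x hx => ?_⟩
  · rw [inv_letter, inv_shape, Option.isSome_map, hw.letter_isSome, ← center_sub_mem_index (i := i),
      ← center_sub_mem_index (i := i - 1), and_comm, show center w + 1 - i = center w - (i - 1) by
      ring, show center w - (i - 1) - 1 = center w - i by ring]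
  · rw [inv_vertex, inv_shape, hw.vertex_isSome, center_sub_mem_index]
  · rw [inv_vertex, show center w - (i - 1) = center w + 1 - i by ring,
      hw.vertex_right (key i x hx), Letter.tail_inverse x hD]
  · rw [inv_vertex, show center w - i = center w + 1 - i - 1 by ring,
      hw.vertex_left (key i x hx), Letter.head_inverse x hD]
  · have h1 := key i x hx
    have h2 := key (i + 1) y hy
    rw [show center w + 1 - i = center w + 1 - (i + 1) + 1 by ring] at h1
    have := hw.consecutive _ _ h2 _ h1
    rw [this, neg_neg, Letter.inverse_inverse]
  · have h1 := key 1 x hx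
    rw [add_sub_cancel_right] at h1
    rw [hw.inv_sign, hw.sgnAt_right h1, neg_neg, Letter.inverse_inverse]
  · have h1 := key 0 x hx
    rw [sub_zero] at h1
    have h2 := hw.sgnAt_left h1
    rw [add_sub_cancel_right] at h2
    rw [hw.inv_sign, h2, neg_neg]

theorem isRightEndAdmissible_iff {w : D.Word} (hw : S.IsWord w) :
    S.IsRightEndAdmissible w ↔
      ∀ i ∈ w.shape.index, i + 1 ∉ w.shape.index → S.NoStar (w.vertex i) (S.sgnAt w i) := by
  have hsign := hw.inv_sign
  rcases hs : w.shape with n | _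
  · have h1 : center w = n := by rw [center, hs]
    have h2 : S.IsRightEndAdmissible w ↔ S.NoStar (w.vertex n) (S.sgnAt w n) := by
      rw [h1] at hsign
      rw [← neg_neg (S.sgnAt w n), ← hsign]
      rcases w with ⟨_, _, _, _⟩
      cases hs
      rfl
    rw [h2]
    constructor
    · rintro h i ⟨h3, h4⟩ h5
      obtain rfl : i = n := by
        by_contra hne
        exact h5 ⟨by omega, by omega⟩
      exact h
    · intro h
      refine h n ⟨by positivity, le_rfl⟩ ?_
      rintro ⟨-, h3⟩
      omega
  · have h2 : S.IsRightEndAdmissible w := by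
      rcases w with ⟨_, _, _, _⟩
      cases hs
      trivial
    exact ⟨fun _ i _ h => absurd trivial h, fun _ => h2⟩

theorem isEndAdmissible_iff (hD : D.IsClannish) {w : D.Word} (hw : S.IsWord w) :
    S.IsEndAdmissible w ↔ S.IsEndWord w := by
  rw [IsEndAdmissible, isRightEndAdmissible_iff hw, isRightEndAdmissible_iff (hw.inv hD)]
  have h : (∀ i ∈ (S.inv w).shape.index, i + 1 ∉ (S.inv w).shape.index →
        S.NoStar ((S.inv w).vertex i) (S.sgnAt (S.inv w) i)) ↔
      ∀ i ∈ w.shape.index, i - 1 ∉ w.shape.index → S.NoStar (w.vertex i) (-S.sgnAt w i) := by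
    rw [inv_shape]
    constructor
    · intro h i hi hi'
      have := h (center w - i) (center_sub_mem_index.mpr hi) (by
        rw [← center_sub_mem_index, show center w - (center w - i + 1) = i - 1 by ring]
        exact hi')
      rwa [inv_vertex, hw.sgnAt_inv (center_sub_mem_index.mpr hi),
        show center w - (center w - i) = i by ring] at this
    · intro h i hi hi'
      rw [inv_vertex, hw.sgnAt_inv hi]
      refine h _ (center_sub_mem_index.mpr hi) ?_
      rw [← center_sub_mem_index, show center w - (center w - i - 1) = i + 1 by ring]
      exact hi'
  rw [h]
  exact ⟨fun h => ⟨hw, h.1, h.2⟩, fun h => ⟨h.2, h.3⟩⟩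

theorem isEndWord_of_full {w : D.Word} (hw : S.IsWord w) (h : w.shape = .full) :
    S.IsEndWord w :=
  ⟨hw, fun i _ hi => absurd (by rw [h]; trivial) hi, fun i _ hi => absurd (by rw [h]; trivial) hi⟩

theorem isEndWord_of_string_or_band (hD : D.IsClannish) {w : D.Word}
    (h : S.IsString w ∨ S.IsBand w) : S.IsEndWord w := by
  rcases h with h | h
  · exact (isEndAdmissible_iff hD h.1).mp h.2.2.1
  · exact isEndWord_of_full h.1 h.2.1

/-! #### Words agreeing at positions -/

variable (S) in
/-- The words `w` at the position `i` and `w'` at the position `j` agree. -/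
structure Agree (w : D.Word) (i : ℤ) (w' : D.Word) (j : ℤ) : Prop where
  vertex : w.vertex i = w'.vertex j
  sgn : S.sgnAt w i = S.sgnAt w' j
  before : before w i = before w' j
  after : after w i = after w' j

namespace Agree

variable {w w' : D.Word} {i j : ℤ}

theorem symm (h : S.Agree w i w' j) : S.Agree w' j w i :=
  ⟨h.1.symm, h.2.symm, h.3.symm, h.4.symm⟩

theorem inv (h : S.Agree w i w' j) (hw : S.IsWord w) (hw' : S.IsWord w')
    (hi : i ∈ w.shape.index) (hj : j ∈ w'.shape.index) :
    S.Agree (S.inv w) (center w - i) (S.inv w') (center w' - j) := by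
  refine ⟨?_, ?_, ?_, ?_⟩
  · rw [inv_vertex, inv_vertex, sub_sub_cancel, sub_sub_cancel, h.vertex]
  · rw [hw.sgnAt_inv (center_sub_mem_index.mpr hi), hw'.sgnAt_inv (center_sub_mem_index.mpr hj),
      sub_sub_cancel, sub_sub_cancel, h.sgn]
  · rw [before_inv, before_inv, sub_sub_cancel, sub_sub_cancel, h.after]
  · rw [after_inv, after_inv, sub_sub_cancel, sub_sub_cancel, h.before]

theorem letter (h : S.Agree w i w' j) (t : ℤ) : w.letter (i + t) = w'.letter (j + t) := by
  rcases le_or_gt t 0 with ht | ht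
  · obtain ⟨k, rfl⟩ : ∃ k : ℕ, t = -k := ⟨(-t).toNat, by omega⟩
    have h1 := congrFun h.before k
    have hinj : Function.Injective (Letter.inverse : D.Letter → D.Letter) :=
      Function.LeftInverse.injective (g := Letter.inverse) Letter.inverse_inverse
    exact Option.map_injective hinj h1
  · obtain ⟨k, rfl⟩ : ∃ k : ℕ, t = 1 + k := ⟨(t - 1).toNat, by omega⟩
    have h1 := congrFun h.after k
    simpa only [SCData.after, add_assoc] using h1

/-- Agreement at one position determines all letters, and away from that position the letters
determine the vertices and signs. Hence it propagates along the word. -/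
theorem add (h : S.Agree w i w' j) (hw : S.IsWord w) (hw' : S.IsWord w')
    (hi : i ∈ w.shape.index) (hj : j ∈ w'.shape.index) (t : ℤ) (ht : i + t ∈ w.shape.index) :
    S.Agree w (i + t) w' (j + t) := by
  have hv : w.vertex (i + t) = w'.vertex (j + t) := by
    rcases lt_trichotomy t 0 with h0 | h0 | h0
    · rw [hw.vertex_eq_head hi (by omega), hw'.vertex_eq_head hj (by omega), add_assoc, add_assoc,
        h.letter]
    · rw [h0, add_zero, add_zero, h.vertex]
    · rw [hw.vertex_eq_tail hi (by omega), hw'.vertex_eq_tail hj (by omega), h.letter]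
  refine ⟨hv, ?_, ?_, ?_⟩
  · cases h1 : w.letter (i + t + 1) with
    | some l =>
      have h2 := h1
      rw [add_assoc, h.letter, ← add_assoc] at h2
      rw [sgnAt_of_some h1, sgnAt_of_some h2]
    | none =>
      have h2 := h1
      rw [add_assoc, h.letter, ← add_assoc] at h2
      cases h3 : w.letter (i + t) with
      | some l =>
        have h4 := h3
        rw [h.letter] at h4
        rw [sgnAt_of_none h1 h3, sgnAt_of_none h2 h4]
      | none =>
        have h0 : t = 0 := by
          rcases lt_trichotomy t 0 with h0 | h0 | h0
          · refine absurd ⟨?_, by simpa using ht⟩ (hw.letter_eq_none_iff.mp h1)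
            exact index_ordConnected _ ht hi (by omega) (by omega)
          · exact h0
          · refine absurd ⟨ht, ?_⟩ (hw.letter_eq_none_iff.mp h3)
            exact index_ordConnected _ hi ht (by omega) (by omega)
        rw [h0, add_zero, add_zero, h.sgn]
  · funext k
    unfold SCData.before
    rw [add_sub_assoc, add_sub_assoc, h.letter]
  · funext k
    unfold SCData.after
    rw [add_assoc, add_assoc, add_assoc, add_assoc, h.letter]

end Agree

theorem agree_swap {w : D.Word} (hw : S.IsWord w) {i : ℤ} (hi : i ∈ w.shape.index) :
    (S.inv w).vertex (center w - i) = w.vertex i ∧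
    S.sgnAt (S.inv w) (center w - i) = -S.sgnAt w i ∧
    before (S.inv w) (center w - i) = after w i ∧
    after (S.inv w) (center w - i) = before w i := by
  refine ⟨?_, ?_, ?_, ?_⟩
  · rw [inv_vertex, sub_sub_cancel]
  · rw [hw.sgnAt_inv (center_sub_mem_index.mpr hi), sub_sub_cancel]
  · rw [before_inv, sub_sub_cancel]
  · rw [after_inv, sub_sub_cancel]

theorem IsWord.agree_shift {w : D.Word} (hw : S.IsWord w) (hs : w.shape = .full) (m i : ℤ) :
    S.Agree (S.shift w m) i w (m + i) := by
  have h1 : S.shift w m =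
    { shape := .full
      letter := fun i => w.letter (m + i)
      vertex := fun i => w.vertex (m + i)
      sign := match w.letter (m + 1) with
        | some x => S.sgn x
        | none => w.sign } := by
    rcases w with ⟨_, _, _, _⟩
    cases hs
    rfl
  rw [h1]
  refine ⟨rfl, ?_, ?_, ?_⟩
  · obtain ⟨l, hl⟩ := hw.exists_letter (i := m + (i + 1)) (by rw [hs]; trivial) (by rw [hs]; trivial)
    rw [sgnAt_of_some (l := l) hl, sgnAt_of_some (l := l) (by rwa [add_assoc])]
  · funext k
    simp only [before]
    congr 2
    ring
  · funext k
    simp only [after]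
    congr 1
    ring

theorem shift_of_finite {w : D.Word} {n : ℕ} (hs : w.shape = .finite n) (m : ℤ) :
    S.shift w m = w := by
  rcases w with ⟨_, _, _, _⟩
  cases hs
  rfl

theorem shift_shape (w : D.Word) (m : ℤ) : (S.shift w m).shape = w.shape := by
  rcases w with ⟨_ | _, _, _, _⟩ <;> rfl

/-- Words agreeing at positions are equal up to a shift, and equal if they are finite. -/
theorem Agree.eq_shift {w w' : D.Word} {i j : ℤ} (h : S.Agree w i w' j) (hw : S.IsWord w)
    (hw' : S.IsWord w') (hi : i ∈ w.shape.index) (hj : j ∈ w'.shape.index) :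
    w = S.shift w' (j - i) ∧ (w.shape = .full ∨ i = j) := by
  have hletter : ∀ t, w.letter t = w'.letter (j - i + t) := by
    intro t
    have := h.letter (t - i)
    rwa [add_sub_cancel, show j + (t - i) = j - i + t by ring] at this
  have hvertex : ∀ t, w.vertex t = w'.vertex (j - i + t) := by
    intro t
    rcases lt_trichotomy t i with h0 | h0 | h0
    · rw [hw.vertex_eq_head hi h0, hw'.vertex_eq_head hj (by omega), hletter, add_assoc]
    · rw [h0, sub_add_cancel, h.vertex]
    · rw [hw.vertex_eq_tail hi h0, hw'.vertex_eq_tail hj (by omega), hletter]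
  rcases hs : w.shape with n | _ <;> rcases hs' : w'.shape with n' | _
  · rw [hs] at hi
    rw [hs'] at hj
    have h1 : ∀ t, (1 ≤ t ∧ t ≤ (n : ℤ)) ↔ (1 ≤ j - i + t ∧ j - i + t ≤ (n' : ℤ)) := by
      intro t
      have h2 := (hw.letter_isSome t)
      rw [hletter, hw'.letter_isSome, hs, hs'] at h2
      change ((0 ≤ _ ∧ _ ≤ _) ∧ (0 ≤ _ ∧ _ ≤ _)) ↔ ((0 ≤ _ ∧ _ ≤ _) ∧ (0 ≤ _ ∧ _ ≤ _)) at h2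
      constructor <;> intro h3
      · have := h2.mpr ⟨⟨by omega, by omega⟩, by omega, by omega⟩
        omega
      · have := h2.mp ⟨⟨by omega, by omega⟩, by omega, by omega⟩
        omega
    obtain ⟨hi1, hi2⟩ := hi
    obtain ⟨hj1, hj2⟩ := hj
    -- Letters occur exactly at 1, …, n, so matching the two ranges forces equal lengths and no
    -- shift. In length 0, where there are no letters, both positions must be 0.
    have h2 : i = j ∧ n = n' := by
      have a1 := h1 1
      have a2 := h1 n
      have a3 := h1 (1 - (j - i))
      have a4 := h1 (n' - (j - i))
      omega
    obtain ⟨rfl, rfl⟩ := h2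
    refine ⟨?_, .inr rfl⟩
    rw [shift_of_finite hs']
    refine SCStrand.ext (hs.trans hs'.symm) ?_ ?_ ?_
    · funext t
      rw [hletter]
      congr 1
      ring
    · funext t
      rw [hvertex]
      congr 1
      ring
    · have h3 := h.add hw hw' (by rw [hs]; exact ⟨hi1, hi2⟩) (by rw [hs']; exact ⟨hi1, hi2⟩) (-i)
        (by rw [add_neg_cancel]; exact zero_mem_index _)
      have := h3.sgn
      rwa [add_neg_cancel, hw.sgnAt_zero, hw'.sgnAt_zero] at this
  · exfalso
    have h1 : w.letter (n + 1) = none := by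
      rw [hw.letter_eq_none_iff, hs]
      rintro ⟨⟨_, h⟩, -⟩
      omega
    rw [hletter, hw'.letter_eq_none_iff, hs'] at h1
    exact h1 ⟨trivial, trivial⟩
  · exfalso
    have h1 : w'.letter (n' + 1) = none := by
      rw [hw'.letter_eq_none_iff, hs']
      rintro ⟨⟨_, h⟩, -⟩
      omega
    rw [show (n' + 1 : ℤ) = j - i + (n' + 1 - (j - i)) by ring, ← hletter,
      hw.letter_eq_none_iff, hs] at h1
    exact h1 ⟨trivial, trivial⟩
  · refine ⟨?_, .inl rfl⟩
    have h1 : S.shift w' (j - i) =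
      { shape := .full
        letter := fun i' => w'.letter (j - i + i')
        vertex := fun i' => w'.vertex (j - i + i')
        sign := match w'.letter (j - i + 1) with
          | some x => S.sgn x
          | none => w'.sign } := by
      rcases w' with ⟨_, _, _, _⟩
      cases hs'
      rfl
    rw [h1]
    refine SCStrand.ext hs (funext hletter) (funext hvertex) ?_
    obtain ⟨l, hl⟩ := hw.exists_letter (i := 1) (by rw [hs]; trivial) (by rw [hs]; trivial)
    rw [← hw.sign_right l hl, ← hletter, hl]

end Words

end SignChoice

/-! ### Elements of `T_C(M)` as families of elements of `M` -/

section Families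

variable {K V A : Type*} [DivisionRing K] [Fintype V] {D : SCData K V A}
  {M : Type*} [AddCommGroup M] [Module K M] [Module D.Alg M] [IsScalarTower K D.Alg M]

theorem single_eq_smul {C : D.Walk} (i : C.shape.index) (r : D.Alg) :
    (D.modRels C).mkQ (Finsupp.single i r) = r • D.b C i := by
  have h : Finsupp.single i r = r • (Finsupp.single i 1 : C.shape.index →₀ D.Alg) := by
    rw [Finsupp.smul_single, smul_eq_mul, mul_one]
  rw [h]
  exact map_smul (D.modRels C).mkQ _ _

theorem e_smul_b {C : D.Walk} {i : C.shape.index} {l : V} (h : C.vertex i = some l) :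
    D.e l • D.b C i = D.b C i := by
  have h1 : (D.modRels C).mkQ (Finsupp.single i (D.e l) - Finsupp.single i 1) = 0 :=
    (Submodule.Quotient.mk_eq_zero _).mpr (Submodule.subset_span (ModRel.vertex i l h))
  rw [map_sub, single_eq_smul, single_eq_smul, one_smul] at h1
  exact sub_eq_zero.mp h1

theorem arr_smul_b {C : D.Walk} {i j : C.shape.index} {a : A} (h : C.HasArrow i j a) :
    D.arr a • D.b C i = D.b C j := by
  have h1 : (D.modRels C).mkQ (Finsupp.single i (D.arr a) - Finsupp.single j 1) = 0 :=
    (Submodule.Quotient.mk_eq_zero _).mpr (Submodule.subset_span (ModRel.arrow i j a h))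
  rw [map_sub, single_eq_smul, single_eq_smul, one_smul] at h1
  exact sub_eq_zero.mp h1

theorem arr_smul_b_eq_zero {C : D.Walk} {i : C.shape.index} {a : A} (ha : a ∉ D.special)
    (ht : C.vertex i = some (D.tail a)) (h : ∀ j, ¬ C.HasArrow i j a) :
    D.arr a • D.b C i = 0 := by
  have h1 : (D.modRels C).mkQ (Finsupp.single i (D.arr a)) = 0 :=
    (Submodule.Quotient.mk_eq_zero _).mpr (Submodule.subset_span (ModRel.zero i a ha ht h))
  rwa [single_eq_smul] at h1

namespace Top

variable {C : D.Walk} {T : D.Twist C}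

open Classical in
/-- The elements of `M` given by an element of `T_C(M)`, extended by zero. -/
noncomputable def val (θ : Top T M) (i : ℤ) : M :=
  if h : i ∈ C.shape.index then θ.hom (D.b C ⟨i, h⟩) else 0

theorem val_of_mem (θ : Top T M) {i : ℤ} (h : i ∈ C.shape.index) :
    θ.val i = θ.hom (D.b C ⟨i, h⟩) := dif_pos h

theorem val_of_notMem (θ : Top T M) {i : ℤ} (h : i ∉ C.shape.index) : θ.val i = 0 := dif_neg h

theorem val_add (θ θ' : Top T M) (i : ℤ) : (θ + θ').val i = θ.val i + θ'.val i := by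
  by_cases h : i ∈ C.shape.index
  · rw [val_of_mem _ h, val_of_mem _ h, val_of_mem _ h]
    rfl
  · rw [val_of_notMem _ h, val_of_notMem _ h, val_of_notMem _ h, add_zero]

theorem val_sub (θ θ' : Top T M) (i : ℤ) : (θ - θ').val i = θ.val i - θ'.val i := by
  rw [eq_sub_iff_add_eq, ← val_add, sub_add_cancel]

theorem val_smul (c : K) (θ : Top T M) (i : ℤ) : (c • θ).val i = T.π i c • θ.val i := by
  by_cases h : i ∈ C.shape.index
  · rw [val_of_mem _ h, val_of_mem _ h, smul_hom_b]
  · rw [val_of_notMem _ h, val_of_notMem _ h, smul_zero]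

theorem val_mem_vertexSpace (θ : Top T M) {i : ℤ} {v : V} (hi : i ∈ C.shape.index)
    (h : C.vertex i = some v) : θ.val i ∈ D.vertexSpace M v := by
  rw [val_of_mem _ hi, mem_vertexSpace, ← map_smul, e_smul_b h]

theorem arr_smul_val (θ : Top T M) {i j : ℤ} {a : A} (hi : i ∈ C.shape.index)
    (hj : j ∈ C.shape.index) (h : C.HasArrow i j a) : D.arr a • θ.val i = θ.val j := by
  rw [val_of_mem _ hi, val_of_mem _ hj, ← map_smul,
    arr_smul_b (i := ⟨i, hi⟩) (j := ⟨j, hj⟩) h]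

theorem arr_smul_val_eq_zero (θ : Top T M) {i : ℤ} {a : A} (hi : i ∈ C.shape.index)
    (ha : a ∉ D.special) (ht : C.vertex i = some (D.tail a)) (h : ∀ j, ¬ C.HasArrow i j a) :
    D.arr a • θ.val i = 0 := by
  rw [val_of_mem _ hi, ← map_smul, arr_smul_b_eq_zero (i := ⟨i, hi⟩) ha ht h, map_zero]

variable (T) in
-- The universal property of M(C), given by generators and relations.
theorem exists_val_eq (m : ℤ → M)
    (hv : ∀ i ∈ C.shape.index, ∀ v, C.vertex i = some v → m i ∈ D.vertexSpace M v)
    (ha : ∀ i ∈ C.shape.index, ∀ j ∈ C.shape.index, ∀ a, C.HasArrow i j a →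
      D.arr a • m i = m j)
    (hz : ∀ i ∈ C.shape.index, ∀ a, a ∉ D.special → C.vertex i = some (D.tail a) →
      (∀ j, ¬ C.HasArrow i j a) → D.arr a • m i = 0) :
    ∃ θ : Top T M, ∀ i ∈ C.shape.index, θ.val i = m i := by
  let f : (C.shape.index →₀ D.Alg) →ₗ[D.Alg] M :=
    Finsupp.linearCombination D.Alg fun i : C.shape.index => m i
  have hf : ∀ i r, f (Finsupp.single i r) = r • m i := fun i r =>
    Finsupp.linearCombination_single _ _ _
  have hle : D.modRels C ≤ LinearMap.ker f := by
    refine Submodule.span_le.mpr ?_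
    rintro x (⟨i, l, h⟩ | ⟨i, j, a, h⟩ | ⟨i, a, ha', ht, h⟩)
    · rw [SetLike.mem_coe, LinearMap.mem_ker, map_sub, hf, hf, one_smul, sub_eq_zero]
      exact hv i i.2 l h
    · rw [SetLike.mem_coe, LinearMap.mem_ker, map_sub, hf, hf, one_smul, sub_eq_zero]
      exact ha i i.2 j j.2 a h
    · rw [SetLike.mem_coe, LinearMap.mem_ker, hf]
      exact hz i i.2 a ha' ht h
  let θ : Top T M := ((D.modRels C).liftQ f hle : D.ModC C →ₗ[D.Alg] M)
  refine ⟨θ, fun i hi => (val_of_mem θ hi).trans ?_⟩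
  change f (Finsupp.single ⟨i, hi⟩ 1) = _
  rw [hf, one_smul]

theorem mem_vanishBelow {θ : Top T M} :
    θ ∈ Top.vanishBelow T M ↔ ∃ N : ℤ, ∀ i < N, θ.val i = 0 := by
  constructor
  · rintro ⟨N, hN⟩
    refine ⟨N, fun i hi => ?_⟩
    by_cases h : i ∈ C.shape.index
    · rw [val_of_mem _ h]
      exact hN ⟨i, h⟩ hi
    · exact val_of_notMem _ h
  · rintro ⟨N, hN⟩
    exact ⟨N, fun i hi => by rw [← hN i hi, val_of_mem _ i.2]⟩

theorem mem_vanishAbove {θ : Top T M} :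
    θ ∈ Top.vanishAbove T M ↔ ∃ N : ℤ, ∀ i, N < i → θ.val i = 0 := by
  constructor
  · rintro ⟨N, hN⟩
    refine ⟨N, fun i hi => ?_⟩
    by_cases h : i ∈ C.shape.index
    · rw [val_of_mem _ h]
      exact hN ⟨i, h⟩ hi
    · exact val_of_notMem _ h
  · rintro ⟨N, hN⟩
    exact ⟨N, fun i hi => by rw [← hN i hi, val_of_mem _ i.2]⟩

theorem mem_boundary {S : D.SignChoice} {θ : Top T M} {i : ℤ} {ε : ℤˣ} (hi : i ∈ C.shape.index)
    {v : V} (hv : C.vertex i = some v) :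
    θ ∈ Top.boundary T M S i ε ↔ θ.val i ∈ S.oneMinus M v ε := by
  rw [val_of_mem _ hi]
  constructor
  · intro h
    exact h ⟨i, hi⟩ v rfl hv
  · rintro h ⟨j, hj⟩ l rfl hl
    obtain rfl : l = v := Option.some.inj (hl.symm.trans hv)
    exact h

end Top

end Families

namespace SignChoice

/-! ### The canonical walk and the orientation of special loops -/

section Canonical

variable {K V A : Type*} [DivisionRing K] {D : SCData K V A} {S : D.SignChoice}

theorem canonicalWalk_star (w : D.Word) : (D.canonicalWalk w).star = w := by
  have h : (D.canonicalWalk w).star.letter = w.letter := by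
    funext i
    change Option.map _ (Option.map _ _) = _
    rw [Option.map_map]
    cases w.letter i with
    | none => rfl
    | some l =>
      refine congrArg some ?_
      cases l with
      | dir a ha => exact ofArrow_of_notMem ha
      | inv a ha => exact congrArg Letter.inverse (ofArrow_of_notMem ha)
      | star s hs =>
        simp only [Function.comp]
        split_ifs
        · exact ofArrow_of_mem hs
        · exact congrArg Letter.inverse (ofArrow_of_mem hs)
  exact SCStrand.ext rfl h rfl rfl

theorem canonicalWalk_letter_none {w : D.Word} {i : ℤ} (h : w.letter i = none) :
    (D.canonicalWalk w).letter i = none := by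
  simp only [canonicalWalk, h, Option.map_none]

theorem letter_of_canonicalWalk {w : D.Word} {i : ℤ} {c : SCWalkLetter A}
    (h : (D.canonicalWalk w).letter i = some c) : ∃ l, w.letter i = some l := by
  cases h' : w.letter i with
  | none =>
    rw [canonicalWalk_letter_none h'] at h
    cases h
  | some l => exact ⟨l, rfl⟩

theorem exists_canonicalWalk_letter {w : D.Word} {i : ℤ} {l : D.Letter}
    (h : w.letter i = some l) : ∃ c, (D.canonicalWalk w).letter i = some c := by
  simp only [canonicalWalk, h, Option.map_some]
  exact ⟨_, rfl⟩

variable [Fintype V] {M : Type*} [AddCommGroup M] [Module K M] [Module D.Alg M]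
  [IsScalarTower K D.Alg M]

/-- This is why C_w orients s^* by comparing the rays on its two sides: the loop then goes from the
smaller ray to the larger one. The assignment of intervals to rays is left abstract, since it is
needed for the limits x^-, x^+ and for two kinds of truncation. -/
theorem canonicalWalk_compat (hD : D.IsClannish) {w : D.Word} (hw : S.IsEndWord w) {i : ℤ}
    {l : D.Letter} {c : SCWalkLetter A} (hl : w.letter i = some l)
    (hc : (D.canonicalWalk w).letter i = some c)
    (Fm Fp : Option V → ℤˣ → (ℕ → Option D.Letter) → Submodule K M)
    (hF : ∀ o ε x y, S.IsRay o ε x → S.IsRay o ε y → SeqLT x y →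
      Fp o ε x ≤ Fp o ε y ∧ (Fp o ε x ≤ Fm o ε y ∨ Fm o ε y = Fm o ε x)) :
    Compat (Fm (w.vertex (i - 1)) (-S.sgnAt w (i - 1)) (before w (i - 1)))
      (Fp (w.vertex (i - 1)) (-S.sgnAt w (i - 1)) (before w (i - 1)))
      (Fm (w.vertex i) (S.sgnAt w i) (after w i))
      (Fp (w.vertex i) (S.sgnAt w i) (after w i)) c l := by
  simp only [canonicalWalk, hl, Option.map_some, Option.some.injEq] at hc
  subst hc
  cases l with
  | dir a ha => exact .dir a ha
  | inv a ha => exact .inv a ha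
  | star s hs =>
    have hmem := hw.mem_index hl
    -- Since s is a loop and s^* is its own inverse, the outward rays on its two sides have the same
    -- head and sign, hence are comparable.
    have h1 : w.vertex (i - 1) = w.vertex i := by
      rw [hw.vertex_left hl, hw.vertex_right hl]
      exact congrArg some (hD.special_loop s hs)
    have h2 : -S.sgnAt w (i - 1) = S.sgnAt w i := by
      rw [hw.sgnAt_left hl, hw.sgnAt_right hl]
      rfl
    have hb := hw.isRay_before hD hmem.2
    have ha := hw.isRay_after hmem.1
    rw [h1, h2] at hb ⊢
    split_ifs with h
    · rcases h with h | h
      · obtain ⟨h3, h4⟩ := hF _ _ _ _ ha hb h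
        exact .star_dir s hs h3 h4
      · rw [h.1.2]
        exact .star_dir s hs le_rfl (.inr rfl)
    · rcases hb.trichotomy ha with h3 | h3 | h3
      · rw [h3]
        exact .star_inv s hs le_rfl (.inr rfl)
      · obtain ⟨h4, h5⟩ := hF _ _ _ _ hb ha h3
        exact .star_inv s hs h4 h5
      · exact absurd (.inl h3) h

section Spaces

variable (S M)

/-- `(w_{≤i})⁻¹` truncated to `d` letters, as a subspace. -/
def leftPlus (w : D.Word) (d : ℕ) (i : ℤ) : Submodule K M :=
  S.plus M d (w.vertex i) (-S.sgnAt w i) (before w i)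

/-- `w_{>i}` truncated to `d` letters, as a subspace. -/
def rightPlus (w : D.Word) (d : ℕ) (i : ℤ) : Submodule K M :=
  S.plus M d (w.vertex i) (S.sgnAt w i) (after w i)

/-- The smaller subspace for `(w_{≤i})⁻¹` truncated to `d` letters. -/
def leftMinus (w : D.Word) (d : ℕ) (i : ℤ) : Submodule K M :=
  S.minus M d (w.vertex i) (-S.sgnAt w i) (before w i)

/-- The smaller subspace for `w_{>i}` truncated to `d` letters. -/
def rightMinus (w : D.Word) (d : ℕ) (i : ℤ) : Submodule K M :=
  S.minus M d (w.vertex i) (S.sgnAt w i) (after w i)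

/-- The subspace `((w_{≤i})⁻¹)^+`. -/
def leftPlusInf (w : D.Word) (i : ℤ) : Submodule K M :=
  S.plusInf M (w.vertex i) (-S.sgnAt w i) (before w i)

/-- The subspace `(w_{>i})^+`. -/
def rightPlusInf (w : D.Word) (i : ℤ) : Submodule K M :=
  S.plusInf M (w.vertex i) (S.sgnAt w i) (after w i)

/-- The subspace `((w_{≤i})⁻¹)^-`. -/
def leftMinusInf (w : D.Word) (i : ℤ) : Submodule K M :=
  S.minusInf M (w.vertex i) (-S.sgnAt w i) (before w i)

/-- The subspace `(w_{>i})^-`. -/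
def rightMinusInf (w : D.Word) (i : ℤ) : Submodule K M :=
  S.minusInf M (w.vertex i) (S.sgnAt w i) (after w i)

/-- The subspace `num` at a position of a word. -/
def numAt (w : D.Word) (i : ℤ) : Submodule K M :=
  S.num M (w.vertex i) (S.sgnAt w i) (before w i) (after w i)

/-- The subspace `den` at a position of a word. -/
def denAt (w : D.Word) (i : ℤ) : Submodule K M :=
  S.den M (w.vertex i) (S.sgnAt w i) (before w i) (after w i)

end Spaces

section Step

variable {w : D.Word} {i : ℤ} {l : D.Letter}

theorem IsWord.rightPlus_succ (hw : S.IsWord w) (hl : w.letter i = some l) (d : ℕ) :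
    S.rightPlus M w (d + 1) (i - 1) = l.act M (S.rightPlus M w d i) := by
  rw [rightPlus, plus_succ_of_some ((after_zero w i).trans hl), after_succ, rightPlus,
    hw.vertex_right hl, hw.sgnAt_right hl]

theorem IsWord.rightMinus_succ (hw : S.IsWord w) (hl : w.letter i = some l) (d : ℕ) :
    S.rightMinus M w (d + 1) (i - 1) = l.act M (S.rightMinus M w d i) := by
  rw [rightMinus, minus_succ_of_some ((after_zero w i).trans hl), after_succ, rightMinus,
    hw.vertex_right hl, hw.sgnAt_right hl]

theorem IsWord.leftPlus_succ (hD : D.IsClannish) (hw : S.IsWord w) (hl : w.letter i = some l)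
    (d : ℕ) : S.leftPlus M w (d + 1) i = l.inverse.act M (S.leftPlus M w d (i - 1)) := by
  rw [leftPlus, plus_succ_of_some (before_zero_of_some hl), before_succ, leftPlus,
    hw.vertex_left hl, hw.sgnAt_left hl, Letter.tail_inverse l hD, Letter.inverse_inverse]

theorem IsWord.leftMinus_succ (hD : D.IsClannish) (hw : S.IsWord w) (hl : w.letter i = some l)
    (d : ℕ) : S.leftMinus M w (d + 1) i = l.inverse.act M (S.leftMinus M w d (i - 1)) := by
  rw [leftMinus, minus_succ_of_some (before_zero_of_some hl), before_succ, leftMinus,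
    hw.vertex_left hl, hw.sgnAt_left hl, Letter.tail_inverse l hD, Letter.inverse_inverse]

variable [Module.Finite K M]

theorem IsEndWord.rightPlusInf_eq (hw : S.IsEndWord w) (hl : w.letter i = some l) :
    S.rightPlusInf M w (i - 1) = l.act M (S.rightPlusInf M w i) := by
  rw [rightPlusInf, plusInf_of_some (hw.isRay_after (hw.mem_index hl).2)
    ((after_zero w i).trans hl), after_succ, rightPlusInf, hw.vertex_right hl, hw.sgnAt_right hl]

theorem IsEndWord.rightMinusInf_eq (hw : S.IsEndWord w) (hl : w.letter i = some l) :
    S.rightMinusInf M w (i - 1) = l.act M (S.rightMinusInf M w i) := by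
  rw [rightMinusInf, minusInf_of_some (hw.isRay_after (hw.mem_index hl).2)
    ((after_zero w i).trans hl), after_succ, rightMinusInf, hw.vertex_right hl, hw.sgnAt_right hl]

theorem IsEndWord.leftPlusInf_eq (hD : D.IsClannish) (hw : S.IsEndWord w)
    (hl : w.letter i = some l) :
    S.leftPlusInf M w i = l.inverse.act M (S.leftPlusInf M w (i - 1)) := by
  rw [leftPlusInf, plusInf_of_some (hw.isRay_before hD (hw.mem_index hl).1)
    (before_zero_of_some hl), before_succ, leftPlusInf, hw.vertex_left hl, hw.sgnAt_left hl,
    Letter.tail_inverse l hD, Letter.inverse_inverse]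

theorem IsEndWord.leftMinusInf_eq (hD : D.IsClannish) (hw : S.IsEndWord w)
    (hl : w.letter i = some l) :
    S.leftMinusInf M w i = l.inverse.act M (S.leftMinusInf M w (i - 1)) := by
  rw [leftMinusInf, minusInf_of_some (hw.isRay_before hD (hw.mem_index hl).1)
    (before_zero_of_some hl), before_succ, leftMinusInf, hw.vertex_left hl, hw.sgnAt_left hl,
    Letter.tail_inverse l hD, Letter.inverse_inverse]

end Step

end Canonical

/-! ### Elements of T_C(M) along the canonical walk -/

section Canonical

variable {K V A : Type*} [DivisionRing K] [Fintype V] {D : SCData K V A} {S : D.SignChoice}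
  {M : Type*} [AddCommGroup M] [Module K M] [Module D.Alg M] [IsScalarTower K D.Alg M]
  {w : D.Word} {i : ℤ} {l : D.Letter} {c : SCWalkLetter A}

theorem IsWord.leftPlus_le (hw : S.IsWord w) (hl : w.letter i = some l) :
    S.leftPlus M w 0 (i - 1) ≤ D.vertexSpace M l.head := by
  rw [leftPlus, hw.vertex_left hl]
  exact le_rfl

theorem IsWord.rightPlus_le (hw : S.IsWord w) (hl : w.letter i = some l) :
    S.rightPlus M w 0 i ≤ D.vertexSpace M l.tail := by
  rw [rightPlus, hw.vertex_right hl]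
  exact le_rfl

theorem IsEndWord.step (hD : D.IsClannish) (hw : S.IsEndWord w) (hl : w.letter i = some l)
    (hc : (D.canonicalWalk w).letter i = some c) :
    IsStep c l (S.leftMinusInf M w (i - 1)) (S.leftPlusInf M w (i - 1))
      (S.rightMinusInf M w i) (S.rightPlusInf M w i) where
  compat := canonicalWalk_compat hD hw hl hc (S.minusInf M) (S.plusInf M)
    fun _ _ _ _ hx hy h => ⟨(plusInf_le_minusInf hx hy h).trans (minusInf_le_plusInf hy),
      .inl (plusInf_le_minusInf hx hy h)⟩
  left_le := minusInf_le_plusInf (hw.isRay_before hD (hw.mem_index hl).2)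
  right_le := minusInf_le_plusInf (hw.isRay_after (hw.mem_index hl).1)
  left_vertex := (plusInf_le 0 _ _ _).trans (hw.leftPlus_le hl)
  right_vertex := (plusInf_le 0 _ _ _).trans (hw.rightPlus_le hl)

/-- The smaller subspaces are truncated on both sides at the same depth. Different rays may then
have equal truncations, which is what the alternative with equal lower ends in `Compat` allows for;
it makes induction on the depth possible. -/
theorem IsEndWord.stepAt (hD : D.IsClannish) (hw : S.IsEndWord w) (hl : w.letter i = some l)
    (hc : (D.canonicalWalk w).letter i = some c) (d : ℕ) :
    IsStep c l (S.leftMinus M w d (i - 1)) (S.leftPlusInf M w (i - 1))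
      (S.rightMinus M w d i) (S.rightPlusInf M w i) where
  compat := canonicalWalk_compat hD hw hl hc (S.minus M d) (S.plusInf M)
    fun _ _ _ _ hx hy h => ⟨(plusInf_le_minusInf hx hy h).trans (minusInf_le_plusInf hy),
      (plus_le_minus_or_eq (M := M) hx hy h d).imp (fun h1 => (plusInf_le d _ _ _).trans h1)
        (fun h1 => h1.2.symm)⟩
  left_le := (le_minusInf d _ _ _).trans
    (minusInf_le_plusInf (hw.isRay_before hD (hw.mem_index hl).2))
  right_le := (le_minusInf d _ _ _).trans
    (minusInf_le_plusInf (hw.isRay_after (hw.mem_index hl).1))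
  left_vertex := (plusInf_le 0 _ _ _).trans (hw.leftPlus_le hl)
  right_vertex := (plusInf_le 0 _ _ _).trans (hw.rightPlus_le hl)

/-- Zero lower ends let the truncated upper subspaces be treated as a step, for the induction in
`val_mem_plus`. -/
theorem IsEndWord.stepPlus (hD : D.IsClannish) (hw : S.IsEndWord w) (hl : w.letter i = some l)
    (hc : (D.canonicalWalk w).letter i = some c) (d : ℕ) :
    IsStep c l ⊥ (S.leftPlus M w d (i - 1)) ⊥ (S.rightPlus M w d i) where
  compat := canonicalWalk_compat hD hw hl hc (fun _ _ _ => ⊥) (S.plus M d)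
    fun _ _ _ _ hx hy h => ⟨plus_le_plus_of_seqLT hx hy h d, .inr rfl⟩
  left_le := bot_le
  right_le := bot_le
  left_vertex := (plus_antitone (hw.isRay_before hD (hw.mem_index hl).2) d.zero_le).trans
    (hw.leftPlus_le hl)
  right_vertex := (plus_antitone (hw.isRay_after (hw.mem_index hl).1) d.zero_le).trans
    (hw.rightPlus_le hl)

theorem letter_of_canonicalWalk_dir {a : A} (ha : a ∉ D.special)
    (h : (D.canonicalWalk w).letter i = some (.dir a)) : w.letter i = some (.dir a ha) := by
  obtain ⟨l, hl⟩ := letter_of_canonicalWalk h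
  simp only [canonicalWalk, hl, Option.map_some, Option.some.injEq] at h
  cases l with
  | dir b hb =>
    cases h
    exact hl
  | inv b hb => cases h
  | star s hs =>
    simp only at h
    split_ifs at h
    cases h
    exact absurd hs ha

theorem letter_of_canonicalWalk_inv {a : A} (ha : a ∉ D.special)
    (h : (D.canonicalWalk w).letter i = some (.inv a)) : w.letter i = some (.inv a ha) := by
  obtain ⟨l, hl⟩ := letter_of_canonicalWalk h
  simp only [canonicalWalk, hl, Option.map_some, Option.some.injEq] at h
  cases l with
  | dir b hb => cases h
  | inv b hb =>
    cases h
    exact hl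
  | star s hs =>
    simp only at h
    split_ifs at h
    cases h
    exact absurd hs ha

theorem canonicalWalk_letter_dir {a : A} {ha : a ∉ D.special} (h : w.letter i = some (.dir a ha)) :
    (D.canonicalWalk w).letter i = some (.dir a) := by
  simp only [canonicalWalk, h, Option.map_some]

theorem canonicalWalk_letter_inv {a : A} {ha : a ∉ D.special} (h : w.letter i = some (.inv a ha)) :
    (D.canonicalWalk w).letter i = some (.inv a) := by
  simp only [canonicalWalk, h, Option.map_some]

theorem units_ne_neg_self (ε : ℤˣ) : ε ≠ -ε := by
  rcases Int.units_eq_one_or ε with rfl | rfl <;> decide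

section Top

variable {T : D.Twist (D.canonicalWalk w)}

theorem IsWord.rel_val (hw : S.IsWord w) (θ : Top T M)
    (hc : (D.canonicalWalk w).letter i = some c) : D.Rel M c (θ.val (i - 1)) (θ.val i) := by
  obtain ⟨l, hl⟩ := letter_of_canonicalWalk hc
  obtain ⟨h1, h2⟩ := hw.mem_index hl
  cases c with
  | dir a => exact (θ.arr_smul_val h1 h2 (.inl ⟨rfl, hc⟩)).symm
  | inv a => exact (θ.arr_smul_val h2 h1 (.inr ⟨by ring, by rwa [sub_add_cancel]⟩)).symm

/-- The values of an element of `T_C(M)` lie in the subspaces given by the truncated words. -/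
theorem IsEndWord.val_mem_plus (hns : D.IsNonSingularType) (hD : D.IsClannish)
    (hw : S.IsEndWord w) (θ : Top T M) (d : ℕ) :
    ∀ i ∈ w.shape.index, θ.val i ∈ S.leftPlus M w d i ∧ θ.val i ∈ S.rightPlus M w d i := by
  induction d with
  | zero =>
    intro i hi
    obtain ⟨v, hv⟩ := hw.exists_vertex hi
    rw [leftPlus, rightPlus, hv]
    exact ⟨θ.val_mem_vertexSpace hi hv, θ.val_mem_vertexSpace hi hv⟩
  | succ d ih =>
    intro i hi
    obtain ⟨v, hv⟩ := hw.exists_vertex hi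
    constructor
    · by_cases h : i - 1 ∈ w.shape.index
      · obtain ⟨l, hl⟩ := hw.exists_letter hi h
        obtain ⟨c, hc⟩ := exists_canonicalWalk_letter hl
        rw [hw.leftPlus_succ hD hl]
        exact (hw.stepPlus hD hl hc d).mem_right hns hD (hw.rel_val θ hc) (ih _ h).1 (ih _ hi).2
      · have h0 : w.letter i = none := hw.letter_eq_none_iff.mpr fun h' => h h'.2
        rw [leftPlus, plus_succ_of_none (by rw [before_zero, h0]; rfl), hv]
        -- At the left end, an arrow a with a⁻¹ of the sign of the missing side cannot label an
        -- arrow of the quiver leaving i, because the only letter there has the opposite sign. So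
        -- the relation a b_i = 0 holds in M(C).
        refine ⟨θ.val_mem_vertexSpace hi hv, fun a ha h1 h2 => ?_⟩
        refine θ.arr_smul_val_eq_zero hi ha (hv.trans (congrArg some h1.symm)) fun j hj => ?_
        rcases hj with ⟨-, hj⟩ | ⟨-, hj⟩
        · rw [canonicalWalk_letter_none h0] at hj
          cases hj
        · rw [sgnAt_of_some (letter_of_canonicalWalk_inv ha hj)] at h2
          exact units_ne_neg_self _ h2
    · by_cases h : i + 1 ∈ w.shape.index
      · obtain ⟨l, hl⟩ := hw.exists_letter h (by rwa [add_sub_cancel_right])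
        obtain ⟨c, hc⟩ := exists_canonicalWalk_letter hl
        have h1 := hw.rightPlus_succ (M := M) hl d
        have h2 := hw.rel_val θ hc
        have h3 := hw.stepPlus (M := M) hD hl hc d
        rw [add_sub_cancel_right] at h1 h2 h3
        rw [h1]
        exact h3.mem_left hns hD h2 (ih _ hi).1 (ih _ h).2
      · have h0 : w.letter (i + 1) = none := hw.letter_eq_none_iff.mpr fun h' => h h'.1
        rw [rightPlus, plus_succ_of_none (by rw [after, Nat.cast_zero, add_zero, h0]), hv]
        refine ⟨θ.val_mem_vertexSpace hi hv, fun a ha h1 h2 => ?_⟩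
        refine θ.arr_smul_val_eq_zero hi ha (hv.trans (congrArg some h1.symm)) fun j hj => ?_
        rcases hj with ⟨-, hj⟩ | ⟨-, hj⟩
        · rw [hw.sgnAt_right (letter_of_canonicalWalk_dir ha hj)] at h2
          exact units_ne_neg_self _ h2
        · rw [canonicalWalk_letter_none h0] at hj
          cases hj

theorem numAt_eq (w : D.Word) (i : ℤ) :
    S.numAt M w i = S.leftPlusInf M w i ⊓ S.rightPlusInf M w i := rfl

theorem denAt_eq (w : D.Word) (i : ℤ) :
    S.denAt M w i = S.leftPlusInf M w i ⊓ S.rightMinusInf M w i ⊔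
      S.leftMinusInf M w i ⊓ S.rightPlusInf M w i := rfl

theorem IsEndWord.val_mem_numAt (hns : D.IsNonSingularType) (hD : D.IsClannish)
    (hw : S.IsEndWord w) (θ : Top T M) (hi : i ∈ w.shape.index) : θ.val i ∈ S.numAt M w i :=
  ⟨(Submodule.mem_iInf _).mpr fun d => (hw.val_mem_plus hns hD θ d i hi).1,
    (Submodule.mem_iInf _).mpr fun d => (hw.val_mem_plus hns hD θ d i hi).2⟩

/-- A ray with the head and sign of a⁻¹ that does not begin with a⁻¹ either stops, leaving 1^+, or
begins with some b such that ab is a zero relation. -/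
theorem arr_smul_eq_zero_of_mem_plus {a : A} {ha : a ∉ D.special} {x : ℕ → Option D.Letter}
    (hx : S.IsRay (some (D.tail a)) (S.sgn (.inv a ha)) x) {m : M}
    (hm : m ∈ S.plus M 1 (some (D.tail a)) (S.sgn (.inv a ha)) x)
    (h : x 0 ≠ some (.inv a ha)) : D.arr a • m = 0 := by
  cases h0 : x 0 with
  | none =>
    rw [plus_succ_of_none h0] at hm
    exact hm.2 a ha rfl rfl
  | some l =>
    obtain ⟨h1, h2, -⟩ := hx.of_some h0
    rw [plus_succ_of_some h0] at hm
    obtain ⟨a', b, ha', hb, hZ, ⟨h3, rfl⟩ | ⟨h3, -⟩⟩ := S.eq_of_sgn_eq (.inv a ha) l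
      (fun h3 => h (h0.trans (congrArg some h3.symm))) (Option.some.inj h1) h2
    · cases h3
      obtain ⟨u, -, rfl⟩ := hm
      exact arr_arr_smul_eq_zero hZ u
    · cases h3

variable (T) in
/-- Families of elements of the subspaces `num` compatible with the walk give elements of
`T_C(M)`. -/
theorem IsEndWord.exists_val_of_family (hD : D.IsClannish) (hw : S.IsEndWord w) (m : ℤ → M)
    (hm : ∀ i ∈ w.shape.index, m i ∈ S.numAt M w i)
    (hr : ∀ i c, (D.canonicalWalk w).letter i = some c → D.Rel M c (m (i - 1)) (m i)) :
    ∃ θ : Top T M, ∀ i ∈ w.shape.index, θ.val i = m i := by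
  refine Top.exists_val_eq T m ?_ ?_ ?_
  · intro i hi v hv
    have h1 := plusInf_le 0 _ _ _ (hm i hi).1
    have hv' : w.vertex i = some v := hv
    rw [hv'] at h1
    exact h1
  · rintro i hi j hj a (⟨rfl, h⟩ | ⟨rfl, h⟩)
    · exact (hr i _ h).symm
    · have := hr _ _ h
      rw [add_sub_cancel_right] at this
      exact this.symm
  · intro i hi a ha hv hno
    have hv' : w.vertex i = some (D.tail a) := hv
    -- The letter a⁻¹ has the sign of one of the two rays leaving i. That ray does not begin with
    -- a⁻¹, for otherwise the quiver would have an arrow labelled a with tail i.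
    have hsgn : S.sgn (.inv a ha) = S.sgnAt w i ∨ S.sgn (.inv a ha) = -S.sgnAt w i := by
      rcases Int.units_eq_one_or (S.sgn (.inv a ha)) with h1 | h1 <;>
      rcases Int.units_eq_one_or (S.sgnAt w i) with h2 | h2 <;> simp [h1, h2]
    rcases hsgn with h1 | h1
    · have h2 := hw.isRay_after hi
      have h3 := plusInf_le 1 _ _ _ (hm i hi).2
      rw [hv', ← h1] at h2 h3
      refine arr_smul_eq_zero_of_mem_plus h2 h3 fun h4 => hno (i + 1) (.inr ⟨rfl, ?_⟩)
      rw [after, Nat.cast_zero, add_zero] at h4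
      exact canonicalWalk_letter_inv h4
    · have h2 := hw.isRay_before hD hi
      have h3 := plusInf_le 1 _ _ _ (hm i hi).1
      rw [hv', ← h1] at h2 h3
      refine arr_smul_eq_zero_of_mem_plus h2 h3 fun h4 => hno (i - 1) (.inl ⟨rfl, ?_⟩)
      rw [before_zero] at h4
      obtain ⟨l, hl, hl'⟩ := Option.map_eq_some_iff.mp h4
      have : l = .dir a ha := by rw [← Letter.inverse_inverse l, hl']; rfl
      rw [this] at hl
      exact canonicalWalk_letter_dir hl

theorem exists_seq_of_step {X : Type*} (P : ℕ → X → Prop) (Q : ℕ → X → X → Prop)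
    (h : ∀ k x, P k x → ∃ y, P (k + 1) y ∧ Q k x y) (x : X) (hx : P 0 x) :
    ∃ f : ℕ → X, f 0 = x ∧ ∀ k, P k (f k) ∧ Q k (f k) (f (k + 1)) := by
  choose g hg using h
  let F : ∀ k, {x // P k x} := fun k => Nat.rec ⟨x, hx⟩ (fun k y => ⟨g k y.1 y.2, (hg k y.1 y.2).1⟩) k
  exact ⟨fun k => (F k).1, rfl, fun k => ⟨(F k).2, (hg k (F k).1 (F k).2).2⟩⟩

section Finite

variable [Module.Finite K M]

/-- The step that extends a single element to a family along the walk. Beyond the end of the word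
there is no condition, and 0 serves as a default value. -/
theorem IsEndWord.exists_right (hns : D.IsNonSingularType) (hD : D.IsClannish)
    (hw : S.IsEndWord w) {m : M} (hm : m ∈ S.numAt M w (i - 1)) :
    ∃ m' ∈ S.numAt M w i, ∀ c, (D.canonicalWalk w).letter i = some c → D.Rel M c m m' := by
  cases hc : (D.canonicalWalk w).letter i with
  | none => exact ⟨0, zero_mem _, by simp⟩
  | some c =>
    obtain ⟨l, hl⟩ := letter_of_canonicalWalk hc
    rw [numAt_eq, hw.rightPlusInf_eq hl] at hm
    obtain ⟨m', h1, h2⟩ := (hw.step hD hl hc).lift_right hns hD hm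
    rw [numAt_eq, hw.leftPlusInf_eq hD hl]
    refine ⟨m', h1, fun c' hc' => ?_⟩
    cases hc'
    exact h2

theorem IsEndWord.exists_left (hns : D.IsNonSingularType) (hD : D.IsClannish)
    (hw : S.IsEndWord w) {m' : M} (hm' : m' ∈ S.numAt M w i) :
    ∃ m ∈ S.numAt M w (i - 1), ∀ c, (D.canonicalWalk w).letter i = some c → D.Rel M c m m' := by
  cases hc : (D.canonicalWalk w).letter i with
  | none => exact ⟨0, zero_mem _, by simp⟩
  | some c =>
    obtain ⟨l, hl⟩ := letter_of_canonicalWalk hc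
    rw [numAt_eq, hw.leftPlusInf_eq hD hl] at hm'
    obtain ⟨m, h1, h2⟩ := (hw.step hD hl hc).lift_left hns hD hm'
    rw [numAt_eq, hw.rightPlusInf_eq hl]
    refine ⟨m, h1, fun c' hc' => ?_⟩
    cases hc'
    exact h2

theorem IsEndWord.exists_right_family (hns : D.IsNonSingularType) (hD : D.IsClannish)
    (hw : S.IsEndWord w) {m : M} (hm : m ∈ S.numAt M w i) :
    ∃ f : ℕ → M, f 0 = m ∧ ∀ k : ℕ, f k ∈ S.numAt M w (i + k) ∧
      ∀ c, (D.canonicalWalk w).letter (i + k + 1) = some c → D.Rel M c (f k) (f (k + 1)) := by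
  refine exists_seq_of_step (fun k x => x ∈ S.numAt M w (i + k)) (fun k x y =>
    ∀ c, (D.canonicalWalk w).letter (i + k + 1) = some c → D.Rel M c x y) (fun k x hx => ?_) m
    (by simpa using hm)
  obtain ⟨y, h1, h2⟩ := hw.exists_right (i := i + k + 1) hns hD (by rwa [add_sub_cancel_right])
  exact ⟨y, by rwa [Nat.cast_succ, ← add_assoc], h2⟩

theorem IsEndWord.exists_left_family (hns : D.IsNonSingularType) (hD : D.IsClannish)
    (hw : S.IsEndWord w) {m : M} (hm : m ∈ S.numAt M w i) :
    ∃ f : ℕ → M, f 0 = m ∧ ∀ k : ℕ, f k ∈ S.numAt M w (i - k) ∧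
      ∀ c, (D.canonicalWalk w).letter (i - k) = some c → D.Rel M c (f (k + 1)) (f k) := by
  refine exists_seq_of_step (fun k x => x ∈ S.numAt M w (i - k)) (fun k x y =>
    ∀ c, (D.canonicalWalk w).letter (i - k) = some c → D.Rel M c y x) (fun k x hx => ?_) m
    (by simpa using hm)
  obtain ⟨y, h1, h2⟩ := hw.exists_left (i := i - k) hns hD hx
  exact ⟨y, by rwa [Nat.cast_succ, ← sub_sub], h2⟩

end Finite

variable (T) in
theorem IsEndWord.exists_val_of_families (hD : D.IsClannish) (hw : S.IsEndWord w) {m : M}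
    {f g : ℕ → M} (hf0 : f 0 = m) (hg0 : g 0 = m)
    (hf : ∀ k : ℕ, f k ∈ S.numAt M w (i - k) ∧
      ∀ c, (D.canonicalWalk w).letter (i - k) = some c → D.Rel M c (f (k + 1)) (f k))
    (hg : ∀ k : ℕ, g k ∈ S.numAt M w (i + k) ∧
      ∀ c, (D.canonicalWalk w).letter (i + k + 1) = some c → D.Rel M c (g k) (g (k + 1))) :
    ∃ θ : Top T M, (∀ k : ℕ, i - k ∈ w.shape.index → θ.val (i - k) = f k) ∧
      ∀ k : ℕ, i + k ∈ w.shape.index → θ.val (i + k) = g k := by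
  let F : ℤ → M := fun j => if j ≤ i then f (i - j).toNat else g (j - i).toNat
  have hFf : ∀ k : ℕ, F (i - k) = f k := fun k => by
    have h1 : i - (k : ℤ) ≤ i := by omega
    have h2 : (i - (i - (k : ℤ))).toNat = k := by omega
    simp only [F, if_pos h1, h2]
  have hFg : ∀ k : ℕ, F (i + k) = g k := fun k => by
    cases k with
    | zero =>
      have := hFf 0
      rw [Nat.cast_zero, sub_zero] at this
      rw [Nat.cast_zero, add_zero, this, hf0, hg0]
    | succ k =>
      have h1 : ¬ i + ((k + 1 : ℕ) : ℤ) ≤ i := by omega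
      have h2 : (i + ((k + 1 : ℕ) : ℤ) - i).toNat = k + 1 := by omega
      simp only [F, if_neg h1, h2]
  have hF1 : ∀ j ∈ w.shape.index, F j ∈ S.numAt M w j := by
    intro j _
    rcases le_total j i with h | h
    · obtain ⟨k, rfl⟩ : ∃ k : ℕ, j = i - k := ⟨(i - j).toNat, by omega⟩
      rw [hFf]
      exact (hf k).1
    · obtain ⟨k, rfl⟩ : ∃ k : ℕ, j = i + k := ⟨(j - i).toNat, by omega⟩
      rw [hFg]
      exact (hg k).1
  have hF2 : ∀ j c, (D.canonicalWalk w).letter j = some c → D.Rel M c (F (j - 1)) (F j) := by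
    intro j c hc
    rcases le_or_gt j i with h | h
    · obtain ⟨k, rfl⟩ : ∃ k : ℕ, j = i - k := ⟨(i - j).toNat, by omega⟩
      have h1 := hFf (k + 1)
      rw [Nat.cast_succ, ← sub_sub] at h1
      rw [hFf, h1]
      exact (hf k).2 c hc
    · obtain ⟨k, rfl⟩ : ∃ k : ℕ, j = i + k + 1 := ⟨(j - i - 1).toNat, by omega⟩
      have h1 := hFg (k + 1)
      rw [Nat.cast_succ, ← add_assoc] at h1
      rw [add_sub_cancel_right, hFg, h1]
      exact (hg k).2 c hc
  obtain ⟨θ, hθ⟩ := hw.exists_val_of_family T hD F hF1 hF2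
  exact ⟨θ, fun k hk => (hθ _ hk).trans (hFf k), fun k hk => (hθ _ hk).trans (hFg k)⟩

end Top

end Canonical

/-! ### The subspace B_C(M) in terms of values -/

section Kernel

variable {K V A : Type*} [DivisionRing K] [Fintype V] {D : SCData K V A} {S : D.SignChoice}
  {M : Type*} [AddCommGroup M] [Module K M] [Module D.Alg M] [IsScalarTower K D.Alg M]
  {w : D.Word} {i : ℤ} {T : D.Twist (D.canonicalWalk w)}

theorem mem_Bplus_of_full {θ : Top T M} (hs : w.shape = .full) :
    θ ∈ S.Bplus T M ↔ ∃ N : ℤ, ∀ i < N, θ.val i = 0 := by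
  rw [← Top.mem_vanishBelow]
  unfold Bplus
  split
  · exact Iff.rfl
  · rename_i n h
    have h' : w.shape = .finite n := h
    rw [hs] at h'
    cases h'

theorem mem_Bminus_of_full {θ : Top T M} (hs : w.shape = .full) :
    θ ∈ S.Bminus T M ↔ ∃ N : ℤ, ∀ i, N < i → θ.val i = 0 := by
  rw [← Top.mem_vanishAbove]
  unfold Bminus
  split
  · exact Iff.rfl
  · rename_i n h
    have h' : w.shape = .finite n := h
    rw [hs] at h'
    cases h'

/-- At position 0 the left ray is empty, so its smaller subspace is the 1^- of the boundary
condition. -/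
theorem IsWord.mem_Bplus_of_finite (hw : S.IsWord w) {θ : Top T M} {n : ℕ}
    (hs : w.shape = .finite n) : θ ∈ S.Bplus T M ↔ θ.val 0 ∈ S.leftMinusInf M w 0 := by
  obtain ⟨v, hv⟩ := hw.exists_vertex (zero_mem_index w.shape)
  have h0 : before w 0 0 = none := by
    rw [before_zero, hw.letter_eq_none_iff.mpr, Option.map_none]
    rw [hs]
    rintro ⟨-, h, -⟩
    omega
  rw [leftMinusInf, minusInf_of_none h0, hv, hw.sgnAt_zero, Option.elim_some]
  unfold Bplus
  split
  · rename_i h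
    have h' : w.shape = .full := h
    rw [hs] at h'
    cases h'
  · exact Top.mem_boundary (zero_mem_index _) hv

theorem IsWord.mem_Bminus_of_finite (hw : S.IsWord w) {θ : Top T M} {n : ℕ}
    (hs : w.shape = .finite n) : θ ∈ S.Bminus T M ↔ θ.val n ∈ S.rightMinusInf M w n := by
  have hn : (n : ℤ) ∈ w.shape.index := by
    rw [hs]
    exact ⟨by positivity, le_rfl⟩
  obtain ⟨v, hv⟩ := hw.exists_vertex hn
  have h0 : after w n 0 = none := by
    rw [after, Nat.cast_zero, add_zero, hw.letter_eq_none_iff.mpr]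
    rw [hs]
    rintro ⟨⟨-, h⟩, -⟩
    omega
  have h1 : center w = n := by rw [center, hs]
  have h2 : -(S.inv (D.canonicalWalk w).star).sign = S.sgnAt w n := by
    rw [canonicalWalk_star, hw.inv_sign, neg_neg, h1]
  rw [rightMinusInf, minusInf_of_none h0, hv, Option.elim_some, ← h2]
  unfold Bminus
  split
  · rename_i h
    have h' : w.shape = .full := h
    rw [hs] at h'
    cases h'
  · rename_i n' h
    have h' : w.shape = .finite n' := h
    rw [hs] at h'
    cases h'
    exact Top.mem_boundary hn hv

theorem IsWord.mem_Bplus_of_vanish (hw : S.IsWord w) {θ : Top T M} (hi : i ∈ w.shape.index)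
    (h : ∀ j ≤ i, θ.val j = 0) : θ ∈ S.Bplus T M := by
  rcases hs : w.shape with n | _
  · rw [hw.mem_Bplus_of_finite hs, h 0]
    · exact zero_mem _
    · rw [hs] at hi
      exact hi.1
  · rw [mem_Bplus_of_full hs]
    exact ⟨i, fun j hj => h j hj.le⟩

theorem IsWord.mem_Bminus_of_vanish (hw : S.IsWord w) {θ : Top T M} (hi : i ∈ w.shape.index)
    (h : ∀ j, i ≤ j → θ.val j = 0) : θ ∈ S.Bminus T M := by
  rcases hs : w.shape with n | _
  · rw [hw.mem_Bminus_of_finite hs, h n]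
    · exact zero_mem _
    · rw [hs] at hi
      exact hi.2
  · rw [mem_Bminus_of_full hs]
    exact ⟨i, fun j hj => h j hj.le⟩

variable [Module.Finite K M]

variable (T) in
theorem IsEndWord.exists_val (hns : D.IsNonSingularType) (hD : D.IsClannish)
    (hw : S.IsEndWord w) (hi : i ∈ w.shape.index) {m : M} (hm : m ∈ S.numAt M w i) :
    ∃ θ : Top T M, θ.val i = m := by
  obtain ⟨f, hf0, hf⟩ := hw.exists_left_family hns hD hm
  obtain ⟨g, hg0, hg⟩ := hw.exists_right_family hns hD hm
  obtain ⟨θ, hθ, -⟩ := hw.exists_val_of_families T hD hf0 hg0 hf hg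
  have := hθ 0
  rw [Nat.cast_zero, sub_zero, hf0] at this
  exact ⟨θ, this hi⟩

variable (T) in
-- An element related to 0 across the letter at i may be continued by 0 to the left, and by any
-- compatible family to the right. Such elements of T_C(M) supply the corrections in B^+.
theorem IsEndWord.exists_val_vanish_left (hns : D.IsNonSingularType) (hD : D.IsClannish)
    (hw : S.IsEndWord w) (hi : i ∈ w.shape.index) {m : M} (hm : m ∈ S.numAt M w i)
    (hr : ∀ c, (D.canonicalWalk w).letter i = some c → D.Rel M c 0 m) :
    ∃ θ : Top T M, θ.val i = m ∧ ∀ j ≤ i - 1, θ.val j = 0 := by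
  obtain ⟨g, hg0, hg⟩ := hw.exists_right_family hns hD hm
  have hf : ∀ k : ℕ, (if k = 0 then m else 0) ∈ S.numAt M w (i - k) ∧
      ∀ c, (D.canonicalWalk w).letter (i - k) = some c →
        D.Rel M c (if k + 1 = 0 then m else 0) (if k = 0 then m else 0) := by
    intro k
    cases k with
    | zero => exact ⟨by simpa using hm, by simpa using hr⟩
    | succ k => exact ⟨by simp, fun c _ => by simpa using Rel.zero c⟩
  obtain ⟨θ, hθ, -⟩ := hw.exists_val_of_families (f := fun k => if k = 0 then m else 0) T hD
    (if_pos rfl) hg0 hf hg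
  have h0 := hθ 0
  rw [Nat.cast_zero, sub_zero, if_pos rfl] at h0
  refine ⟨θ, h0 hi, fun j hj => ?_⟩
  obtain ⟨k, rfl⟩ : ∃ k : ℕ, j = i - (k + 1 : ℕ) := ⟨(i - j - 1).toNat, by omega⟩
  by_cases h : i - ((k + 1 : ℕ) : ℤ) ∈ w.shape.index
  · exact (hθ (k + 1) h).trans (if_neg (by omega))
  · exact θ.val_of_notMem h

variable (T) in
theorem IsEndWord.exists_val_vanish_right (hns : D.IsNonSingularType) (hD : D.IsClannish)
    (hw : S.IsEndWord w) (hi : i ∈ w.shape.index) {m : M} (hm : m ∈ S.numAt M w i)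
    (hr : ∀ c, (D.canonicalWalk w).letter (i + 1) = some c → D.Rel M c m 0) :
    ∃ θ : Top T M, θ.val i = m ∧ ∀ j, i + 1 ≤ j → θ.val j = 0 := by
  obtain ⟨f, hf0, hf⟩ := hw.exists_left_family hns hD hm
  have hg : ∀ k : ℕ, (if k = 0 then m else 0) ∈ S.numAt M w (i + k) ∧
      ∀ c, (D.canonicalWalk w).letter (i + k + 1) = some c →
        D.Rel M c (if k = 0 then m else 0) (if k + 1 = 0 then m else 0) := by
    intro k
    cases k with
    | zero => exact ⟨by simpa using hm, by simpa using hr⟩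
    | succ k => exact ⟨by simp, fun c _ => by simpa using Rel.zero c⟩
  obtain ⟨θ, -, hθ⟩ := hw.exists_val_of_families (g := fun k => if k = 0 then m else 0) T hD
    hf0 (if_pos rfl) hf hg
  have h0 := hθ 0
  rw [Nat.cast_zero, add_zero, if_pos rfl] at h0
  refine ⟨θ, h0 hi, fun j hj => ?_⟩
  obtain ⟨k, rfl⟩ : ∃ k : ℕ, j = i + (k + 1 : ℕ) := ⟨(j - i - 1).toNat, by omega⟩
  by_cases h : i + ((k + 1 : ℕ) : ℤ) ∈ w.shape.index
  · exact (hθ (k + 1) h).trans (if_neg (by omega))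
  · exact θ.val_of_notMem h

/-- Being in `den` is preserved under compatible moves along the walk. -/
theorem IsEndWord.den_iff (hns : D.IsNonSingularType) (hD : D.IsClannish) (hw : S.IsEndWord w)
    {c : SCWalkLetter A} (hc : (D.canonicalWalk w).letter i = some c) {m m' : M}
    (hm : m ∈ S.numAt M w (i - 1)) (hm' : m' ∈ S.numAt M w i) (hr : D.Rel M c m m') :
    m ∈ S.denAt M w (i - 1) ↔ m' ∈ S.denAt M w i := by
  obtain ⟨l, hl⟩ := letter_of_canonicalWalk hc
  have hst := hw.step (M := M) hD hl hc
  rw [numAt_eq, hw.rightPlusInf_eq hl] at hm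
  rw [numAt_eq, hw.leftPlusInf_eq hD hl] at hm'
  rw [denAt_eq, denAt_eq, hw.rightPlusInf_eq hl, hw.rightMinusInf_eq hl, hw.leftPlusInf_eq hD hl,
    hw.leftMinusInf_eq hD hl]
  exact ⟨hst.den_right hns hD hr hm', hst.den_left hns hD hr hm⟩

theorem IsEndWord.val_den_iff (hns : D.IsNonSingularType) (hD : D.IsClannish)
    (hw : S.IsEndWord w) (θ : Top T M) {i j : ℤ} (hi : i ∈ w.shape.index)
    (hj : j ∈ w.shape.index) : θ.val i ∈ S.denAt M w i ↔ θ.val j ∈ S.denAt M w j := by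
  wlog hij : i ≤ j generalizing i j
  · exact (this hj hi (le_of_not_ge hij)).symm
  obtain ⟨k, rfl⟩ : ∃ k : ℕ, j = i + k := ⟨(j - i).toNat, by omega⟩
  clear hij
  induction k with
  | zero => rw [Nat.cast_zero, add_zero]
  | succ k ih =>
    have h1 : i + (k : ℤ) ∈ w.shape.index :=
      index_ordConnected _ hi hj (by omega) (by push_cast; omega)
    rw [Nat.cast_succ, ← add_assoc] at hj ⊢
    obtain ⟨l, hl⟩ := hw.exists_letter hj (by rwa [add_sub_cancel_right])
    obtain ⟨c, hc⟩ := exists_canonicalWalk_letter hl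
    rw [ih h1]
    have h2 := hw.den_iff hns hD hc (m := θ.val (i + k)) (m' := θ.val (i + k + 1))
    have h3 := hw.rel_val θ hc
    rw [add_sub_cancel_right] at h2 h3
    exact h2 (hw.val_mem_numAt hns hD θ h1) (hw.val_mem_numAt hns hD θ hj) h3

/-- Whether a value lies in den does not depend on the position, so the two summands can be tested
where the answer is evident: at an end of a finite word, or far out where the value is 0. -/
theorem IsEndWord.val_mem_denAt (hns : D.IsNonSingularType) (hD : D.IsClannish)
    (hw : S.IsEndWord w) {θ : Top T M} (hθ : θ ∈ S.B T M) (hi : i ∈ w.shape.index) :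
    θ.val i ∈ S.denAt M w i := by
  obtain ⟨p, hp, q, hq, rfl⟩ := Submodule.mem_sup.mp hθ
  rw [Top.val_add]
  refine add_mem ?_ ?_
  · rcases hs : w.shape with n | _
    · rw [hw.mem_Bplus_of_finite hs] at hp
      rw [hw.val_den_iff hns hD p hi (zero_mem_index _)]
      exact Submodule.mem_sup_right
        ⟨hp, (hw.val_mem_numAt hns hD p (zero_mem_index _)).2⟩
    · rw [mem_Bplus_of_full hs] at hp
      obtain ⟨N, hN⟩ := hp
      rw [hw.val_den_iff hns hD p hi (j := N - 1) (by rw [hs]; trivial), hN _ (by omega)]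
      exact zero_mem _
  · rcases hs : w.shape with n | _
    · have hn : (n : ℤ) ∈ w.shape.index := by
        rw [hs]
        exact ⟨by positivity, le_rfl⟩
      rw [hw.mem_Bminus_of_finite hs] at hq
      rw [hw.val_den_iff hns hD q hi hn]
      exact Submodule.mem_sup_left ⟨(hw.val_mem_numAt hns hD q hn).1, hq⟩
    · rw [mem_Bminus_of_full hs] at hq
      obtain ⟨N, hN⟩ := hq
      rw [hw.val_den_iff hns hD q hi (j := N + 1) (by rw [hs]; trivial), hN _ (by omega)]
      exact zero_mem _

variable (T) in
/-- The elements of `den` are values of elements of `B_C(M)`, by induction on the number of letters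
which are used. -/
theorem IsEndWord.exists_mem_B_of_minus (hns : D.IsNonSingularType) (hD : D.IsClannish)
    (hw : S.IsEndWord w) (d : ℕ) : ∀ i ∈ w.shape.index,
      (∀ m ∈ S.leftMinus M w d i ⊓ S.rightPlusInf M w i, ∃ θ ∈ S.B T M, θ.val i = m) ∧
      (∀ m ∈ S.leftPlusInf M w i ⊓ S.rightMinus M w d i, ∃ θ ∈ S.B T M, θ.val i = m) := by
  have hzero : ∀ i ∈ w.shape.index, (0 : Top T M).val i = 0 := fun i hi => by
    rw [Top.val_of_mem _ hi]
    rfl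
  induction d with
  | zero =>
    intro i hi
    refine ⟨fun m hm => ⟨0, zero_mem _, ?_⟩, fun m hm => ⟨0, zero_mem _, ?_⟩⟩
    · rw [hzero i hi]
      exact ((Submodule.mem_bot K).mp hm.1).symm
    · rw [hzero i hi]
      exact ((Submodule.mem_bot K).mp hm.2).symm
  | succ d ih =>
    intro i hi
    have hleft : ∀ d, S.leftMinus M w d i ≤ S.leftPlusInf M w i := fun d =>
      (le_minusInf d _ _ _).trans (minusInf_le_plusInf (hw.isRay_before hD hi))
    have hright : ∀ d, S.rightMinus M w d i ≤ S.rightPlusInf M w i := fun d =>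
      (le_minusInf d _ _ _).trans (minusInf_le_plusInf (hw.isRay_after hi))
    constructor
    · intro m hm
      have hmn : m ∈ S.numAt M w i := ⟨hleft _ hm.1, hm.2⟩
      by_cases h : i - 1 ∈ w.shape.index
      · obtain ⟨l, hl⟩ := hw.exists_letter hi h
        obtain ⟨c, hc⟩ := exists_canonicalWalk_letter hl
        rw [hw.leftMinus_succ hD hl] at hm
        -- Up to q, which uses d letters on the right, m comes from an element p at i - 1 using d
        -- letters on the left. Both have one letter fewer, so the two halves of the claim are
        -- proved together.
        obtain ⟨p, hp, q, hq, hr⟩ := (hw.stepAt hD hl hc d).exists_rel_sub hns hm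
        rw [← hw.rightPlusInf_eq hl] at hp
        rw [← hw.leftPlusInf_eq hD hl] at hq
        obtain ⟨θp, hθp, hvp⟩ := (ih _ h).1 p hp
        obtain ⟨θq, hθq, hvq⟩ := (ih _ hi).2 q hq
        have hr' := hw.rel_val θp hc
        rw [hvp] at hr'
        have hr'' := hr.sub hr'
        rw [sub_self] at hr''
        -- θp need not take the value m - q at i, but p is related to both, so their difference is
        -- related to 0 and is the value of an element vanishing to the left.
        obtain ⟨θ, hθ, hv⟩ := hw.exists_val_vanish_left T hns hD hi
          (m := m - q - θp.val i) (sub_mem (sub_mem hmn ⟨hq.1, hright _ hq.2⟩)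
            (hw.val_mem_numAt hns hD θp hi)) (fun c' hc' => by
              cases hc.symm.trans hc'
              exact hr'')
        refine ⟨θp + θq + θ, add_mem (add_mem hθp hθq)
          (Submodule.mem_sup_left (hw.mem_Bplus_of_vanish h hv)), ?_⟩
        rw [Top.val_add, Top.val_add, hvq, hθ]
        abel
      · obtain ⟨θ, hθ⟩ := hw.exists_val T hns hD hi hmn
        refine ⟨θ, Submodule.mem_sup_left ?_, hθ⟩
        rcases hs : w.shape with n | _
        · rw [hs] at h hi
          obtain rfl : i = 0 := by
            by_contra h0
            obtain ⟨h1, h2⟩ := hi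
            exact h ⟨by omega, by omega⟩
          rw [hw.mem_Bplus_of_finite hs, hθ]
          exact le_minusInf _ _ _ _ hm.1
        · rw [hs] at h
          exact absurd trivial h
    · intro m hm
      have hmn : m ∈ S.numAt M w i := ⟨hm.1, hright _ hm.2⟩
      by_cases h : i + 1 ∈ w.shape.index
      · obtain ⟨l, hl⟩ := hw.exists_letter h (by rwa [add_sub_cancel_right])
        obtain ⟨c, hc⟩ := exists_canonicalWalk_letter hl
        have h1 := hw.rightMinus_succ (M := M) hl d
        have h2 := hw.stepAt (M := M) hD hl hc d
        have h3 := hw.rightPlusInf_eq (M := M) hl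
        have h4 := hw.leftPlusInf_eq (M := M) hD hl
        have h5 := fun θ : Top T M => hw.rel_val θ hc
        rw [add_sub_cancel_right] at h1 h2 h3 h4 h5
        have hm' : m ∈ l.inverse.inverse.act M (S.rightMinus M w d (i + 1)) ⊓
            S.leftPlusInf M w i := by
          rw [Letter.inverse_inverse, ← h1]
          exact hm.symm
        obtain ⟨p, hp, q, hq, hr⟩ := (h2.swap hD).exists_rel_sub hns hm'
        rw [← h4] at hp
        rw [Letter.inverse_inverse, ← h3] at hq
        rw [rel_inverse] at hr
        obtain ⟨θp, hθp, hvp⟩ := (ih _ h).2 p hp.symm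
        obtain ⟨θq, hθq, hvq⟩ := (ih _ hi).1 q hq.symm
        have hr' := h5 θp
        rw [hvp] at hr'
        have hr'' := hr.sub hr'
        rw [sub_self] at hr''
        obtain ⟨θ, hθ, hv⟩ := hw.exists_val_vanish_right T hns hD hi
          (m := m - q - θp.val i) (sub_mem (sub_mem hmn ⟨hleft _ hq.2, hq.1⟩)
            (hw.val_mem_numAt hns hD θp hi)) (fun c' hc' => by
              cases hc.symm.trans hc'
              exact hr'')
        refine ⟨θp + θq + θ, add_mem (add_mem hθp hθq)
          (Submodule.mem_sup_right (hw.mem_Bminus_of_vanish h hv)), ?_⟩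
        rw [Top.val_add, Top.val_add, hvq, hθ]
        abel
      · obtain ⟨θ, hθ⟩ := hw.exists_val T hns hD hi hmn
        refine ⟨θ, Submodule.mem_sup_right ?_, hθ⟩
        rcases hs : w.shape with n | _
        · rw [hs] at h hi
          obtain rfl : i = n := by
            by_contra h0
            obtain ⟨h1, h2⟩ := hi
            exact h ⟨by omega, by omega⟩
          rw [hw.mem_Bminus_of_finite hs, hθ]
          exact le_minusInf _ _ _ _ hm.2
        · rw [hs] at h
          exact absurd trivial h

/-- An element vanishing at i can be cut there: its two halves are again in T_C(M), the left half in
B^- and the right half in B^+. -/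
theorem IsEndWord.mem_B_of_val_eq_zero (hns : D.IsNonSingularType) (hD : D.IsClannish)
    (hw : S.IsEndWord w) {θ : Top T M} (hi : i ∈ w.shape.index) (h : θ.val i = 0) :
    θ ∈ S.B T M := by
  obtain ⟨θ', hθ'⟩ := hw.exists_val_of_family T hD (fun j => if j ≤ i then θ.val j else 0)
    (fun j hj => by
      split_ifs
      · exact hw.val_mem_numAt hns hD θ hj
      · exact zero_mem _)
    (fun j c hc => by
      rcases lt_trichotomy j (i + 1) with h1 | h1 | h1
      · rw [if_pos (by omega), if_pos (by omega)]
        exact hw.rel_val θ hc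
      · rw [if_pos (by omega), if_neg (by omega), show j - 1 = i by omega, h]
        exact Rel.zero c
      · rw [if_neg (by omega), if_neg (by omega)]
        exact Rel.zero c)
  rw [← sub_add_cancel θ θ']
  refine add_mem (Submodule.mem_sup_left (hw.mem_Bplus_of_vanish hi fun j hj => ?_))
    (Submodule.mem_sup_right (hw.mem_Bminus_of_vanish hi fun j hj => ?_))
  · by_cases hj' : j ∈ w.shape.index
    · rw [Top.val_sub, hθ' j hj', if_pos hj, sub_self]
    · exact Top.val_of_notMem _ hj'
  · by_cases hj' : j ∈ w.shape.index
    · rw [hθ' j hj']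
      split_ifs with h1
      · rw [le_antisymm h1 hj, h]
      · rfl
    · exact Top.val_of_notMem _ hj'

/-- The subspace `B_C(M)` consists of the elements with values in `den`. -/
theorem IsEndWord.mem_B_iff (hns : D.IsNonSingularType) (hD : D.IsClannish)
    (hw : S.IsEndWord w) {θ : Top T M} (hi : i ∈ w.shape.index) :
    θ ∈ S.B T M ↔ θ.val i ∈ S.denAt M w i := by
  refine ⟨fun h => hw.val_mem_denAt hns hD h hi, fun h => ?_⟩
  obtain ⟨p, hp, q, hq, hpq⟩ := Submodule.mem_sup.mp h
  obtain ⟨d, hd⟩ := mem_minusInf.mp hp.2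
  obtain ⟨d', hd'⟩ := mem_minusInf.mp hq.1
  obtain ⟨θp, hθp, hvp⟩ := (hw.exists_mem_B_of_minus T hns hD d i hi).2 p ⟨hp.1, hd⟩
  obtain ⟨θq, hθq, hvq⟩ := (hw.exists_mem_B_of_minus T hns hD d' i hi).1 q ⟨hd', hq.2⟩
  rw [← sub_add_cancel θ (θp + θq)]
  refine add_mem (hw.mem_B_of_val_eq_zero hns hD hi ?_) (add_mem hθp hθq)
  rw [Top.val_sub, Top.val_add, hvp, hvq, hpq, sub_self]

end Kernel

/-! ### The dimension of F_C(M) -/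

section Dimension

variable {K V A : Type*} [DivisionRing K] [Fintype V] {D : SCData K V A} {S : D.SignChoice}
  {M : Type*} [AddCommGroup M] [Module K M] [Module D.Alg M] [IsScalarTower K D.Alg M]
  {w : D.Word} {i : ℤ} {T : D.Twist (D.canonicalWalk w)}

variable (T M) in
/-- Evaluation of elements of `T_C(M)` at `b_i`, as a semilinear map. -/
noncomputable def evalMap (i : ℤ) : Top T M →ₛₗ[((T.π i : K ≃+* K) : K →+* K)] M where
  toFun θ := θ.val i
  map_add' θ θ' := θ.val_add θ' i
  map_smul' c θ := θ.val_smul c i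

variable [Module.Finite K M]

/-- Evaluation at b_i maps T_C(M) onto num, and B_C(M) is the preimage of den. The induced
isomorphism is semilinear over π_i, not linear. -/
theorem IsEndWord.exists_equiv (hns : D.IsNonSingularType) (hD : D.IsClannish)
    (hw : S.IsEndWord w) (hi : i ∈ w.shape.index) :
    ∃ e : S.F T M ≃+ (S.numAt M w i).map (S.denAt M w i).mkQ,
      ∀ (c : K) (x : S.F T M), e (c • x) = T.π i c • e x := by
  have hle : S.B T M ≤ (S.denAt M w i).comap (evalMap M T i) :=
    fun θ hθ => (hw.mem_B_iff hns hD hi).mp hθ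
  let f := Submodule.mapQ (S.B T M) (S.denAt M w i) (evalMap M T i) hle
  have hinj : Function.Injective f := by
    rw [injective_iff_map_eq_zero]
    intro x hx
    obtain ⟨θ, rfl⟩ := Submodule.Quotient.mk_surjective _ x
    rw [Submodule.Quotient.mk_eq_zero, hw.mem_B_iff hns hD hi]
    exact (Submodule.Quotient.mk_eq_zero _).mp hx
  have hrange : LinearMap.range f = (S.numAt M w i).map (S.denAt M w i).mkQ := by
    ext x
    constructor
    · rintro ⟨y, rfl⟩
      obtain ⟨θ, rfl⟩ := Submodule.Quotient.mk_surjective _ y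
      exact ⟨θ.val i, hw.val_mem_numAt hns hD θ hi, rfl⟩
    · rintro ⟨m, hm, rfl⟩
      obtain ⟨θ, rfl⟩ := hw.exists_val T hns hD hi hm
      exact ⟨Submodule.Quotient.mk θ, rfl⟩
  have hmem : ∀ x, f x ∈ (S.numAt M w i).map (S.denAt M w i).mkQ := fun x =>
    hrange ▸ LinearMap.mem_range_self f x
  let g : S.F T M →+ (S.numAt M w i).map (S.denAt M w i).mkQ :=
    { toFun := fun x => ⟨f x, hmem x⟩
      map_zero' := Subtype.ext (map_zero f)
      map_add' := fun x y => Subtype.ext (map_add f x y) }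
  refine ⟨AddEquiv.ofBijective g ⟨fun x y h => hinj (congrArg Subtype.val h), ?_⟩,
    fun c x => Subtype.ext (f.map_smulₛₗ c x)⟩
  rintro ⟨y, hy⟩
  rw [← hrange] at hy
  obtain ⟨x, rfl⟩ := hy
  exact ⟨x, rfl⟩

theorem IsEndWord.finite_F_and_finrank_eq (hns : D.IsNonSingularType) (hD : D.IsClannish)
    (hw : S.IsEndWord w) (hi : i ∈ w.shape.index) :
    Module.Finite K (S.F T M) ∧ Module.finrank K (S.F T M) =
      Module.finrank K ((S.numAt M w i).map (S.denAt M w i).mkQ) := by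
  obtain ⟨e, he⟩ := hw.exists_equiv (T := T) (M := M) hns hD hi
  -- Ranks are invariant under additive isomorphisms that are semilinear over an automorphism of K.
  have h := lift_rank_eq_of_equiv_equiv (T.π i) e (T.π i).bijective he
  constructor
  · rw [← Module.rank_lt_aleph0_iff, ← Cardinal.lift_lt_aleph0, h, Cardinal.lift_lt_aleph0,
      Module.rank_lt_aleph0_iff]
    infer_instance
  · have := congrArg Cardinal.toNat h
    rwa [Cardinal.toNat_lift, Cardinal.toNat_lift] at this

theorem IsEndWord.finite_F (hns : D.IsNonSingularType) (hD : D.IsClannish)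
    (hw : S.IsEndWord w) : Module.Finite K (S.F T M) :=
  (hw.finite_F_and_finrank_eq hns hD (zero_mem_index w.shape)).1

theorem IsEndWord.finrank_F (hns : D.IsNonSingularType) (hD : D.IsClannish)
    (hw : S.IsEndWord w) (hi : i ∈ w.shape.index) :
    Module.finrank K (S.F T M) = S.mult M (w.vertex i) (S.sgnAt w i) (before w i) (after w i) := by
  have h2 := (hw.finite_F_and_finrank_eq (T := T) (M := M) hns hD hi).2
  have hle : S.denAt M w i ≤ S.numAt M w i :=
    den_le_num (hw.isRay_before hD hi) (hw.isRay_after hi)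
  have h3 := LinearMap.finrank_range_add_finrank_ker
    ((S.denAt M w i).mkQ.comp (S.numAt M w i).subtype)
  have h4 : LinearMap.range ((S.denAt M w i).mkQ.comp (S.numAt M w i).subtype) =
      (S.numAt M w i).map (S.denAt M w i).mkQ := by
    rw [LinearMap.range_comp, Submodule.range_subtype]
  have h5 : LinearMap.ker ((S.denAt M w i).mkQ.comp (S.numAt M w i).subtype) =
      (S.denAt M w i).comap (S.numAt M w i).subtype := by
    rw [LinearMap.ker_comp, Submodule.ker_mkQ]
  rw [h4, h5, (Submodule.comapSubtypeEquivOfLe hle).finrank_eq] at h3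
  rw [h2, mult]
  change _ = Module.finrank K (S.numAt M w i) - Module.finrank K (S.denAt M w i)
  omega

end Dimension

/-! ### Words formed by two rays -/

section Joint

variable {K V A : Type*} [DivisionRing K] {D : SCData K V A} {S : D.SignChoice}

theorem IsRay.cons {l : D.Letter} {x y : ℕ → Option D.Letter} (h0 : x 0 = some l)
    (hxy : (fun j => x (j + 1)) = y) (hy : S.IsRay (some l.tail) (-S.sgn l.inverse) y) :
    S.IsRay (some l.head) (S.sgn l) x := by
  obtain ⟨P, hP, hPy⟩ := hy
  refine ⟨fun o ε z => P o ε z ∨ (o = some l.head ∧ ε = S.sgn l ∧ z = x), ?_,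
    .inr ⟨rfl, rfl, rfl⟩⟩
  rintro o ε z (h | ⟨rfl, rfl, rfl⟩)
  · rcases hP o ε z h with h1 | ⟨l', h1, h2, h3, h4⟩
    · exact .inl h1
    · exact .inr ⟨l', h1, h2, h3, .inl h4⟩
  · exact .inr ⟨l, h0, rfl, rfl, .inl (hxy ▸ hPy)⟩

theorem IsRay.eq_none {o : Option V} {ε : ℤˣ} {x : ℕ → Option D.Letter} (h : S.IsRay o ε x)
    {j k : ℕ} (hj : x j = none) (hjk : j ≤ k) : x k = none := by
  induction j generalizing o ε x k with
  | zero => exact (h.of_none hj).1 k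
  | succ j ih =>
    cases hl : x 0 with
    | none => exact (h.of_none hl).1 k
    | some l =>
      obtain ⟨k, rfl⟩ : ∃ k', k = k' + 1 := ⟨k - 1, by omega⟩
      exact ih (h.of_some hl).2.2 hj (by omega)

/-- The criterion for a strand to be an end-admissible word, in terms of the one-sided words at
a position `p`. -/
theorem isEndWord_of_rays (hD : D.IsClannish) {w : D.Word} {p : ℤ} (hp : p ∈ w.shape.index)
    (hl : ∀ i, (w.letter i).isSome ↔ i ∈ w.shape.index ∧ i - 1 ∈ w.shape.index)
    (hvp : (w.vertex p).isSome)
    (hv : ∀ i, p < i → w.vertex i = (w.letter i).map Letter.tail)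
    (hv' : ∀ i < p, w.vertex i = (w.letter (i + 1)).map Letter.head)
    (hs : w.sign = S.sgnAt w 0) (hb : S.IsRay (w.vertex p) (-S.sgnAt w p) (before w p))
    (ha : S.IsRay (w.vertex p) (S.sgnAt w p) (after w p)) : S.IsEndWord w := by
  have hex : ∀ {i}, i ∈ w.shape.index → i - 1 ∈ w.shape.index → ∃ l, w.letter i = some l :=
    fun h h' => Option.isSome_iff_exists.mp ((hl _).mpr ⟨h, h'⟩)
  have hmem : ∀ {i l}, w.letter i = some l → i ∈ w.shape.index ∧ i - 1 ∈ w.shape.index :=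
    fun h => (hl _).mp (by rw [h]; rfl)
  have hright : ∀ k : ℕ, p + k ∈ w.shape.index →
      S.IsRay (w.vertex (p + k)) (S.sgnAt w (p + k)) (after w (p + k)) ∧
      ∀ l, w.letter (p + k) = some l → S.sgnAt w (p + k) = -S.sgn l.inverse := by
    intro k
    induction k with
    | zero =>
      intro _
      rw [Nat.cast_zero, add_zero]
      refine ⟨ha, fun l h => ?_⟩
      have := (hb.of_some (before_zero_of_some h)).2.1
      rw [← this, neg_neg]
    | succ k ih =>
      intro hk
      have hk' : p + (k : ℤ) ∈ w.shape.index :=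
        index_ordConnected _ hp hk (by omega) (by push_cast; omega)
      rw [Nat.cast_succ, ← add_assoc] at hk ⊢
      obtain ⟨l, h1⟩ := hex hk (by rwa [add_sub_cancel_right])
      have h2 : after w (p + k) 0 = some l := by rw [after, Nat.cast_zero, add_zero, h1]
      obtain ⟨-, -, h3⟩ := (ih hk').1.of_some h2
      have h4 := after_succ w (p + k + 1)
      rw [add_sub_cancel_right] at h4
      rw [h4] at h3
      have h5 : S.sgnAt w (p + k + 1) = -S.sgn l.inverse := by
        cases h6 : w.letter (p + k + 1 + 1) with
        | none => exact sgnAt_of_none h6 h1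
        | some l' =>
          rw [sgnAt_of_some h6]
          exact (h3.of_some (l := l') (by rw [after, Nat.cast_zero, add_zero, h6])).2.1.symm
      refine ⟨?_, fun l' h6 => ?_⟩
      · rw [hv _ (by omega), h1, h5]
        exact h3
      · rw [h1, Option.some.injEq] at h6
        rw [h5, h6]
  have hleft : ∀ k : ℕ, p - k ∈ w.shape.index →
      S.IsRay (w.vertex (p - k)) (-S.sgnAt w (p - k)) (before w (p - k)) ∧
      ∀ l, w.letter (p - k + 1) = some l → w.vertex (p - k) = some l.head := by
    intro k
    induction k with
    | zero =>
      intro _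
      rw [Nat.cast_zero, sub_zero]
      refine ⟨hb, fun l h => ?_⟩
      exact (ha.of_some (l := l) (by rw [after, Nat.cast_zero, add_zero, h])).1
    | succ k ih =>
      intro hk
      have hk' : p - (k : ℤ) ∈ w.shape.index :=
        index_ordConnected _ hk hp (by push_cast; omega) (by omega)
      rw [Nat.cast_succ, ← sub_sub] at hk ⊢
      obtain ⟨l, h1⟩ := hex hk' hk
      obtain ⟨-, -, h3⟩ := (ih hk').1.of_some (before_zero_of_some h1)
      have h4 : w.vertex (p - k - 1) = some l.head := by
        rw [hv' _ (by omega), sub_add_cancel, h1, Option.map_some]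
      rw [before_succ, Letter.tail_inverse l hD, Letter.inverse_inverse] at h3
      refine ⟨?_, fun l' h6 => ?_⟩
      · rw [h4, sgnAt_of_some (l := l) (by rw [sub_add_cancel, h1])]
        exact h3
      · rw [sub_add_cancel, h1, Option.some.injEq] at h6
        rw [h4, h6]
  have hR : ∀ {i}, p ≤ i → i ∈ w.shape.index → S.IsRay (w.vertex i) (S.sgnAt w i) (after w i) ∧
      ∀ l, w.letter i = some l → S.sgnAt w i = -S.sgn l.inverse := by
    intro i h1 h2
    obtain ⟨k, rfl⟩ : ∃ k : ℕ, i = p + k := ⟨(i - p).toNat, by omega⟩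
    exact hright k h2
  have hL : ∀ {i}, i ≤ p → i ∈ w.shape.index →
      S.IsRay (w.vertex i) (-S.sgnAt w i) (before w i) ∧
      ∀ l, w.letter (i + 1) = some l → w.vertex i = some l.head := by
    intro i h1 h2
    obtain ⟨k, rfl⟩ : ∃ k : ℕ, i = p - k := ⟨(p - i).toNat, by omega⟩
    exact hleft k h2
  have hcons : ∀ i l, w.letter i = some l → S.sgnAt w i = -S.sgn l.inverse := by
    intro i l h
    rcases le_total p i with h1 | h1
    · exact (hR h1 (hmem h).1).2 l h
    · rw [← ((hL h1 (hmem h).1).1.of_some (before_zero_of_some h)).2.1, neg_neg]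
  have hword : S.IsWord w := by
    refine ⟨hl, fun i => ?_, fun i l h => ?_, fun i l h => ?_, fun i l h l' h' => ?_,
      fun l h => ?_, fun l h => ?_⟩
    · rcases lt_trichotomy p i with h | rfl | h
      · rw [hv i h, Option.isSome_map, hl]
        exact ⟨fun h1 => h1.1, fun h1 =>
          ⟨h1, index_ordConnected _ hp h1 (by omega) (by omega)⟩⟩
      · exact ⟨fun _ => hp, fun _ => hvp⟩
      · rw [hv' i h, Option.isSome_map, hl, add_sub_cancel_right]
        exact ⟨fun h1 => h1.2, fun h1 =>
          ⟨index_ordConnected _ h1 hp (by omega) (by omega), h1⟩⟩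
    · rcases le_or_gt p (i - 1) with h1 | h1
      · exact ((hR h1 (hmem h).2).1.of_some (l := l) (by rw [after_zero]; exact h)).1
      · exact (hL h1.le (hmem h).2).2 l (by rw [sub_add_cancel]; exact h)
    · rcases lt_or_ge p i with h1 | h1
      · rw [hv i h1, Option.mem_def.mp h, Option.map_some]
      · rw [((hL h1 (hmem h).1).1.of_some (before_zero_of_some h)).1, Letter.head_inverse l hD]
    · rw [← hcons i l h, sgnAt_of_some h']
    · rw [hs, sgnAt_of_some (l := l) (by rw [zero_add]; exact h)]
    · rw [hs, hcons 0 l h, neg_neg]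
  refine ⟨hword, fun i hi hi' => ?_, fun i hi hi' => ?_⟩
  · have h1 : p ≤ i := by
      by_contra h
      exact hi' (index_ordConnected _ hi hp (by omega) (by omega))
    refine ((hR h1 hi).1.of_none ?_).2
    rw [after, Nat.cast_zero, add_zero, hword.letter_eq_none_iff]
    exact fun h => hi' h.1
  · have h1 : i ≤ p := by
      by_contra h
      exact hi' (index_ordConnected _ hp hi (by omega) (by omega))
    refine ((hL h1 hi).1.of_none ?_).2
    rw [before_zero, hword.letter_eq_none_iff.mpr fun h => hi' h.2]
    rfl

variable (S) in
/-- The strand with the one-sided words `x` and `y` at the position `p`, where the vertex is `v`. -/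
def joint (s : SCShape) (p : ℤ) (v : V) (ε : ℤˣ) (x y : ℕ → Option D.Letter) : D.Word :=
  let l : ℤ → Option D.Letter := fun i =>
    if p < i then y (i - p - 1).toNat else (x (p - i).toNat).map Letter.inverse
  { shape := s
    letter := l
    vertex := fun i => if p < i then (l i).map Letter.tail else
      if i < p then (l (i + 1)).map Letter.head else some v
    sign := match l 1 with
      | some a => S.sgn a
      | none => match l 0 with
        | some a => -S.sgn a.inverse
        | none => ε }

variable {s : SCShape} {p : ℤ} {v : V} {ε : ℤˣ} {x y : ℕ → Option D.Letter}

theorem joint_letter_of_lt {i : ℤ} (h : p < i) :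
    (S.joint s p v ε x y).letter i = y (i - p - 1).toNat := if_pos h

theorem joint_letter_of_le {i : ℤ} (h : i ≤ p) :
    (S.joint s p v ε x y).letter i = (x (p - i).toNat).map Letter.inverse :=
  if_neg (not_lt.mpr h)

theorem after_joint : after (S.joint s p v ε x y) p = y := by
  funext j
  rw [after, joint_letter_of_lt (by omega)]
  congr 1
  omega

theorem before_joint : before (S.joint s p v ε x y) p = x := by
  funext j
  rw [before, joint_letter_of_le (by omega), Option.map_map]
  have : Letter.inverse ∘ Letter.inverse = (id : D.Letter → D.Letter) :=
    funext Letter.inverse_inverse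
  rw [this, Option.map_id_fun, id]
  congr 1
  omega

theorem joint_vertex : (S.joint s p v ε x y).vertex p = some v := by
  simp [joint]

theorem joint_vertex_of_lt {i : ℤ} (h : p < i) :
    (S.joint s p v ε x y).vertex i = ((S.joint s p v ε x y).letter i).map Letter.tail := if_pos h

theorem joint_vertex_of_gt {i : ℤ} (h : i < p) :
    (S.joint s p v ε x y).vertex i = ((S.joint s p v ε x y).letter (i + 1)).map Letter.head :=
  (if_neg (by omega)).trans (if_pos h)

theorem joint_sign : (S.joint s p v ε x y).sign = S.sgnAt (S.joint s p v ε x y) 0 := by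
  unfold sgnAt
  rw [zero_add]
  change (match (S.joint s p v ε x y).letter 1 with
      | some a => S.sgn a
      | none => match (S.joint s p v ε x y).letter 0 with
        | some a => -S.sgn a.inverse
        | none => ε) = _
  cases h1 : (S.joint s p v ε x y).letter 1 with
  | some l => rfl
  | none =>
    cases h0 : (S.joint s p v ε x y).letter 0 with
    | some l => rfl
    | none =>
      change _ = (match (S.joint s p v ε x y).letter 1 with
      | some a => S.sgn a
      | none => match (S.joint s p v ε x y).letter 0 with
        | some a => -S.sgn a.inverse
        | none => ε)
      rw [h1, h0]

/-- Some letter next to p normally fixes the sign. If both rays are empty the stored sign is used,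
and it equals ε because the position is then required to be 0. -/
theorem joint_sgnAt (hx : S.IsRay (some v) (-ε) x) (hy : S.IsRay (some v) ε y)
    (hp : x 0 = none → y 0 = none → p = 0) : S.sgnAt (S.joint s p v ε x y) p = ε := by
  have h1 : (S.joint s p v ε x y).letter (p + 1) = y 0 := by
    rw [joint_letter_of_lt (by omega)]
    congr 1
    omega
  have h2 : (S.joint s p v ε x y).letter p = (x 0).map Letter.inverse := by
    rw [joint_letter_of_le le_rfl, sub_self, Int.toNat_zero]
  cases hy0 : y 0 with
  | some l =>
    rw [sgnAt_of_some (h1.trans hy0)]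
    exact (hy.of_some hy0).2.1.symm
  | none =>
    cases hx0 : x 0 with
    | some l =>
      rw [hx0, Option.map_some] at h2
      rw [sgnAt_of_none (h1.trans hy0) h2, Letter.inverse_inverse, ← (hx.of_some hx0).2.1, neg_neg]
    | none =>
      rw [hx0, Option.map_none] at h2
      have hp' := hp hx0 hy0
      rw [sgnAt_of_none_none (h1.trans hy0) h2]
      rw [hy0] at h1
      subst hp'
      change (match (S.joint s 0 v ε x y).letter 1 with
        | some a => S.sgn a
        | none => match (S.joint s 0 v ε x y).letter 0 with
          | some a => -S.sgn a.inverse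
          | none => ε) = _
      rw [zero_add] at h1
      rw [h1, h2]

/-- The last two hypotheses say that the lengths of the two rays fit the index set. -/
theorem isEndWord_joint (hD : D.IsClannish) (hx : S.IsRay (some v) (-ε) x)
    (hy : S.IsRay (some v) ε y) (hp : p ∈ s.index) (hp' : x 0 = none → y 0 = none → p = 0)
    (hxs : ∀ k : ℕ, (x k).isSome ↔ p - k - 1 ∈ s.index)
    (hys : ∀ k : ℕ, (y k).isSome ↔ p + k + 1 ∈ s.index) : S.IsEndWord (S.joint s p v ε x y) := by
  refine isEndWord_of_rays hD (p := p) hp (fun i => ?_) (by rw [joint_vertex]; rfl)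
    (fun i h => joint_vertex_of_lt h) (fun i h => joint_vertex_of_gt h) joint_sign ?_ ?_
  · change _ ↔ i ∈ s.index ∧ i - 1 ∈ s.index
    rcases lt_or_ge p i with h | h
    · rw [joint_letter_of_lt h, hys, show p + ((i - p - 1).toNat : ℤ) + 1 = i by omega]
      exact ⟨fun h1 => ⟨h1, index_ordConnected _ hp h1 (by omega) (by omega)⟩, fun h1 => h1.1⟩
    · rw [joint_letter_of_le h, Option.isSome_map, hxs,
        show p - ((p - i).toNat : ℤ) - 1 = i - 1 by omega]
      exact ⟨fun h1 => ⟨index_ordConnected _ h1 hp (by omega) (by omega), h1⟩, fun h1 => h1.2⟩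
  · rwa [joint_vertex, joint_sgnAt hx hy hp', before_joint]
  · rwa [joint_vertex, joint_sgnAt hx hy hp', after_joint]

end Joint

/-! ### The words given by non-zero subquotients -/

section Point

variable {K V A : Type*} [DivisionRing K] [Fintype V] {D : SCData K V A} {S : D.SignChoice}
  {M : Type*} [AddCommGroup M] [Module K M] [Module D.Alg M] [IsScalarTower K D.Alg M]

variable (S M) in
/-- The rays `x` and `y` have opposite signs and `(x^+ ∩ y^+) / (x^+ ∩ y^- + x^- ∩ y^+)` is
non-zero. -/
structure IsPoint (o : Option V) (ε : ℤˣ) (x y : ℕ → Option D.Letter) : Prop where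
  left : S.IsRay o (-ε) x
  right : S.IsRay o ε y
  not_le : ¬ S.num M o ε x y ≤ S.den M o ε x y

theorem IsPoint.swap {o : Option V} {ε : ℤˣ} {x y : ℕ → Option D.Letter}
    (h : S.IsPoint M o ε x y) : S.IsPoint M o (-ε) y x := by
  refine ⟨by rw [neg_neg]; exact h.right, h.left, ?_⟩
  rw [num_swap, den_swap]
  exact h.not_le

theorem mem_points {v : V} {x y : ℕ → Option D.Letter} :
    (⟨v, x, y⟩ : Σ _ : V, (ℕ → Option D.Letter) × (ℕ → Option D.Letter)) ∈ S.points M ↔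
      S.IsPoint M (some v) 1 x y :=
  ⟨fun h => ⟨h.1, h.2.1, h.2.2⟩, fun h => ⟨h.1, h.2, h.3⟩⟩

/-- Two rays on the two sides of a letter fit together. -/
theorem exists_isStep (hD : D.IsClannish) {l : D.Letter} {x y : ℕ → Option D.Letter}
    (hx : S.IsRay (some l.head) (-S.sgn l) x) (hy : S.IsRay (some l.tail) (-S.sgn l.inverse) y) :
    ∃ c, IsStep c l (S.minusInf M (some l.head) (-S.sgn l) x)
      (S.plusInf M (some l.head) (-S.sgn l) x)
      (S.minusInf M (some l.tail) (-S.sgn l.inverse) y)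
      (S.plusInf M (some l.tail) (-S.sgn l.inverse) y) := by
  suffices ∃ c, Compat (S.minusInf M (some l.head) (-S.sgn l) x)
      (S.plusInf M (some l.head) (-S.sgn l) x)
      (S.minusInf M (some l.tail) (-S.sgn l.inverse) y)
      (S.plusInf M (some l.tail) (-S.sgn l.inverse) y) c l by
    obtain ⟨c, hc⟩ := this
    exact ⟨c, hc, minusInf_le_plusInf hx, minusInf_le_plusInf hy, plusInf_le_vertexSpace,
      plusInf_le_vertexSpace⟩
  cases l with
  | dir a ha => exact ⟨_, .dir a ha⟩
  | inv a ha => exact ⟨_, .inv a ha⟩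
  | star s hs =>
    have h1 : (Letter.star s hs).head = (Letter.star s hs).tail := hD.special_loop s hs
    have h2 : (Letter.star s hs).inverse = Letter.star s hs := rfl
    rw [h2] at hy ⊢
    rw [h1] at hx ⊢
    rcases hx.trichotomy hy with h3 | h3 | h3
    · rw [h3]
      exact ⟨_, .star_inv s hs le_rfl (.inr rfl)⟩
    · have h4 := plusInf_le_minusInf (M := M) hx hy h3
      exact ⟨_, .star_inv s hs (h4.trans (minusInf_le_plusInf hy)) (.inl h4)⟩
    · have h4 := plusInf_le_minusInf (M := M) hy hx h3
      exact ⟨_, .star_dir s hs (h4.trans (minusInf_le_plusInf hx)) (.inl h4)⟩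

variable [Module.Finite K M]

/-- Moving a point along a letter. -/
theorem IsPoint.step (hns : D.IsNonSingularType) (hD : D.IsClannish) {o : Option V} {ε : ℤˣ}
    {x y x' y' : ℕ → Option D.Letter} (h : S.IsPoint M o ε x y) {l : D.Letter}
    (hl : y 0 = some l) (hy' : (fun j => y (j + 1)) = y') (hl' : x' 0 = some l.inverse)
    (hx' : (fun j => x' (j + 1)) = x) :
    S.IsPoint M (some l.tail) (-S.sgn l.inverse) x' y' := by
  obtain ⟨hx, hy, hne⟩ := h
  obtain ⟨rfl, rfl, h1⟩ := hy.of_some hl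
  rw [hy'] at h1
  have h2 : S.IsRay (some l.tail) (S.sgn l.inverse) x' := by
    rw [← Letter.head_inverse l hD]
    refine IsRay.cons hl' hx' ?_
    rwa [Letter.tail_inverse l hD, Letter.inverse_inverse]
  refine ⟨by rwa [neg_neg], h1, fun hle => hne fun m hm => ?_⟩
  obtain ⟨c, hc⟩ := exists_isStep (M := M) hD hx h1
  have e1 := plusInf_of_some (M := M) hy hl
  have e2 := minusInf_of_some (M := M) hy hl
  have e3 := plusInf_of_some (M := M) h2 hl'
  have e4 := minusInf_of_some (M := M) h2 hl'
  rw [hy'] at e1 e2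
  rw [hx', Letter.tail_inverse l hD, Letter.inverse_inverse] at e3 e4
  rw [num, e1] at hm
  rw [den, e1, e2]
  -- If the subquotient after the letter vanished, the partner m' of any m in num would lie in den,
  -- and pulling back across the letter would put m in den.
  obtain ⟨m', hm', hr⟩ := hc.lift_right hns hD hm
  refine hc.den_left hns hD hr hm ?_
  have h5 := hle (x := m')
  rw [num, den, neg_neg, e3, e4] at h5
  exact h5 hm'

end Point

/-! ### Words carrying a point are strings or bands -/

section Admissible

variable {K V A : Type*} [DivisionRing K] [Fintype V] {D : SCData K V A} {S : D.SignChoice}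
  {M : Type*} [AddCommGroup M] [Module K M] [Module D.Alg M] [IsScalarTower K D.Alg M]
  {w : D.Word} {i : ℤ}

/-- Direct letters and *-letters both act by images, so reading r^* amounts to taking the image of
the path r. -/
theorem IsWord.exists_smul_of_mem_rightPlus (hw : S.IsWord w) (r : List A) {i : ℤ}
    (hr : ∀ (j : ℕ) (h : j < r.length), w.letter (i + 1 + j) = some (Letter.ofArrow D r[j]))
    {m : M} (hm : m ∈ S.rightPlus M w r.length i) : ∃ u : M, m = (r.map D.arr).prod • u := by
  induction r generalizing i m with
  | nil => exact ⟨m, by simp⟩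
  | cons a r ih =>
    have h0 := hr 0 (by simp)
    rw [Nat.cast_zero, add_zero, List.getElem_cons_zero] at h0
    have h1 := hw.rightPlus_succ (M := M) h0 r.length
    rw [add_sub_cancel_right] at h1
    rw [List.length_cons, h1] at hm
    obtain ⟨u, hu, hmu⟩ : ∃ u ∈ S.rightPlus M w r.length (i + 1), D.arr a • u = m := by
      by_cases ha : a ∈ D.special
      · rw [ofArrow_of_mem ha] at hm
        exact hm
      · rw [ofArrow_of_notMem ha] at hm
        exact hm
    obtain ⟨u', rfl⟩ := ih (fun j hj => by
      have := hr (j + 1) (by simpa using hj)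
      rwa [List.getElem_cons_succ, Nat.cast_succ, add_comm (j : ℤ), ← add_assoc] at this) hu
    exact ⟨u', by rw [List.map_cons, List.prod_cons, mul_smul, hmu]⟩

theorem IsEndWord.inv (hD : D.IsClannish) (hw : S.IsEndWord w) : S.IsEndWord (S.inv w) := by
  refine ⟨hw.toIsWord.inv hD, fun i hi hi' => ?_, fun i hi hi' => ?_⟩
  · rw [inv_shape] at hi hi'
    rw [inv_vertex, hw.sgnAt_inv hi]
    refine hw.noStar_left _ (center_sub_mem_index.mpr hi) ?_
    rwa [show center w - i - 1 = center w - (i + 1) by ring, center_sub_mem_index]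
  · rw [inv_shape] at hi hi'
    rw [inv_vertex, hw.sgnAt_inv hi, neg_neg]
    refine hw.noStar_right _ (center_sub_mem_index.mpr hi) ?_
    rwa [show center w - i + 1 = center w - (i - 1) by ring, center_sub_mem_index]

variable [Module.Finite K M]

variable (S M) in
/-- The subquotient for the position `i` of `w` is non-zero. -/
def IsPointAt (w : D.Word) (i : ℤ) : Prop :=
  S.IsPoint M (w.vertex i) (S.sgnAt w i) (before w i) (after w i)

theorem IsEndWord.isPointAt_iff (hns : D.IsNonSingularType) (hD : D.IsClannish)
    (hw : S.IsEndWord w) (hi : i ∈ w.shape.index) (T : D.Twist (D.canonicalWalk w)) :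
    S.IsPointAt M w i ↔ ¬ Subsingleton (S.F T M) := by
  have h1 := hw.finrank_F (T := T) (M := M) hns hD hi
  have h2 := hw.finite_F (T := T) (M := M) hns hD
  have hx := hw.isRay_before hD hi
  have hy := hw.isRay_after hi
  have h3 : S.denAt M w i ≤ S.numAt M w i := den_le_num hx hy
  rw [← Module.finrank_zero_iff (R := K), h1]
  constructor
  · intro h h0
    refine h.not_le (Submodule.eq_of_le_of_finrank_le h3 ?_).ge
    exact Nat.sub_eq_zero_iff_le.mp h0
  · exact fun h => ⟨hx, hy, fun hle => h (mult_eq_zero hle)⟩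

/-- The subquotients at all positions of w vanish or not together, being isomorphic to the same
F_C(M) up to semilinearity. -/
theorem IsEndWord.isPointAt_of_isPointAt (hns : D.IsNonSingularType) (hD : D.IsClannish)
    (hw : S.IsEndWord w) {j : ℤ} (hi : i ∈ w.shape.index) (hj : j ∈ w.shape.index)
    (h : S.IsPointAt M w i) : S.IsPointAt M w j := by
  obtain ⟨T, -⟩ := Twist.exists_zero_eq_one D (D.canonicalWalk w)
  rwa [hw.isPointAt_iff hns hD hj T, ← hw.isPointAt_iff hns hD hi T]

theorem isPointAt_inv (hw : S.IsWord w) (hi : i ∈ w.shape.index) (h : S.IsPointAt M w i) :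
    S.IsPointAt M (S.inv w) (center w - i) := by
  obtain ⟨h1, h2, h3, h4⟩ := agree_swap hw hi
  rw [IsPointAt, h1, h2, h3, h4]
  exact h.swap

/-- If `w` contains a zero relation, then its subquotients are zero. -/
theorem IsEndWord.not_contains (hns : D.IsNonSingularType) (hD : D.IsClannish)
    (hw : S.IsEndWord w) (hi : i ∈ w.shape.index) (h : S.IsPointAt M w i) {r : List A}
    (hr : r ∈ D.Z) : ¬ Contains w r := by
  rintro ⟨k, hk⟩
  match r, hD.zero_head r hr with
  | [], _ => exact absurd (hD.zero_length _ hr) (by simp)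
  | a :: r, hhead =>
    have ha : a ∉ D.special := hhead a rfl
    have h0 := hk 0 (by simp)
    rw [Nat.cast_zero, add_zero, List.getElem_cons_zero, ofArrow_of_notMem ha] at h0
    -- Look just after the first arrow a of the zero relation. The elements of num there are values
    -- of the remaining path, hence killed by a, hence in a⁻¹0, which is part of the smaller
    -- subspace on the left.
    refine (hw.isPointAt_of_isPointAt hns hD hi (hw.mem_index h0).1 h).not_le
      (num_le_den_of_left fun m hm => ?_)
    obtain ⟨u, rfl⟩ := hw.exists_smul_of_mem_rightPlus r (i := k) (fun j hj => by
      have := hk (j + 1) (by simpa using hj)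
      rwa [List.getElem_cons_succ, Nat.cast_succ, add_comm (j : ℤ), ← add_assoc] at this)
      (plusInf_le _ _ _ _ hm.2)
    refine le_minusInf 1 _ _ _ ?_
    change _ ∈ S.leftMinus M w 1 k
    rw [hw.leftMinus_succ hD h0]
    refine ⟨?_, ?_⟩
    · have := plusInf_le 0 _ _ _ hm.1
      rw [hw.vertex_right h0] at this
      exact this
    · rw [SetLike.mem_coe, Submodule.mem_comap, arrMap_apply, ← mul_smul, ← List.prod_cons,
        ← List.map_cons, prod_arr_eq_zero D hr, zero_smul]
      exact zero_mem _

theorem IsEndWord.isRelationAdmissible (hns : D.IsNonSingularType) (hD : D.IsClannish)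
    (hw : S.IsEndWord w) (hi : i ∈ w.shape.index) (h : S.IsPointAt M w i) :
    S.IsRelationAdmissible w := fun r hr =>
  ⟨hw.not_contains hns hD hi h hr, (hw.inv hD).not_contains hns hD
    (by rw [inv_shape]; exact center_sub_mem_index.mpr hi)
    (isPointAt_inv hw.toIsWord hi h) hr⟩

/-- Along an infinite ray of a point, two of the points agree. -/
theorem IsPoint.exists_agree (hns : D.IsNonSingularType) (hD : D.IsClannish) {v : V} {ε : ℤˣ}
    {x y : ℕ → Option D.Letter} (h : S.IsPoint M (some v) ε x y) (hy : ∀ k, (y k).isSome) :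
    ∃ j k : ℕ, j < k ∧ S.Agree (S.joint .full 0 v ε x y) j (S.joint .full 0 v ε x y) k := by
  -- The index set is taken to be ℤ although x might be finite, so w need not be a word; only the
  -- positions to the right of 0 are used as points.
  set w := S.joint .full 0 v ε x y with hw
  have hl : ∀ k : ℕ, w.letter (k + 1) = y k := fun k => by
    rw [hw, joint_letter_of_lt (by omega)]
    congr 1
    omega
  have hpt : ∀ k : ℕ, S.IsPointAt M w k := by
    intro k
    induction k with
    | zero =>
      have h1 : S.sgnAt w (0 : ℕ) = ε := joint_sgnAt h.left h.right fun _ _ => rfl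
      have h2 : w.vertex (0 : ℕ) = some v := joint_vertex
      have h3 : before w (0 : ℕ) = x := before_joint
      have h4 : after w (0 : ℕ) = y := after_joint
      rw [IsPointAt, h1, h2, h3, h4]
      exact h
    | succ k ih =>
      obtain ⟨l, h1⟩ := Option.isSome_iff_exists.mp (hy k)
      obtain ⟨l', h2⟩ := Option.isSome_iff_exists.mp (hy (k + 1))
      have h3 : w.letter ((k + 1 : ℕ) : ℤ) = some l := by rw [Nat.cast_succ, hl, h1]
      have h4 : w.letter ((k + 1 : ℕ) + 1 : ℤ) = some l' := by rw [hl, h2]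
      have h5 : ((k + 1 : ℕ) : ℤ) - 1 = k := by push_cast; ring
      have h6 := after_succ w ((k + 1 : ℕ) : ℤ)
      have h7 := before_succ w ((k + 1 : ℕ) : ℤ)
      have h8 := after_zero w ((k + 1 : ℕ) : ℤ)
      rw [h5] at h6 h7 h8
      have h9 := ih.step hns hD (h8.trans h3) h6 (before_zero_of_some h3) h7
      have h10 := (h9.right.of_some (l := l') (by
        rw [after, Nat.cast_zero, add_zero, h4])).2.1
      have h11 : w.vertex ((k + 1 : ℕ) : ℤ) = some l.tail := by
        rw [hw, joint_vertex_of_lt (by omega), ← hw, h3, Option.map_some]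
      rw [IsPointAt, sgnAt_of_some h4, h11, ← h10]
      exact h9
  let F : ℕ → Option V × ℤˣ × (ℕ → Option D.Letter) × (ℕ → Option D.Letter) := fun k =>
    (w.vertex k, S.sgnAt w k, before w k, after w k)
  have hfin : (Set.range F).Finite := by
    refine (((S.points_finite (M := M) hns).image fun p => (some p.1, (1 : ℤˣ), p.2.1, p.2.2)).union
      ((S.points_finite (M := M) hns).image
        fun p => (some p.1, (-1 : ℤˣ), p.2.2, p.2.1))).subset ?_
    rintro _ ⟨k, rfl⟩
    obtain ⟨u, hu⟩ : ∃ u, w.vertex k = some u := by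
      cases k with
      | zero => exact ⟨v, joint_vertex⟩
      | succ k =>
        obtain ⟨l, h1⟩ := Option.isSome_iff_exists.mp (hy k)
        refine ⟨l.tail, ?_⟩
        rw [hw, joint_vertex_of_lt (by omega), ← hw, Nat.cast_succ, hl, h1, Option.map_some]
    have h1 := hpt k
    rw [IsPointAt, hu] at h1
    rcases Int.units_eq_one_or (S.sgnAt w k) with h2 | h2
    · refine .inl ⟨⟨u, before w k, after w k⟩, mem_points.mpr (h2 ▸ h1), ?_⟩
      simp only [F, hu, h2]
    · refine .inr ⟨⟨u, after w k, before w k⟩, mem_points.mpr ?_, ?_⟩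
      · have := h1.swap
        rwa [h2, neg_neg] at this
      · simp only [F, hu, h2]
  -- Only finitely many points exist, so the infinitely many positions on the ray cannot give
  -- distinct ones.
  have hninj : ¬ Function.Injective F := fun hinj =>
    Set.infinite_range_of_injective hinj hfin
  obtain ⟨j, k, hjk, hne⟩ := Function.not_injective_iff.mp hninj
  simp only [F, Prod.mk.injEq] at hjk
  have key : S.Agree w j w k := ⟨hjk.1, hjk.2.1, hjk.2.2.1, hjk.2.2.2⟩
  rcases lt_or_gt_of_ne hne with h1 | h1
  · exact ⟨j, k, h1, key⟩
  · exact ⟨k, j, h1, key.symm⟩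

/-- Two positions j < k on the infinite side agree, so the ray back from k would have to end at the
same distance as the ray back from j. That is impossible if the left side is finite. -/
theorem IsPoint.isSome_left (hns : D.IsNonSingularType) (hD : D.IsClannish) {v : V} {ε : ℤˣ}
    {x y : ℕ → Option D.Letter} (h : S.IsPoint M (some v) ε x y) (hy : ∀ k, (y k).isSome)
    (k : ℕ) : (x k).isSome := by
  by_contra hk
  have hex : ∃ k, x k = none := ⟨k, Option.not_isSome_iff_eq_none.mp hk⟩
  classical
  have h1 := Nat.find_spec hex
  have h2 := fun k => Nat.find_min (m := k) hex
  generalize Nat.find hex = p at h1 h2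
  obtain ⟨j, k, hjk, hagree⟩ := h.exists_agree hns hD hy
  have h3 := hagree.letter (-(p + j))
  rw [joint_letter_of_le (by omega), show (0 - ((j : ℤ) + -(p + j))).toNat = p by omega, h1,
    Option.map_none] at h3
  rcases lt_or_ge (0 : ℤ) (k + -(p + j)) with h4 | h4
  · rw [joint_letter_of_lt h4] at h3
    have := hy ((k : ℤ) + -(p + j) - 0 - 1).toNat
    rw [← h3] at this
    cases this
  · rw [joint_letter_of_le h4, eq_comm, Option.map_eq_none_iff] at h3
    exact h2 _ (by omega) h3

/-- Every point arises from a string or a band. -/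
theorem IsPoint.exists_string_or_band (hns : D.IsNonSingularType) (hD : D.IsClannish) {v : V}
    {x y : ℕ → Option D.Letter} (h : S.IsPoint M (some v) 1 x y) :
    ∃ w, (S.IsString w ∨ S.IsBand w) ∧ ∃ i ∈ w.shape.index, w.vertex i = some v ∧
      S.sgnAt w i = 1 ∧ before w i = x ∧ after w i = y := by
  have key : ∀ (s : SCShape) (p : ℤ), p ∈ s.index → (x 0 = none → y 0 = none → p = 0) →
      S.IsPointAt M (S.joint s p v 1 x y) p := by
    intro s p hp hp'
    rw [IsPointAt, joint_vertex, joint_sgnAt h.left h.right hp', before_joint, after_joint]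
    exact h
  by_cases hy : ∀ k, (y k).isSome
  · have hx := h.isSome_left hns hD hy
    have hp' : x 0 = none → y 0 = none → (0 : ℤ) = 0 := fun _ _ => rfl
    have hw := isEndWord_joint hD (s := .full) (p := 0) h.left h.right trivial hp'
      (fun k => ⟨fun _ => trivial, fun _ => hx k⟩) (fun k => ⟨fun _ => trivial, fun _ => hy k⟩)
    refine ⟨_, .inr ⟨hw.toIsWord, rfl, ?_,
      hw.isRelationAdmissible (M := M) hns hD (i := 0) trivial (key _ _ trivial hp')⟩,
      0, trivial, joint_vertex, joint_sgnAt h.left h.right hp', before_joint, after_joint⟩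
    -- Agreement of the positions j and k makes k - j a period of the whole two-sided word.
    obtain ⟨j, k, hjk, hagree⟩ := h.exists_agree hns hD hy
    refine ⟨k - j, by omega, ?_⟩
    have := (hagree.eq_shift hw.toIsWord hw.toIsWord trivial trivial).1
    rw [Nat.cast_sub hjk.le]
    exact this.symm
  · have hx : ¬ ∀ k, (x k).isSome := fun hx => hy (h.swap.isSome_left hns hD hx)
    have hlen : ∀ {o ε} {z : ℕ → Option D.Letter}, S.IsRay o ε z → (¬ ∀ k, (z k).isSome) →
        ∃ n : ℕ, ∀ k, (z k).isSome ↔ k < n := by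
      intro o ε z hz hz'
      have hex : ∃ k, z k = none := by simpa using hz'
      classical
      refine ⟨Nat.find hex, fun k => ⟨fun hk => ?_, fun hk => ?_⟩⟩
      · by_contra hk'
        rw [hz.eq_none (Nat.find_spec hex) (not_lt.mp hk')] at hk
        cases hk
      · exact Option.isSome_iff_ne_none.mpr (Nat.find_min hex hk)
    obtain ⟨p, hp⟩ := hlen h.left hx
    obtain ⟨q, hq⟩ := hlen h.right hy
    have hp' : x 0 = none → y 0 = none → (p : ℤ) = 0 := fun h1 _ => by
      have := hp 0
      rw [h1] at this
      have h2 : ¬ 0 < p := fun h3 => by simpa using this.mpr h3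
      omega
    -- Rays of lengths p and q form a word of length p + q, marked at position p.
    have hmem : (p : ℤ) ∈ (SCShape.finite (p + q)).index := ⟨by omega, by push_cast; omega⟩
    have hw := isEndWord_joint hD h.left h.right hmem hp'
      (fun k => by
        rw [hp]
        change k < p ↔ 0 ≤ (p : ℤ) - k - 1 ∧ (p : ℤ) - k - 1 ≤ ((p + q : ℕ) : ℤ)
        omega)
      (fun k => by
        rw [hq]
        change k < q ↔ 0 ≤ (p : ℤ) + k + 1 ∧ (p : ℤ) + k + 1 ≤ ((p + q : ℕ) : ℤ)
        omega)
    exact ⟨_, .inl ⟨hw.toIsWord, ⟨_, rfl⟩, (isEndAdmissible_iff hD hw.toIsWord).mpr hw,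
      hw.isRelationAdmissible (M := M) hns hD hmem (key _ _ hmem hp')⟩,
      p, hmem, joint_vertex, joint_sgnAt h.left h.right hp', before_joint, after_joint⟩

end Admissible

/-! ### Positions up to inversion -/

section Positions

variable {K V A : Type*} [DivisionRing K] {D : SCData K V A} {S : D.SignChoice}

variable (S) in
/-- The pair `p` consists of the two one-sided words of `w` at the position `i`, ordered by sign. -/
def IsPair (w : D.Word) (i : ℤ) (p : Σ _ : V, (ℕ → Option D.Letter) × (ℕ → Option D.Letter)) :
    Prop :=
  w.vertex i = some p.1 ∧ ((S.sgnAt w i = 1 ∧ before w i = p.2.1 ∧ after w i = p.2.2) ∨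
    (S.sgnAt w i = -1 ∧ after w i = p.2.1 ∧ before w i = p.2.2))

variable {w w' : D.Word} {i j : ℤ}
  {p q : Σ _ : V, (ℕ → Option D.Letter) × (ℕ → Option D.Letter)}

theorem IsWord.exists_isPair (hw : S.IsWord w) (hi : i ∈ w.shape.index) :
    ∃ p, S.IsPair w i p := by
  obtain ⟨v, hv⟩ := hw.exists_vertex hi
  rcases Int.units_eq_one_or (S.sgnAt w i) with h | h
  · exact ⟨⟨v, before w i, after w i⟩, hv, .inl ⟨h, rfl, rfl⟩⟩
  · exact ⟨⟨v, after w i, before w i⟩, hv, .inr ⟨h, rfl, rfl⟩⟩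

theorem IsPair.agree (h : S.IsPair w i p) (h' : S.Agree w i w' j) : S.IsPair w' j p := by
  unfold IsPair at h ⊢
  rwa [h'.vertex, h'.sgn, h'.before, h'.after] at h

theorem IsPair.inv (h : S.IsPair w i p) (hw : S.IsWord w) (hi : i ∈ w.shape.index) :
    S.IsPair (S.inv w) (center w - i) p := by
  obtain ⟨h1, h2, h3, h4⟩ := agree_swap hw hi
  unfold IsPair
  rw [h1, h2, h3, h4]
  refine ⟨h.1, ?_⟩
  rcases h.2 with ⟨h5, h6, h7⟩ | ⟨h5, h6, h7⟩
  · exact .inr ⟨by rw [h5], h6, h7⟩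
  · exact .inl ⟨by rw [h5, neg_neg], h6, h7⟩

/-- Positions with the same pair agree up to inversion. -/
theorem IsPair.agree_or (h : S.IsPair w i p) (h' : S.IsPair w' j p) (hw : S.IsWord w)
    (hi : i ∈ w.shape.index) :
    S.Agree w i w' j ∨ S.Agree (S.inv w) (center w - i) w' j := by
  have h0 := h.inv hw hi
  obtain ⟨h1, h2⟩ := h
  obtain ⟨h1', h2'⟩ := h'
  obtain ⟨h1'', h2''⟩ := h0
  rcases h2' with ⟨a1, a2, a3⟩ | ⟨a1, a2, a3⟩
  · rcases h2 with ⟨b1, b2, b3⟩ | ⟨b1, b2, b3⟩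
    · exact .inl ⟨h1.trans h1'.symm, b1.trans a1.symm, b2.trans a2.symm, b3.trans a3.symm⟩
    · rcases h2'' with ⟨c1, c2, c3⟩ | ⟨c1, c2, c3⟩
      · exact .inr ⟨h1''.trans h1'.symm, c1.trans a1.symm, c2.trans a2.symm, c3.trans a3.symm⟩
      · rw [(agree_swap hw hi).2.1, b1] at c1
        exact absurd c1 (by decide)
  · rcases h2 with ⟨b1, b2, b3⟩ | ⟨b1, b2, b3⟩
    · rcases h2'' with ⟨c1, c2, c3⟩ | ⟨c1, c2, c3⟩
      · rw [(agree_swap hw hi).2.1, b1] at c1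
        exact absurd c1 (by decide)
      · exact .inr ⟨h1''.trans h1'.symm, c1.trans a1.symm, c3.trans a3.symm, c2.trans a2.symm⟩
    · exact .inl ⟨h1.trans h1'.symm, b1.trans a1.symm, b3.trans a3.symm, b2.trans a2.symm⟩

theorem IsPair.eq (h : S.IsPair w i p) (h' : S.IsPair w i q) : p = q := by
  obtain ⟨v, x, y⟩ := p
  obtain ⟨v', x', y'⟩ := q
  obtain ⟨h1, h2⟩ := h
  obtain ⟨h1', h2'⟩ := h'
  obtain rfl : v = v' := Option.some.inj (h1.symm.trans h1')
  rcases h2 with ⟨b1, rfl, rfl⟩ | ⟨b1, rfl, rfl⟩ <;>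
  rcases h2' with ⟨c1, rfl, rfl⟩ | ⟨c1, rfl, rfl⟩
  · rfl
  · exact absurd (b1.symm.trans c1) (by decide)
  · exact absurd (b1.symm.trans c1) (by decide)
  · rfl

theorem agree_refl (w : D.Word) (i : ℤ) : S.Agree w i w i := ⟨rfl, rfl, rfl, rfl⟩

theorem IsWord.inv_inv (hD : D.IsClannish) (hw : S.IsWord w) : S.inv (S.inv w) = w := by
  have h0 := zero_mem_index w.shape
  have h0' := center_sub_mem_index.mpr h0
  have hw' := hw.inv hD
  have hc : center (S.inv w) = center w := by rw [center, inv_shape, center]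
  obtain ⟨a1, a2, a3, a4⟩ := agree_swap hw h0
  obtain ⟨b1, b2, b3, b4⟩ := agree_swap hw' (i := center w - 0) (by rw [inv_shape]; exact h0')
  rw [hc, sub_sub_cancel] at b1 b2 b3 b4
  have h : S.Agree (S.inv (S.inv w)) 0 w 0 :=
    ⟨b1.trans a1, by rw [b2, a2, neg_neg], b3.trans a4, b4.trans a3⟩
  have h2 := (h.eq_shift (hw'.inv hD) hw (zero_mem_index _) h0).1
  have h3 := ((agree_refl (S := S) w 0).eq_shift hw hw h0 h0).1
  rw [h2, ← h3]

theorem IsWord.exists_agree_shift (hw : S.IsWord w) (hi : i ∈ w.shape.index) (m : ℤ) :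
    ∃ j ∈ (S.shift w m).shape.index, S.Agree w i (S.shift w m) j := by
  rcases hs : w.shape with n | _
  · rw [shift_of_finite hs]
    exact ⟨i, hi, agree_refl w i⟩
  · refine ⟨i - m, by rw [shift_shape, hs]; trivial, ?_⟩
    have := hw.agree_shift hs m (i - m)
    rw [add_sub_cancel] at this
    exact this.symm

/-- Words which are represented by the same pair are equivalent. -/
theorem IsPair.equivalent (hD : D.IsClannish) (h : S.IsPair w i p) (h' : S.IsPair w' j p)
    (hw : S.IsWord w) (hw' : S.IsWord w') (hi : i ∈ w.shape.index) (hj : j ∈ w'.shape.index) :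
    S.Equivalent w w' := by
  rcases h.agree_or h' hw hi with h1 | h1
  · exact ⟨_, .inl (h1.eq_shift hw hw' hi hj).1⟩
  · have hi' : center w - i ∈ (S.inv w).shape.index := by
      rw [inv_shape]
      exact center_sub_mem_index.mpr hi
    have hj' : center w' - j ∈ (S.inv w').shape.index := by
      rw [inv_shape]
      exact center_sub_mem_index.mpr hj
    have hi'' : center (S.inv w) - (center w - i) ∈ w.shape.index := by
      rw [← inv_shape (S := S)]
      exact center_sub_mem_index.mpr hi'
    have h2 := h1.inv (hw.inv hD) hw' hi' hj
    rw [hw.inv_inv hD] at h2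
    exact ⟨_, .inr (h2.eq_shift hw (hw'.inv hD) hi'' hj').1⟩

theorem IsRepresentatives.eq_of_equivalent {Ω : Set D.Word} (hΩ : S.IsRepresentatives Ω)
    (hw : w ∈ Ω) (hw' : w' ∈ Ω) (hword : S.IsWord w') (h : S.Equivalent w w') : w = w' := by
  have h0 := zero_mem_index w'.shape
  have h1 := ((agree_refl (S := S) w' 0).eq_shift hword hword h0 h0).1
  exact (hΩ.unique w' (hΩ.mem w' hw')).unique ⟨hw, h⟩ ⟨hw', _, .inl h1⟩

theorem isWord_of_string_or_band (h : S.IsString w ∨ S.IsBand w) : S.IsWord w :=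
  h.elim (fun h => h.1) fun h => h.1

/-- Pairs of a string or band occur for the representing string or band. -/
theorem IsRepresentatives.exists_isPair (hD : D.IsClannish) {Ω : Set D.Word}
    (hΩ : S.IsRepresentatives Ω) (hw : S.IsString w ∨ S.IsBand w) (hi : i ∈ w.shape.index)
    (h : S.IsPair w i p) : ∃ z ∈ Ω, ∃ j ∈ z.shape.index, S.IsPair z j p := by
  have hword := isWord_of_string_or_band hw
  obtain ⟨z, ⟨hz, m, rfl | rfl⟩, -⟩ := hΩ.unique w hw
  · obtain ⟨j, hj, h1⟩ := hword.exists_agree_shift hi m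
    exact ⟨_, hz, j, hj, h.agree h1⟩
  · obtain ⟨j, hj, h1⟩ := (hword.inv hD).exists_agree_shift (i := center w - i)
      (by rw [inv_shape]; exact center_sub_mem_index.mpr hi) m
    exact ⟨_, hz, j, hj, (h.inv hword hi).agree h1⟩

end Positions

/-! ### The sets `J_w` -/

section Representatives

variable {K V A : Type*} [DivisionRing K] {D : SCData K V A} {S : D.SignChoice}
  {w : D.Word} {i j : ℤ} {p : Σ _ : V, (ℕ → Option D.Letter) × (ℕ → Option D.Letter)}

theorem center_of_full (hs : w.shape = .full) : center w = -1 := by rw [center, hs]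

theorem mem_index_of_full (hs : w.shape = .full) (i : ℤ) : i ∈ w.shape.index := by
  rw [hs]
  trivial

/-- The word `w` is its own reflection in a symmetry. -/
theorem agree_inv_of_isSymmetry (hD : D.IsClannish) (hw : S.IsWord w) (hs : w.shape = .full)
    {c : ℤ} (hc : IsSymmetry w c) (i : ℤ) : S.Agree (S.inv w) (-1 - i) w (2 * c - 1 - i) := by
  obtain ⟨⟨s, hs', hl⟩, hsym⟩ := hc
  have key : S.Agree (S.inv w) (-1 - (c - 1)) w c := by
    obtain ⟨h1, h2, h3, h4⟩ := agree_swap hw (mem_index_of_full hs (c - 1))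
    rw [center_of_full hs] at h1 h2 h3 h4
    refine ⟨?_, ?_, ?_, h4.trans hsym⟩
    · rw [h1, hw.vertex_left hl, hw.vertex_right hl]
      exact congrArg some (hD.special_loop s hs')
    · rw [h2, hw.sgnAt_left hl, hw.sgnAt_right hl]
      rfl
    · rw [h3]
      funext k
      cases k with
      | zero => rw [after_zero, hl, before_zero_of_some hl]; rfl
      | succ k =>
        exact (congrFun (after_succ w c) k).trans
          ((congrFun hsym.symm k).trans (congrFun (before_succ w c) k).symm)
  have := key.add (hw.inv hD) hw (mem_index_of_full (by rw [inv_shape, hs]) _)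
    (mem_index_of_full hs _) (c - 1 - i) (mem_index_of_full (by rw [inv_shape, hs]) _)
  rwa [show -1 - (c - 1) + (c - 1 - i) = -1 - i by ring,
    show c + (c - 1 - i) = 2 * c - 1 - i by ring] at this

/-- Every reflection of `w` is the reflection in a symmetry. -/
theorem exists_isSymmetry (hD : D.IsClannish) (hw : S.IsWord w) (hs : w.shape = .full)
    (h : S.Agree (S.inv w) (-1 - i) w j) : ∃ c, 2 * c = i + j + 1 ∧ IsSymmetry w c := by
  have hadd := fun t => h.add (hw.inv hD) hw (mem_index_of_full (by rw [inv_shape, hs]) _)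
    (mem_index_of_full hs _) t (mem_index_of_full (by rw [inv_shape, hs]) _)
  -- A reflection with i + j = 2t would fix the position t while exchanging the opposite signs of
  -- its two rays. So i + j is odd, and the reflection fixes the letter t + 1, which equals its own
  -- inverse and is therefore a *-letter.
  rcases Int.even_or_odd' (i + j) with ⟨t, ht | ht⟩
  · have h1 := (hadd (t - j)).sgn
    rw [show -1 - i + (t - j) = -1 - t by linarith, add_sub_cancel, ← center_of_full hs,
      (agree_swap hw (mem_index_of_full hs t)).2.1] at h1
    exact absurd h1.symm (by
      rcases Int.units_eq_one_or (S.sgnAt w t) with h2 | h2 <;> rw [h2] <;> decide)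
  · have h1 := hadd (t + 1 - j)
    rw [show -1 - i + (t + 1 - j) = -1 - (t + 1 - 1) by linarith, add_sub_cancel] at h1
    obtain ⟨-, -, -, h4⟩ := agree_swap hw (mem_index_of_full hs (t + 1 - 1))
    rw [center_of_full hs] at h4
    refine ⟨t + 1, by linarith, ?_, h4.symm.trans h1.after⟩
    obtain ⟨l, hl⟩ := hw.exists_letter (mem_index_of_full hs (t + 1)) (mem_index_of_full hs _)
    have h5 := h1.letter 0
    rw [inv_letter, center_of_full hs, show (-1 + 1 - (-1 - (t + 1 - 1) + 0) : ℤ) = t + 1 by ring,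
      add_zero, hl, Option.map_some, Option.some.injEq] at h5
    rw [hl]
    cases l with
    | dir a ha => cases h5
    | inv a ha => cases h5
    | star s hs' => exact ⟨s, hs', rfl⟩

theorem IsBand.exists_agree (h : S.IsBand w) : ∃ n : ℕ, 0 < n ∧ ∀ i, S.Agree w i w (n + i) := by
  obtain ⟨hw, hs, ⟨n, hn, hper⟩, -⟩ := h
  refine ⟨n, hn, fun i => ?_⟩
  have := hw.agree_shift hs n i
  rwa [hper] at this

theorem isSymmetry_periodic {n : ℤ} (h : ∀ i, S.Agree w i w (n + i)) :
    Function.Periodic (IsSymmetry w) n := by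
  intro c
  have h1 := (h c).letter 0
  have h2 := (h c).after
  have h3 := (h (c - 1)).before
  rw [add_zero, add_zero] at h1
  unfold IsSymmetry
  rw [h1, h2, h3, add_comm c n, add_sub_assoc]

theorem isPair_periodic {n : ℤ} (h : ∀ i, S.Agree w i w (n + i)) :
    Function.Periodic (fun i => S.IsPair w i p) n := by
  intro i
  refine propext ⟨fun h1 => h1.agree ?_, fun h1 => h1.agree ?_⟩
  · rw [add_comm i n]
    exact (h i).symm
  · rw [add_comm i n]
    exact h i

variable (w) in
/-- The integers `a ≤ 0` and `b > 0` are the symmetries of `w` closest to `0`. -/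
structure IsSymmetryPair (a b : ℤ) : Prop where
  nonpos : a ≤ 0
  pos : 0 < b
  left : IsSymmetry w a
  right : IsSymmetry w b
  between : ∀ c, IsSymmetry w c → ¬ (a < c ∧ c < b)

/-- One symmetry exists because w⁻¹ is a shift of w. By periodicity there are symmetries on both
sides of 0, so the supremum and infimum in `J` are attained. -/
theorem IsBand.isSymmetryPair (hD : D.IsClannish) (h : S.IsBand w)
    (hsym : ∃ m : ℤ, S.inv w = S.shift w m) :
    IsSymmetryPair w (sSup {i : ℤ | i ≤ 0 ∧ IsSymmetry w i})
      (sInf {i : ℤ | 0 < i ∧ IsSymmetry w i}) := by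
  obtain ⟨n, hn, hper⟩ := h.exists_agree
  obtain ⟨hw, hs, -, -⟩ := h
  obtain ⟨m, hm⟩ := hsym
  have h1 := hw.agree_shift hs m (-1 - 0)
  rw [← hm] at h1
  obtain ⟨c, -, hc⟩ := exists_isSymmetry hD hw hs h1
  have hn' : (0 : ℤ) < n := by omega
  obtain ⟨a, ha, hca⟩ := (isSymmetry_periodic hper).exists_mem_Ico hn' c (-n)
  obtain ⟨b, hb, hcb⟩ := (isSymmetry_periodic hper).exists_mem_Ico hn' c 1
  rw [hca] at hc
  have hb' : IsSymmetry w b := by rwa [← hcb, hca]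
  have ha0 : a ≤ 0 := by
    have := ha.2
    omega
  have hb0 : 0 < b := by
    have := hb.1
    omega
  have hbdd : BddAbove {i : ℤ | i ≤ 0 ∧ IsSymmetry w i} := ⟨0, fun i hi => hi.1⟩
  have hbdd' : BddBelow {i : ℤ | 0 < i ∧ IsSymmetry w i} := ⟨0, fun i hi => hi.1.le⟩
  have h2 := Int.csSup_mem (s := {i : ℤ | i ≤ 0 ∧ IsSymmetry w i}) ⟨a, ha0, hc⟩ hbdd
  have h3 := Int.csInf_mem (s := {i : ℤ | 0 < i ∧ IsSymmetry w i}) ⟨b, hb0, hb'⟩ hbdd'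
  refine ⟨h2.1, h3.1, h2.2, h3.2, fun d hd ⟨h4, h5⟩ => ?_⟩
  rcases le_or_gt d 0 with h6 | h6
  · exact absurd (le_csSup hbdd ⟨h6, hd⟩) (not_le.mpr h4)
  · exact absurd (csInf_le hbdd' ⟨h6, hd⟩) (not_le.mpr h5)

/-- The reflections in a and b, which send j to 2a - 1 - j and 2b - 1 - j, preserve pairs, and their
composite is the translation by 2(b - a). The positions a, …, b - 1 meet every orbit. -/
theorem IsSymmetryPair.exists_isPair (hD : D.IsClannish) (hw : S.IsWord w) (hs : w.shape = .full)
    {a b : ℤ} (h : IsSymmetryPair w a b) (hp : S.IsPair w i p) :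
    ∃ j ∈ Set.Ico a b, S.IsPair w j p := by
  have hrefl : ∀ c, IsSymmetry w c → ∀ j, S.IsPair w j p → S.IsPair w (2 * c - 1 - j) p := by
    intro c hc j hj
    have h1 := hj.inv hw (mem_index_of_full hs j)
    rw [center_of_full hs] at h1
    exact h1.agree (agree_inv_of_isSymmetry hD hw hs hc j)
  have hper : Function.Periodic (fun i => S.IsPair w i p) (2 * (b - a)) := by
    intro j
    refine propext ⟨fun h1 => ?_, fun h1 => ?_⟩
    · have := hrefl a h.left _ (hrefl b h.right _ h1)
      rwa [show 2 * a - 1 - (2 * b - 1 - (j + 2 * (b - a))) = j by ring] at this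
    · have := hrefl b h.right _ (hrefl a h.left _ h1)
      rwa [show 2 * b - 1 - (2 * a - 1 - j) = j + 2 * (b - a) by ring] at this
  have hab := h.nonpos.trans_lt h.pos
  obtain ⟨j, ⟨h1, h2⟩, h3⟩ := hper.exists_mem_Ico (by omega) i a
  have h4 : S.IsPair w j p := by rwa [← h3]
  rcases lt_or_ge j b with h5 | h5
  · exact ⟨j, ⟨h1, h5⟩, h4⟩
  · exact ⟨_, ⟨by omega, by omega⟩, hrefl b h.right j h4⟩

theorem J_of_finite {n : ℕ} (hs : w.shape = .finite n) [Decidable (S.inv w = w)] :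
    S.J w = if S.inv w = w then Finset.Icc 0 ((n / 2 : ℕ) : ℤ) else Finset.Icc 0 (n : ℤ) := by
  unfold J
  split
  · rename_i n' h
    rw [hs] at h
    cases h
    congr
  · rename_i h
    rw [hs] at h
    cases h

theorem J_of_full (hs : w.shape = .full) [Decidable (∃ m : ℤ, S.inv w = S.shift w m)] :
    S.J w = if ∃ m : ℤ, S.inv w = S.shift w m then
      Finset.Ico (sSup {i : ℤ | i ≤ 0 ∧ IsSymmetry w i}) (sInf {i : ℤ | 0 < i ∧ IsSymmetry w i})
    else Finset.Ico 0 (S.period w : ℤ) := by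
  unfold J
  split
  · rename_i n' h
    rw [hs] at h
    cases h
  · congr

theorem mem_index_of_mem_J (h : i ∈ S.J w) : i ∈ w.shape.index := by
  classical
  rcases hs : w.shape with n | _
  · rw [J_of_finite hs] at h
    change 0 ≤ i ∧ i ≤ n
    split_ifs at h
    · rw [Finset.mem_Icc] at h
      omega
    · exact Finset.mem_Icc.mp h
  · trivial

theorem IsBand.period_spec (h : S.IsBand w) : 0 < S.period w ∧ S.shift w (S.period w) = w :=
  Nat.sInf_mem (s := {n : ℕ | 0 < n ∧ S.shift w n = w}) h.2.2.1

theorem shape_of_string_or_band (hw : S.IsString w ∨ S.IsBand w) :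
    (∃ n, w.shape = .finite n) ∨ S.IsBand w := hw.imp_left fun h => h.2.1

theorem IsPair.exists_mem_J (hD : D.IsClannish) (hw : S.IsString w ∨ S.IsBand w)
    (hi : i ∈ w.shape.index) (h : S.IsPair w i p) : ∃ j ∈ S.J w, S.IsPair w j p := by
  classical
  have hword := isWord_of_string_or_band hw
  rcases shape_of_string_or_band hw with ⟨n, hs⟩ | hb
  · have hi' := hi
    rw [hs] at hi'
    obtain ⟨h1, h2⟩ := hi'
    rw [J_of_finite hs]
    split_ifs with h3
    · rcases le_or_gt i (n / 2 : ℕ) with h4 | h4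
      · exact ⟨i, Finset.mem_Icc.mpr ⟨h1, h4⟩, h⟩
      -- A symmetric string is preserved by the reflection i ↦ n - i, which brings the right half
      -- into the left half.
      · refine ⟨n - i, Finset.mem_Icc.mpr ⟨by omega, by omega⟩, ?_⟩
        have h5 := h.inv hword hi
        rwa [h3, show center w = n by rw [center, hs]] at h5
    · exact ⟨i, Finset.mem_Icc.mpr ⟨h1, h2⟩, h⟩
  · have hs := hb.2.1
    rw [J_of_full hs]
    split_ifs with h3
    · obtain ⟨j, hj, hp⟩ := (hb.isSymmetryPair hD h3).exists_isPair hD hword hs h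
      exact ⟨j, Finset.mem_Ico.mpr hj, hp⟩
    · obtain ⟨h4, h5⟩ := hb.period_spec
      have hper : ∀ i, S.Agree w i w (S.period w + i) := fun i => by
        have := hword.agree_shift hs (S.period w) i
        rwa [h5] at this
      obtain ⟨j, hj, h6⟩ := (isPair_periodic (p := p) hper).exists_mem_Ico₀
        (by exact_mod_cast h4) i
      exact ⟨j, Finset.mem_Ico.mpr hj, by rwa [← h6]⟩

/-- Positions with the same pair differ by a translation or reflection preserving w. In a band, i <
j would give a translation by less than the period or a symmetry strictly between the two nearest
ones; in a string only i = j or i + j = n is possible, and the latter leaves at most one position in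
J. -/
theorem IsPair.le_of_mem_J (hD : D.IsClannish) (hw : S.IsString w ∨ S.IsBand w)
    (hi : i ∈ S.J w) (hj : j ∈ S.J w) (h : S.IsPair w i p) (h' : S.IsPair w j p) : j ≤ i := by
  classical
  have hword := isWord_of_string_or_band hw
  have hi' := mem_index_of_mem_J hi
  have hj' := mem_index_of_mem_J hj
  rcases h.agree_or h' hword hi' with h1 | h1
  · obtain ⟨h2, h3⟩ := h1.eq_shift hword hword hi' hj'
    rcases shape_of_string_or_band hw with ⟨n, hs⟩ | hb
    · rw [hs] at h3
      exact (h3.resolve_left (by simp)).ge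
    · have hs := hb.2.1
      by_contra hlt
      rw [J_of_full hs] at hi hj
      split_ifs at hi hj with h4
      · rw [Finset.mem_Ico] at hi hj
        have hsp := hb.isSymmetryPair hD h4
        refine hsp.between (sSup {i : ℤ | i ≤ 0 ∧ IsSymmetry w i} + (j - i)) ?_ ⟨?_, ?_⟩
        · have hper : ∀ k, S.Agree w k w (j - i + k) := fun k => by
            have := hword.agree_shift hs (j - i) k
            rwa [← h2] at this
          exact (isSymmetry_periodic hper _).mpr hsp.left
        · omega
        · omega
      · rw [Finset.mem_Ico] at hi hj
        have h5 : S.period w ≤ (j - i).toNat := Nat.sInf_le ⟨by omega, by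
          rw [Int.toNat_of_nonneg (by omega)]
          exact h2.symm⟩
        omega
  · obtain ⟨h2, h3⟩ := h1.eq_shift (hword.inv hD) hword
      (by rw [inv_shape]; exact center_sub_mem_index.mpr hi') hj'
    rcases shape_of_string_or_band hw with ⟨n, hs⟩ | hb
    · rw [shift_of_finite hs] at h2
      rw [inv_shape, hs, show center w = n by rw [center, hs]] at h3
      have h4 := h3.resolve_left (by simp)
      rw [J_of_finite hs, if_pos h2, Finset.mem_Icc] at hi hj
      omega
    · have hs := hb.2.1
      by_contra hlt
      rw [J_of_full hs, if_pos ⟨_, h2⟩, Finset.mem_Ico] at hi hj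
      rw [center_of_full hs] at h1
      obtain ⟨c, hc, hsym⟩ := exists_isSymmetry hD hword hs h1
      exact (hb.isSymmetryPair hD ⟨_, h2⟩).between c hsym ⟨by omega, by omega⟩

theorem IsPair.eq_of_mem_J (hD : D.IsClannish) (hw : S.IsString w ∨ S.IsBand w)
    (hi : i ∈ S.J w) (hj : j ∈ S.J w) (h : S.IsPair w i p) (h' : S.IsPair w j p) : i = j :=
  le_antisymm (h'.le_of_mem_J hD hw hj hi h) (h.le_of_mem_J hD hw hi hj h')

end Representatives

/-! ### The points and the positions in representing strings and bands -/

section Positions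

variable {K V A : Type*} [DivisionRing K] [Fintype V] {D : SCData K V A} {S : D.SignChoice}
  {M : Type*} [AddCommGroup M] [Module K M] [Module D.Alg M] [IsScalarTower K D.Alg M]
  {w : D.Word} {i : ℤ} {p : Σ _ : V, (ℕ → Option D.Letter) × (ℕ → Option D.Letter)}

theorem IsPair.num_eq (h : S.IsPair w i p) :
    S.numAt M w i = S.num M (some p.1) 1 p.2.1 p.2.2 := by
  obtain ⟨h1, ⟨h2, h3, h4⟩ | ⟨h2, h3, h4⟩⟩ := h
  · rw [numAt, h1, h2, h3, h4]
  · rw [numAt, h1, h2, h3, h4, num_swap]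

theorem IsPair.den_eq (h : S.IsPair w i p) :
    S.denAt M w i = S.den M (some p.1) 1 p.2.1 p.2.2 := by
  obtain ⟨h1, ⟨h2, h3, h4⟩ | ⟨h2, h3, h4⟩⟩ := h
  · rw [denAt, h1, h2, h3, h4]
  · rw [denAt, h1, h2, h3, h4, den_swap]

theorem IsPair.mult_eq (h : S.IsPair w i p) :
    S.mult M (w.vertex i) (S.sgnAt w i) (before w i) (after w i) =
      S.mult M (some p.1) 1 p.2.1 p.2.2 := by
  obtain ⟨h1, ⟨h2, h3, h4⟩ | ⟨h2, h3, h4⟩⟩ := h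
  · rw [h1, h2, h3, h4]
  · rw [h1, h2, h3, h4, mult_swap]

theorem IsPair.mem_points (h : S.IsPair w i p) (h' : S.IsPointAt M w i) : p ∈ S.points M := by
  obtain ⟨v, x, y⟩ := p
  refine SignChoice.mem_points.mpr ?_
  obtain ⟨h1, ⟨h2, h3, h4⟩ | ⟨h2, h3, h4⟩⟩ := h
  · rwa [IsPointAt, h1, h2, h3, h4] at h'
  · rw [IsPointAt, h1, h2, h3, h4] at h'
    exact h'.swap

variable [Module.Finite K M]

/-- Every point occurs at a position in `J_w` for a representing string or band `w`. -/
theorem IsRepresentatives.exists_position (hns : D.IsNonSingularType) (hD : D.IsClannish)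
    {Ω : Set D.Word} (hΩ : S.IsRepresentatives Ω) (hp : p ∈ S.points M) :
    ∃ w ∈ Ω, ∃ i ∈ S.J w, S.IsPair w i p := by
  obtain ⟨v, x, y⟩ := p
  obtain ⟨w, hw, i, hi, h1, h2, h3, h4⟩ :=
    (SignChoice.mem_points.mp hp).exists_string_or_band hns hD
  obtain ⟨z, hz, j, hj, h5⟩ := hΩ.exists_isPair (p := ⟨v, x, y⟩) hD hw hi
    ⟨h1, .inl ⟨h2, h3, h4⟩⟩
  obtain ⟨k, hk, h6⟩ := h5.exists_mem_J hD (hΩ.mem z hz) hj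
  exact ⟨z, hz, k, hk, h6⟩

theorem IsRepresentatives.isEndWord (hD : D.IsClannish) {Ω : Set D.Word}
    (hΩ : S.IsRepresentatives Ω) (hw : w ∈ Ω) : S.IsEndWord w :=
  isEndWord_of_string_or_band hD (hΩ.mem w hw)

/-- A pair determines the representing string or band. -/
theorem IsRepresentatives.eq_of_isPair (hD : D.IsClannish) {Ω : Set D.Word}
    (hΩ : S.IsRepresentatives Ω) {w' : D.Word} {j : ℤ} (hw : w ∈ Ω) (hw' : w' ∈ Ω)
    (hi : i ∈ w.shape.index) (hj : j ∈ w'.shape.index) (h : S.IsPair w i p)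
    (h' : S.IsPair w' j p) : w = w' :=
  have hword := (hΩ.isEndWord hD hw).toIsWord
  have hword' := (hΩ.isEndWord hD hw').toIsWord
  hΩ.eq_of_equivalent hw hw' hword' (h.equivalent hD h' hword hword' hi hj)

variable (M) in
-- A word with non-zero F carries a point, and a point determines its representing word; so finitely
-- many points leave finitely many words.
theorem IsRepresentatives.finite_support (hns : D.IsNonSingularType) (hD : D.IsClannish)
    {Ω : Set D.Word} (hΩ : S.IsRepresentatives Ω) (π : ∀ w : D.Word, D.Twist (D.canonicalWalk w)) :
    {w ∈ Ω | ¬ Subsingleton (S.F (π w) M)}.Finite := by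
  have hex : ∀ p : S.points M, ∃ w ∈ Ω, ∃ i ∈ S.J w, S.IsPair w i p.1 :=
    fun p => hΩ.exists_position hns hD p.2
  choose f hf g hg hfg using hex
  have : Finite (S.points M) := S.points_finite hns
  refine (Set.finite_range f).subset ?_
  rintro w ⟨hw, hne⟩
  have hend := hΩ.isEndWord hD hw
  have h0 := zero_mem_index w.shape
  obtain ⟨p, hp⟩ := hend.toIsWord.exists_isPair h0
  have hmem := hp.mem_points ((hend.isPointAt_iff hns hD h0 (π w)).mpr hne)
  exact ⟨⟨p, hmem⟩, hΩ.eq_of_isPair hD (hf _) hw (mem_index_of_mem_J (hg _)) h0 (hfg _) hp⟩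

variable (M) in
-- The points are in bijection with the pairs (w, i), where w in Ω has non-zero F and i lies in J_w,
-- and the multiplicity of a point is dim F at every position of w.
theorem IsRepresentatives.finrank_eq (hns : D.IsNonSingularType) (hD : D.IsClannish)
    {Ω : Set D.Word} (hΩ : S.IsRepresentatives Ω) (π : ∀ w : D.Word, D.Twist (D.canonicalWalk w)) :
    Module.finrank K M = ∑ᶠ w ∈ Ω, (S.J w).card * Module.finrank K (S.F (π w) M) := by
  have hfin := hΩ.finite_support M hns hD π
  have hpts := S.points_finite (M := M) hns
  rw [← finsum_points (S := S) (M := M) hns, finsum_mem_eq_finite_toFinset_sum _ hpts,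
    finsum_mem_eq_sum_of_inter_support_eq (t := hfin.toFinset)]
  · have hcard : ∀ w ∈ hfin.toFinset, (S.J w).card * Module.finrank K (S.F (π w) M) =
        ∑ _i ∈ S.J w, Module.finrank K (S.F (π w) M) := fun w _ => by
      rw [Finset.sum_const, smul_eq_mul]
    rw [Finset.sum_congr rfl hcard, Finset.sum_sigma']
    symm
    have hpair : ∀ a ∈ hfin.toFinset.sigma fun w => S.J w, ∃ p, S.IsPair a.1 a.2 p := by
      intro a ha
      rw [Finset.mem_sigma, Set.Finite.mem_toFinset] at ha
      exact (hΩ.isEndWord hD ha.1.1).toIsWord.exists_isPair (mem_index_of_mem_J ha.2)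
    choose f hf using hpair
    refine Finset.sum_bij f (fun a ha => ?_) (fun a ha b hb hab => ?_) (fun p hp => ?_)
      (fun a ha => ?_)
    · have h := hf a ha
      rw [Finset.mem_sigma, Set.Finite.mem_toFinset] at ha
      rw [Set.Finite.mem_toFinset]
      exact h.mem_points (((hΩ.isEndWord hD ha.1.1).isPointAt_iff hns hD
        (mem_index_of_mem_J ha.2) (π _)).mpr ha.1.2)
    · have h := hf a ha
      have h' := hf b hb
      rw [← hab] at h'
      rw [Finset.mem_sigma, Set.Finite.mem_toFinset] at ha hb
      obtain ⟨w, i⟩ := a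
      obtain ⟨w', j⟩ := b
      obtain rfl : w = w' := hΩ.eq_of_isPair hD ha.1.1 hb.1.1 (mem_index_of_mem_J ha.2)
        (mem_index_of_mem_J hb.2) h h'
      obtain rfl : i = j := h.eq_of_mem_J hD (hΩ.mem w ha.1.1) ha.2 hb.2 h'
      rfl
    · rw [Set.Finite.mem_toFinset] at hp
      obtain ⟨w, hw, i, hi, h⟩ := hΩ.exists_position hns hD hp
      have hend := hΩ.isEndWord hD hw
      have hi' := mem_index_of_mem_J hi
      have hpt : S.IsPointAt M w i := by
        refine ⟨hend.isRay_before hD hi', hend.isRay_after hi', ?_⟩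
        have h1 := hp.2.2
        rw [← h.num_eq, ← h.den_eq] at h1
        exact h1
      have ha : (⟨w, i⟩ : Σ _ : D.Word, ℤ) ∈ hfin.toFinset.sigma fun w => S.J w := by
        rw [Finset.mem_sigma, Set.Finite.mem_toFinset]
        exact ⟨⟨hw, (hend.isPointAt_iff hns hD hi' (π w)).mp hpt⟩, hi⟩
      exact ⟨⟨w, i⟩, ha, (hf _ ha).eq h⟩
    · have h := hf a ha
      rw [Finset.mem_sigma, Set.Finite.mem_toFinset] at ha
      rw [← h.mult_eq, (hΩ.isEndWord hD ha.1.1).finrank_F hns hD (mem_index_of_mem_J ha.2)]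
  · ext w
    rw [Set.mem_inter_iff, Set.mem_inter_iff, Set.Finite.coe_toFinset]
    refine ⟨fun h => ⟨⟨h.1, fun hs => h.2 ?_⟩, h.2⟩, fun h => ⟨h.1.1, h.2⟩⟩
    change _ * _ = 0
    rw [Module.finrank_zero_of_subsingleton, mul_zero]

end Positions

/-! ### Homomorphisms -/

section Homomorphisms

variable {K V A : Type*} [DivisionRing K] [Fintype V] {D : SCData K V A} {S : D.SignChoice}
  {M M' : Type*} [AddCommGroup M] [Module K M] [Module D.Alg M] [IsScalarTower K D.Alg M]
  [AddCommGroup M'] [Module K M'] [Module D.Alg M'] [IsScalarTower K D.Alg M']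
  (f : M →ₗ[D.Alg] M')

theorem map_vertexSpace {v : V} {m : M} (hm : m ∈ D.vertexSpace M v) :
    f m ∈ D.vertexSpace M' v := by
  rw [mem_vertexSpace] at hm ⊢
  rw [← map_smul, hm]

theorem map_act (l : D.Letter) {U : Submodule K M} {U' : Submodule K M'}
    (h : ∀ m ∈ U, f m ∈ U') {m : M} (hm : m ∈ l.act M U) : f m ∈ l.act M' U' := by
  cases l with
  | dir a ha =>
    obtain ⟨u, hu, rfl⟩ := hm
    exact ⟨f u, h u hu, (map_smul f (D.arr a) u).symm⟩
  | inv a ha =>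
    refine ⟨map_vertexSpace f hm.1, ?_⟩
    have := h _ hm.2
    rw [arrMap_apply, map_smul] at this
    exact this
  | star s hs =>
    obtain ⟨u, hu, rfl⟩ := hm
    exact ⟨f u, h u hu, (map_smul f (D.arr s) u).symm⟩

theorem map_plus (d : ℕ) {v : V} {ε : ℤˣ} {x : ℕ → Option D.Letter} {m : M}
    (hm : m ∈ S.plus M d (some v) ε x) : f m ∈ S.plus M' d (some v) ε x := by
  induction d generalizing v ε x m with
  | zero => exact map_vertexSpace f hm
  | succ d ih =>
    cases h0 : x 0 with
    | none =>
      rw [plus_succ_of_none h0] at hm ⊢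
      refine ⟨map_vertexSpace f hm.1, fun a ha h1 h2 => ?_⟩
      rw [← map_smul, hm.2 a ha h1 h2, map_zero]
    | some l =>
      rw [plus_succ_of_some h0] at hm ⊢
      exact map_act f l (fun _ => ih) hm

theorem map_minus (d : ℕ) {v : V} {ε : ℤˣ} {x : ℕ → Option D.Letter} {m : M}
    (hm : m ∈ S.minus M d (some v) ε x) : f m ∈ S.minus M' d (some v) ε x := by
  induction d generalizing v ε x m with
  | zero =>
    rw [minus_zero, Submodule.mem_bot] at hm ⊢
    rw [hm, map_zero]
  | succ d ih =>
    cases h0 : x 0 with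
    | none =>
      rw [minus_succ_of_none h0] at hm ⊢
      exact S.map_oneMinus f v ε hm
    | some l =>
      rw [minus_succ_of_some h0] at hm ⊢
      exact map_act f l (fun _ => ih) hm

theorem map_plusInf {v : V} {ε : ℤˣ} {x : ℕ → Option D.Letter} {m : M}
    (hm : m ∈ S.plusInf M (some v) ε x) : f m ∈ S.plusInf M' (some v) ε x :=
  (Submodule.mem_iInf _).mpr fun d => map_plus f d (plusInf_le d _ _ _ hm)

theorem map_minusInf {v : V} {ε : ℤˣ} {x : ℕ → Option D.Letter} {m : M}
    (hm : m ∈ S.minusInf M (some v) ε x) : f m ∈ S.minusInf M' (some v) ε x := by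
  obtain ⟨d, hd⟩ := mem_minusInf.mp hm
  exact le_minusInf d _ _ _ (map_minus f d hd)

theorem Top.val_map {C : D.Walk} {T : D.Twist C} (θ : Top T M) (i : ℤ) :
    (Top.map T f θ).val i = f (θ.val i) := by
  by_cases h : i ∈ C.shape.index
  · rw [Top.val_of_mem _ h, Top.val_of_mem _ h, Top.map_hom]
  · rw [Top.val_of_notMem _ h, Top.val_of_notMem _ h, map_zero]

variable [Module.Finite K M] [Module.Finite K M']

/-- If `F_C(f)` is injective, then `f` is injective on the subquotients for the word. -/
theorem IsEndWord.mem_denAt_of_map (hns : D.IsNonSingularType) (hD : D.IsClannish) {w : D.Word}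
    (hw : S.IsEndWord w) {T : D.Twist (D.canonicalWalk w)}
    (hinj : Function.Injective (S.Fmap T f)) {i : ℤ} (hi : i ∈ w.shape.index) {m : M}
    (hm : m ∈ S.numAt M w i) (hfm : f m ∈ S.denAt M' w i) : m ∈ S.denAt M w i := by
  obtain ⟨θ, rfl⟩ := hw.exists_val T hns hD hi hm
  rw [← Top.val_map, ← hw.mem_B_iff hns hD hi, ← Submodule.Quotient.mk_eq_zero] at hfm
  rw [← hw.mem_B_iff hns hD hi, ← Submodule.Quotient.mk_eq_zero]
  refine hinj ?_
  rw [map_zero]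
  exact hfm

theorem IsRepresentatives.injective (hns : D.IsNonSingularType) (hD : D.IsClannish)
    {Ω : Set D.Word} (hΩ : S.IsRepresentatives Ω) (π : ∀ w : D.Word, D.Twist (D.canonicalWalk w))
    (h : ∀ w ∈ Ω, Function.Injective (S.Fmap (π w) f)) : Function.Injective f := by
  have key : ∀ v, ∀ m ∈ D.vertexSpace M v, f m = 0 → m = 0 := by
    intro v m hm hfm
    by_contra hm0
    -- m itself may vanish in every subquotient of the common refinement, so it is first replaced by
    -- a representative m' modulo x^- that does not.
    obtain ⟨x, hx, y, hy, m', hm', hlo, hden⟩ := (isIntervalFlag (S := S) hns v (-1)).exists_refined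
      (isIntervalFlag (S := S) hns v 1) hm hm0
    have hp : (⟨v, x, y⟩ : Σ _ : V, (ℕ → Option D.Letter) × (ℕ → Option D.Letter)) ∈
      S.points M := ⟨hx, hy, fun hle => hden (hle hm')⟩
    obtain ⟨w, hw, i, hi, hpair⟩ := hΩ.exists_position hns hD hp
    refine hden ?_
    have h1 := (hΩ.isEndWord hD hw).mem_denAt_of_map f hns hD (h w hw) (mem_index_of_mem_J hi)
      (m := m')
    rw [hpair.num_eq, hpair.den_eq, hpair.den_eq] at h1
    -- Since f m = 0, the image of m' is minus that of m - m', which lies in x^-; so f m' falls into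
    -- the second summand x^- ∩ y^+ of the denominator.
    refine h1 hm' (Submodule.mem_sup_right ⟨?_, map_plusInf f hm'.2⟩)
    have h2 := map_minusInf f hlo
    rw [map_sub, hfm, zero_sub, neg_mem_iff] at h2
    exact h2
  rw [injective_iff_map_eq_zero]
  intro m hm
  rw [← one_smul D.Alg m, ← sum_e, Finset.sum_smul]
  refine Finset.sum_eq_zero fun v _ => key v _ (e_smul_mem v m) ?_
  rw [map_smul, hm, smul_zero]

end Homomorphisms

end SignChoice

end SCData

theorem mainTheorem4 {K V A : Type*} [DivisionRing K] [Fintype V] [Finite A]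
    (D : SCData K V A) (hD : D.IsClannish) (hnormal : D.IsNormallyBound)
    (hnonsing : D.IsNonSingularType) (hsemisimple : D.IsSemisimpleType)
    (S : D.SignChoice) (Ω : Set D.Word) (hΩ : S.IsRepresentatives Ω)
    (π : ∀ w : D.Word, D.Twist (D.canonicalWalk w))
    {M M' : Type*} [AddCommGroup M] [Module K M] [Module D.Alg M] [IsScalarTower K D.Alg M]
    [Module.Finite K M]
    [AddCommGroup M'] [Module K M'] [Module D.Alg M'] [IsScalarTower K D.Alg M']
    [Module.Finite K M']
    (θ : M →ₗ[D.Alg] M') :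
    ((∀ w ∈ Ω, Module.Finite K (S.F (π w) M)) ∧
      {w ∈ Ω | ¬ Subsingleton (S.F (π w) M)}.Finite ∧
      Module.finrank K M = ∑ᶠ w ∈ Ω, (S.J w).card * Module.finrank K (S.F (π w) M)) ∧
    ((∀ w ∈ Ω, Function.Bijective (S.Fmap (π w) θ)) → Function.Bijective θ) := by
  refine ⟨⟨fun w hw => (hΩ.isEndWord hD hw).finite_F hnonsing hD,
    hΩ.finite_support M hnonsing hD π, hΩ.finrank_eq M hnonsing hD π⟩, fun h => ?_⟩
  have hinj := hΩ.injective θ hnonsing hD π fun w hw => (h w hw).1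
  refine ⟨hinj, ?_⟩
  let g : M →ₗ[K] M' :=
    { toFun := θ
      map_add' := map_add θ
      map_smul' := fun c x => by
        rw [← SCData.scalar_smul (D := D), map_smul, SCData.scalar_smul, RingHom.id_apply] }
  -- Surjectivity comes from counting: by the dimension formula both dimensions are the same sum,
  -- term by term.
  have hrank : Module.finrank K M = Module.finrank K M' := by
    rw [hΩ.finrank_eq M hnonsing hD π, hΩ.finrank_eq M' hnonsing hD π]
    refine finsum_mem_congr rfl fun w hw => ?_
    rw [(LinearEquiv.ofBijective (S.Fmap (π w) θ) (h w hw)).finrank_eq]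
  exact (LinearMap.injective_iff_surjective_of_finrank_eq_finrank (f := g) hrank).mp hinj
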